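/- Let $\mathbb K=\mathbb R$ or $\mathbb K=\mathbb C$, let $S^1=\mathbb R/\mathbb Z$ with coordinate $x$, and let $\mathrm{Diff}(S^1)$ be the group of orientation-preserving smooth diffeomorphisms of $S^1$. For $\lambda\in\mathbb K$ let $\mathcal F_\lambda$ be the space of $\lambda$-densities $\phi(x)(dx)^\lambda$ with $\phi\in C^\infty(S^1,\mathbb K)$, on which $f\in\mathrm{Diff}(S^1)$ acts by $\rho^\lambda_{f^{-1}}\colon \phi\,(dx)^\lambda\mapsto (f')^\lambda\,(\phi\circ f)\,(dx)^\lambda$. For $\lambda,\mu\in\mathbb K$ let $\mathcal D^4_{\lambda,\mu}(S^1)$ be the space of linear differential operators $A=\sum_{i=0}^4 a_i(x)\frac{d^i}{dx^i}\colon\mathcal F_\lambda\to\mathcal F_\mu$ of order at most $4$ with coefficients $a_i\in C^\infty(S^1,\mathbb K)$, with the action $f\cdot A=\rho^\mu_f\circ A\circ\rho^\lambda_{f^{-1}}$ of $\mathrm{Diff}(S^1)$. Let $\mathcal I^4_{\lambda,\mu}(S^1)$ be the algebra, under composition, of all $\mathbb K$-linear maps $T\colon\mathcal D^4_{\lambda,\mu}(S^1)\to\mathcal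 D^4_{\lambda,\mu}(S^1)$ that commute with this action (no locality or continuity is assumed). Write $\mathbb K^n$ for the direct sum of $n$ copies of the algebra $\mathbb K$, let $\mathfrak a$ be the algebra of matrices $\begin{pmatrix}a&0\\ b&a\end{pmatrix}$ and $\mathfrak b$ the algebra of matrices $$\begin{pmatrix}a&0&0&d\\0&a&0&0\\0&c&b&0\\0&0&0&b\end{pmatrix},$$ with entries $a,b,c,d\in\mathbb K$. Isomorphisms below are isomorphisms of unital associative $\mathbb K$-algebras. Theorem. The algebra $\mathcal I^4_{\lambda,\mu}(S^1)$ is trivial, that is, equal to $\mathbb K\cdot\mathrm{Id}$, for all $(\lambda,\mu)\in\mathbb K^2$ except in the following cases. 1. $\mathcal I^4_{\lambda,\mu}(S^1)\cong\mathbb K^2$ if $\lambda+\mu=1$ and $\lambda\neq0,-\frac23$; or $\lambda=0$ and $\mu\neq3,\frac54,1,0$; or $\mu=1$ and $\lambda\neq1,0,-\frac14,-2$. 2. $\mathcal I^4_{\lambda,\mu}(S^1)\cong\mathbb K^3$ if $(\lambda,\mu)$ is one of $(1,1)$, $(0,\frac54)$, $(0,0)$, $(-\frac14,1)$, $(-\frac23,\frac53)$.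 3. $\mathcal I^4_{0,3}(S^1)\cong\mathcal I^4_{-2,1}(S^1)\cong\mathfrak a\oplus\mathbb K$. 4. $\mathcal I^4_{0,1}(S^1)\cong\mathfrak b\oplus\mathbb K^2$. 5. If $\mathbb K=\mathbb C$: $\mathcal I^4_{\lambda,\mu}(S^1)\cong\mathfrak a$ for the two non-real pairs $(\lambda,\mu)=\left(\frac{-1\pm i}{2},\frac{3\pm i}{2}\right)$ (equal signs), that is, $2\lambda^2+2\lambda+1=0$ and $\mu=\lambda+2$. -/

import Mathlib

open scoped ContDiff

noncomputable section

namespace CircleDO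

/-! The circle is `S¹ = ℝ/ℤ`, with its standard coordinate `x`. The ground field `𝕜` is `ℝ` or `ℂ`. -/

section Functions

variable (𝕜 : Type*) [RCLike 𝕜]

/-- `C^∞(S¹)`: the algebra of smooth `𝕜`-valued functions on `S¹ = ℝ/ℤ`, that is, of smooth
functions on `ℝ` of period `1`. -/
def SmoothFun : Subalgebra 𝕜 (ℝ → 𝕜) where
  carrier := {φ | ContDiff ℝ ∞ φ ∧ Function.Periodic φ 1}
  mul_mem' hφ hψ := ⟨hφ.1.mul hψ.1, hφ.2.mul hψ.2⟩
  add_mem' hφ hψ := ⟨hφ.1.add hψ.1, hφ.2.add hψ.2⟩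
  algebraMap_mem' _ := ⟨contDiff_const, fun _ => rfl⟩

/-- The derivative `d/dx : C^∞(S¹) → C^∞(S¹)`. -/
def ddx : Module.End 𝕜 (SmoothFun 𝕜) where
  toFun φ := ⟨deriv φ.1, by
    refine ⟨(contDiff_infty_iff_deriv.1 φ.2.1).2, fun x => ?_⟩
    rw [← deriv_comp_add_const]
    exact congrArg (fun g => deriv g x) (funext φ.2.2)⟩
  map_add' φ ψ := by
    ext x
    exact deriv_add ((φ.2.1.differentiable (by simp)) x) ((ψ.2.1.differentiable (by simp)) x)
  map_smul' c φ := by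
    ext x
    exact deriv_const_smul c ((φ.2.1.differentiable (by simp)) x)

/-- Multiplication by a function `a`, as a zeroth-order differential operator. -/
abbrev mulOp (a : SmoothFun 𝕜) : Module.End 𝕜 (SmoothFun 𝕜) := LinearMap.mulLeft 𝕜 a

/-- The space of linear differential operators `a_k dᵏ/dxᵏ + ⋯ + a_1 d/dx + a_0` of order at most
`k` on the circle. Since `φ(x) (dx)^λ ↔ φ(x)` identifies `λ`-densities with functions, this is the
vector space underlying `𝒟ᵏ_{λ,μ}(S¹)` for all weights; the weights enter in the group action. -/
def DiffOp (k : ℕ) : Submodule 𝕜 (Module.End 𝕜 (SmoothFun 𝕜)) where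
  carrier := {A | ∃ a : Fin (k + 1) → SmoothFun 𝕜, A = ∑ i, mulOp 𝕜 (a i) * ddx 𝕜 ^ (i : ℕ)}
  zero_mem' := ⟨0, by ext; simp⟩
  add_mem' := by
    rintro _ _ ⟨a, rfl⟩ ⟨b, rfl⟩
    refine ⟨a + b, ?_⟩
    rw [← Finset.sum_add_distrib]
    refine Finset.sum_congr rfl fun i _ => ?_
    ext φ : 1
    simp [add_mul]
  smul_mem' := by
    rintro c _ ⟨a, rfl⟩
    refine ⟨c • a, ?_⟩
    rw [Finset.smul_sum]
    refine Finset.sum_congr rfl fun i _ => ?_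
    ext φ : 1
    simp

end Functions

/-- Orientation-preserving diffeomorphisms of `S¹ = ℝ/ℤ`, given by their lifts to `ℝ`: a smooth
bijection `f` of `ℝ` with smooth inverse, with `f (x + 1) = f x + 1` and `f' > 0`. Each
orientation-preserving diffeomorphism of the circle has such lifts, any two differ by an integer
translation, and integer translations act trivially on periodic functions. -/
structure CircleDiffeo extends ℝ ≃ ℝ where
  contDiff_toFun : ContDiff ℝ ∞ toFun
  contDiff_invFun : ContDiff ℝ ∞ invFun
  map_add_one : ∀ x, toFun (x + 1) = toFun x + 1
  deriv_pos : ∀ x, 0 < deriv toFun x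

/-- The inverse diffeomorphism. -/
def CircleDiffeo.inv (f : CircleDiffeo) : CircleDiffeo where
  toEquiv := f.toEquiv.symm
  contDiff_toFun := f.contDiff_invFun
  contDiff_invFun := f.contDiff_toFun
  map_add_one x := by
    apply f.toEquiv.injective
    have h := f.map_add_one (f.toEquiv.symm x)
    change f.toEquiv (f.toEquiv.symm (x + 1)) = f.toEquiv (f.toEquiv.symm x + 1)
    change f.toEquiv (f.toEquiv.symm x + 1) = f.toEquiv (f.toEquiv.symm x) + 1 at h
    rw [h]; simp
  deriv_pos x := by
    have h1 : HasDerivAt f.toFun (deriv f.toFun (f.invFun x)) (f.invFun x) :=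
      ((f.contDiff_toFun.differentiable (by simp)) _).hasDerivAt
    have h2 : HasDerivAt f.invFun (deriv f.invFun x) x :=
      ((f.contDiff_invFun.differentiable (by simp)) _).hasDerivAt
    have h3 := h1.comp x h2
    have h4 : f.toFun ∘ f.invFun = id := funext f.right_inv
    rw [h4] at h3
    have h5 := h3.unique (hasDerivAt_id x)
    have h6 := f.deriv_pos (f.invFun x)
    exact pos_of_mul_pos_right (h5 ▸ one_pos) h6.le

section Action

variable {𝕜 : Type*} [RCLike 𝕜]

/-- The composition `φ ↦ φ ∘ f`. -/
def compOp (f : CircleDiffeo) : Module.End 𝕜 (SmoothFun 𝕜) where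
  toFun φ := ⟨fun x => φ.1 (f.toFun x), φ.2.1.comp f.contDiff_toFun, fun x => by
    change φ.1 (f.toFun (x + 1)) = φ.1 (f.toFun x)
    rw [f.map_add_one, φ.2.2]⟩
  map_add' _ _ := rfl
  map_smul' _ _ := rfl

lemma contDiff_deriv (f : CircleDiffeo) : ContDiff ℝ ∞ (deriv f.toFun) :=
  (contDiff_infty_iff_deriv.1 f.contDiff_toFun).2

lemma periodic_deriv (f : CircleDiffeo) : Function.Periodic (deriv f.toFun) 1 := fun x => by
  rw [← deriv_comp_add_const]
  have h : (fun x => f.toFun (x + 1)) = fun x => f.toFun x + 1 := funext f.map_add_one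
  rw [h, deriv_add_const]

/-- The function `(f')^lam = exp (lam * log f')` on the circle (recall `f' > 0`). -/
def jacPow (f : CircleDiffeo) (lam : 𝕜) : SmoothFun 𝕜 :=
  ⟨fun x => NormedSpace.exp (lam * ((Real.log (deriv f.toFun x) : ℝ) : 𝕜)), by
    constructor
    · have h1 : ContDiff ℝ ∞ (NormedSpace.exp : 𝕜 → 𝕜) :=
        contDiff_iff_contDiffAt.2 fun x => (NormedSpace.exp_analytic (𝕂 := ℝ) x).contDiffAt
      have h2 : ContDiff ℝ ∞ fun x => Real.log (deriv f.toFun x) :=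
        (contDiff_deriv f).log fun x => (f.deriv_pos x).ne'
      have h3 : ContDiff ℝ ∞ fun x => ((Real.log (deriv f.toFun x) : ℝ) : 𝕜) :=
        (RCLike.ofRealCLM (K := 𝕜)).contDiff.comp h2
      exact h1.comp (contDiff_const.mul h3)
    · intro x
      simp only [periodic_deriv f x]⟩

/-- The natural action of `f` on the densities of weight `lam`,
`φ(x) (dx)^lam ↦ ((f⁻¹)')^lam φ(f⁻¹(x)) (dx)^lam`. -/
def densityAct (f : CircleDiffeo) (lam : 𝕜) : Module.End 𝕜 (SmoothFun 𝕜) :=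
  mulOp 𝕜 (jacPow f.inv lam) * compOp f.inv

/-! The next lemmas show that the action on operators preserves the order. -/

lemma mulOp_mul (a b : SmoothFun 𝕜) : mulOp 𝕜 a * mulOp 𝕜 b = mulOp 𝕜 (a * b) := by
  ext φ : 1
  simp

lemma monomial_mem {i k : ℕ} (h : i ≤ k) (a : SmoothFun 𝕜) :
    mulOp 𝕜 a * ddx 𝕜 ^ i ∈ DiffOp 𝕜 k := by
  refine ⟨Pi.single ⟨i, Nat.lt_succ_of_le h⟩ a, ?_⟩
  rw [Finset.sum_eq_single (⟨i, Nat.lt_succ_of_le h⟩ : Fin (k + 1))]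
  · simp
  · intro j _ hj
    ext φ : 1
    simp [Pi.single_eq_of_ne hj]
  · simp

lemma diffOp_mono {i k : ℕ} (h : i ≤ k) : DiffOp 𝕜 i ≤ DiffOp 𝕜 k := by
  rintro _ ⟨a, rfl⟩
  exact Submodule.sum_mem _ fun j _ => monomial_mem (by omega) _

lemma mulOp_mul_mem {k : ℕ} (c : SmoothFun 𝕜) {B : Module.End 𝕜 (SmoothFun 𝕜)}
    (hB : B ∈ DiffOp 𝕜 k) : mulOp 𝕜 c * B ∈ DiffOp 𝕜 k := by
  obtain ⟨a, rfl⟩ := hB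
  rw [Finset.mul_sum]
  refine Submodule.sum_mem _ fun j _ => ?_
  rw [← mul_assoc, mulOp_mul]
  exact monomial_mem (by omega) _

lemma ddx_mul_mulOp (a : SmoothFun 𝕜) :
    ddx 𝕜 * mulOp 𝕜 a = mulOp 𝕜 (ddx 𝕜 a) + mulOp 𝕜 a * ddx 𝕜 := by
  ext φ x
  exact deriv_mul ((a.2.1.differentiable (by simp)) x) ((φ.2.1.differentiable (by simp)) x)

lemma ddx_mul_mem {k : ℕ} {B : Module.End 𝕜 (SmoothFun 𝕜)} (hB : B ∈ DiffOp 𝕜 k) :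
    ddx 𝕜 * B ∈ DiffOp 𝕜 (k + 1) := by
  obtain ⟨a, rfl⟩ := hB
  rw [Finset.mul_sum]
  refine Submodule.sum_mem _ fun j _ => ?_
  rw [← mul_assoc, ddx_mul_mulOp, add_mul, mul_assoc, ← pow_succ']
  exact Submodule.add_mem _ (monomial_mem (by omega) _) (monomial_mem (by omega) _)

lemma compOp_mul_mulOp (f : CircleDiffeo) (a : SmoothFun 𝕜) :
    compOp f * mulOp 𝕜 a = mulOp 𝕜 (compOp f a) * compOp f := rfl

lemma compOp_inv_apply (f : CircleDiffeo) (φ : SmoothFun 𝕜) :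
    compOp f (compOp f.inv φ) = φ := by
  ext x
  exact congrArg φ.1 (f.left_inv x)

lemma compOp_inv_mul (f : CircleDiffeo) :
    compOp f.inv * compOp f = (1 : Module.End 𝕜 (SmoothFun 𝕜)) := by
  ext φ x
  exact congrArg φ.1 (f.right_inv x)

lemma ddx_mul_compOp (f : CircleDiffeo) :
    ∃ c : SmoothFun 𝕜, ddx 𝕜 * compOp f = compOp f * (mulOp 𝕜 c * ddx 𝕜) := by
  let d : SmoothFun 𝕜 := ⟨fun x => ((deriv f.toFun x : ℝ) : 𝕜),
    (RCLike.ofRealCLM (K := 𝕜)).contDiff.comp (contDiff_deriv f), fun x => by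
      simp only [periodic_deriv f x]⟩
  refine ⟨compOp f.inv d, ?_⟩
  rw [← mul_assoc, compOp_mul_mulOp, compOp_inv_apply]
  ext φ x
  have h1 : HasDerivAt f.toFun (deriv f.toFun x) x :=
    ((f.contDiff_toFun.differentiable (by simp)) x).hasDerivAt
  have h2 : HasDerivAt φ.1 (deriv φ.1 (f.toFun x)) (f.toFun x) :=
    ((φ.2.1.differentiable (by simp)) _).hasDerivAt
  have h3 := (h2.scomp x h1).deriv
  rw [RCLike.real_smul_eq_coe_mul] at h3
  exact h3

lemma pow_mul_compOp (f : CircleDiffeo) (w : SmoothFun 𝕜) (i : ℕ) :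
    ∃ B ∈ DiffOp 𝕜 i, ddx 𝕜 ^ i * (mulOp 𝕜 w * compOp f) = compOp f * B := by
  induction i with
  | zero =>
    refine ⟨mulOp 𝕜 (compOp f.inv w), ?_, ?_⟩
    · have h := monomial_mem le_rfl (compOp f.inv w) (i := 0)
      rwa [pow_zero, mul_one] at h
    · rw [← mul_assoc, compOp_mul_mulOp, compOp_inv_apply, pow_zero, one_mul]
  | succ i ih =>
    obtain ⟨B, hB, h⟩ := ih
    obtain ⟨c, hc⟩ := ddx_mul_compOp (𝕜 := 𝕜) f
    refine ⟨mulOp 𝕜 c * (ddx 𝕜 * B), mulOp_mul_mem _ (ddx_mul_mem hB), ?_⟩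
    rw [pow_succ', mul_assoc, h, ← mul_assoc, hc]
    simp only [mul_assoc]

lemma circleDiffeo_inv_inv (f : CircleDiffeo) : f.inv.inv = f := rfl

lemma conj_mem (f : CircleDiffeo) (lam mu : 𝕜) {k : ℕ} {A : Module.End 𝕜 (SmoothFun 𝕜)}
    (hA : A ∈ DiffOp 𝕜 k) : densityAct f mu * A * densityAct f.inv lam ∈ DiffOp 𝕜 k := by
  obtain ⟨a, rfl⟩ := hA
  rw [Finset.mul_sum, Finset.sum_mul]
  refine Submodule.sum_mem _ fun j _ => ?_
  obtain ⟨B, hB, h⟩ := pow_mul_compOp f (jacPow f lam) (j : ℕ)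
  have key : densityAct f mu * (mulOp 𝕜 (a j) * ddx 𝕜 ^ (j : ℕ)) * densityAct f.inv lam
      = mulOp 𝕜 (jacPow f.inv mu) * (mulOp 𝕜 (compOp f.inv (a j)) * B) := by
    calc _ = mulOp 𝕜 (jacPow f.inv mu) * ((compOp f.inv * mulOp 𝕜 (a j)) *
          (ddx 𝕜 ^ (j : ℕ) * (mulOp 𝕜 (jacPow f lam) * compOp f))) := by
            simp only [densityAct, circleDiffeo_inv_inv, mul_assoc]
      _ = mulOp 𝕜 (jacPow f.inv mu) * (mulOp 𝕜 (compOp f.inv (a j)) *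
          ((compOp f.inv * compOp f) * B)) := by
            rw [h, compOp_mul_mulOp]
            simp only [mul_assoc]
      _ = _ := by rw [compOp_inv_mul, one_mul]
  rw [key]
  exact mulOp_mul_mem _ (mulOp_mul_mem _ (diffOp_mono (by omega) hB))

/-- The action of `f` on the differential operators of order at most `k` from `lam`-densities to
`mu`-densities: `A ↦ ρ^mu_f ∘ A ∘ ρ^lam_{f⁻¹}`. -/
def diffOpAct (k : ℕ) (lam mu : 𝕜) (f : CircleDiffeo) : Module.End 𝕜 (DiffOp 𝕜 k) where
  toFun A := ⟨densityAct f mu * A.1 * densityAct f.inv lam, conj_mem f lam mu A.2⟩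
  map_add' A B := by
    ext1
    simp [mul_add, add_mul]
  map_smul' c A := by
    ext1
    simp

/-- The algebra of symmetries `ℐᵏ_{λ,μ}(S¹)`: all `𝕜`-linear maps `T : 𝒟ᵏ_{λ,μ} → 𝒟ᵏ_{λ,μ}`, local
or not, that commute with the action of the diffeomorphism group. The product is composition. -/
def SymmetryAlgebra (k : ℕ) (lam mu : 𝕜) : Subalgebra 𝕜 (Module.End 𝕜 (DiffOp 𝕜 k)) :=
  Subalgebra.centralizer 𝕜 (Set.range (diffOpAct k lam mu))

end Action

section Matrices

variable (𝕜 : Type*) [RCLike 𝕜]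

/-- The algebra `𝔞` of matrices `(a 0; b a)`. -/
def AlgA : Subalgebra 𝕜 (Matrix (Fin 2) (Fin 2) 𝕜) where
  carrier := {M | ∃ a b : 𝕜, M = !![a, 0; b, a]}
  mul_mem' := by
    rintro _ _ ⟨a, b, rfl⟩ ⟨a', b', rfl⟩
    refine ⟨a * a', b * a' + a * b', ?_⟩
    simp
  add_mem' := by
    rintro _ _ ⟨a, b, rfl⟩ ⟨a', b', rfl⟩
    exact ⟨a + a', b + b', by simp⟩
  algebraMap_mem' c := ⟨c, 0, by
    ext i j
    fin_cases i <;> fin_cases j <;> simp [Matrix.algebraMap_matrix_apply]⟩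

/-- The algebra `𝔟` of matrices `(a 0 0 d; 0 a 0 0; 0 c b 0; 0 0 0 b)`. -/
def AlgB : Subalgebra 𝕜 (Matrix (Fin 4) (Fin 4) 𝕜) where
  carrier := {M | ∃ a b c d : 𝕜, M = !![a, 0, 0, d; 0, a, 0, 0; 0, c, b, 0; 0, 0, 0, b]}
  mul_mem' := by
    rintro _ _ ⟨a, b, c, d, rfl⟩ ⟨a', b', c', d', rfl⟩
    refine ⟨a * a', b * b', c * a' + b * c', a * d' + d * b', ?_⟩
    ext i j
    fin_cases i <;> fin_cases j <;> simp [Matrix.mul_apply, Fin.sum_univ_four]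
  add_mem' := by
    rintro _ _ ⟨a, b, c, d, rfl⟩ ⟨a', b', c', d', rfl⟩
    refine ⟨a + a', b + b', c + c', d + d', ?_⟩
    ext i j
    fin_cases i <;> fin_cases j <;> simp
  algebraMap_mem' r := ⟨r, r, 0, 0, by
    ext i j
    fin_cases i <;> fin_cases j <;> simp [Matrix.algebraMap_matrix_apply]⟩

end Matrices

end CircleDO

end

/-! An operator is recorded by its five coefficients. With `δ = mu - lam`, pulling back along `f`
turns the coefficient `a_j` into `(f')^(δ - j) (a_j ∘ f)` and adds contributions of the higher
coefficients, whose factors are polynomials in `p = f''/f'` and its derivatives (`pull_ddx_pow`,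
`coeffAct`).

Locality. Let `T` be a symmetry and let `a` vanish near `0`. Diffeomorphisms supported near `0` fix
`a`, hence fix `T a`, so the values `(T a)_j(0)` are invariant under all germs at `0`. Dilations
kill every value with `δ ≠ j`. The germs `x + ε x²` and `x + ε x³` kill the remaining one, unless
`mu = lam`, `j = 0`, or `(lam, mu) = (0, 1)`, `j = 1` (`eval_zero_eq_zero`). In these two cases `a ↦
(T a)_j(0)` is a functional invariant under the diffeomorphisms that are trivial near `0`. Such a
functional vanishes on densities of weight `0`, `-1`, ..., `-4`, and is a multiple of the integral
on `1`-densities (the `CutInvariant` lemmas). Hence every symmetry is local, except that at `(0, 1)`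
a multiple of `A ↦ (∫ A(1)) d/dx` has to be subtracted first.

Shape of local symmetries. A functional on germs at `0` that is homogeneous under one linear
contraction is a multiple of a single derivative at `0`; no continuity is needed, because the
cohomological equation `b(x) - ρ b(q x) = r(x)` is solvable for flat enough `r`
(`exists_eq_deriv_of_homogeneous`). Translations carry this to all points, so a local symmetry is `a
↦ (∑ j, C i j a_j^(j - i))_i` for a constant upper triangular matrix `C` (`exists_eq_opV`).

Linear algebra. Formal vector fields vanishing to second order at `0` are generated by `x² ∂` and
`x³ ∂`. Accordingly invariance of `opV C` under all diffeomorphisms amounts to the sixteen linear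
equations coming from the germs `x + ε x²` and `x + ε x³` (`jetDefect_eq_zero`,
`jetRelations_of_jetDefect`). The entries at distance at least two from the diagonal can be
eliminated, which leaves `ReducedSystem`, in the differences of the diagonal entries and the
superdiagonal entries. If `lam (mu - 1) (lam + mu - 1) ≠ 0` the differences vanish, and a
superdiagonal entry survives only when `2 lam² + 2 lam + 1 = 0` and `δ = 2`. On the lines `lam = 0`
and `lam + mu = 1` explicit matrices exhaust the solutions, and the line `mu = 1` is the image of
`lam = 0` under the formal adjoint (`adjointEquiv`). -/

open scoped ContDiff Topology
open Filter

noncomputable section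

namespace CircleDO

/-! ### Periodic cut-offs and circle diffeomorphisms with prescribed germs. -/

section Periodize

variable {E : Type*} [NormedAddCommGroup E] [NormedSpace ℝ E]

/-- A smooth function supported in an interval shorter than `1` has a smooth periodization. -/
lemma exists_periodization (g : ℝ → E) (c r : ℝ) (hr : r < 1 / 2) (hg : ContDiff ℝ ∞ g)
    (hs : ∀ x, r ≤ |x - c| → g x = 0) :
    ∃ φ : ℝ → E, ContDiff ℝ ∞ φ ∧ Function.Periodic φ 1 ∧ ∀ x, |x - c| ≤ 1 / 2 → φ x = g x := by
  have hend : ∀ x : ℝ, |x - c| = 1 / 2 → g x = 0 := fun x hx => hs x (by rw [hx]; exact hr.le)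
  refine ⟨fun x => g (x - ⌊x - c + 1 / 2⌋), ?_, ?_, ?_⟩
  · rw [contDiff_iff_contDiffAt]
    intro x
    obtain ⟨n, hn⟩ : ∃ n : ℤ, n = ⌊x - c + 1 / 2⌋ := ⟨_, rfl⟩
    have h1 := Int.floor_le (x - c + 1 / 2)
    have h2 := Int.lt_floor_add_one (x - c + 1 / 2)
    rw [← hn] at h1 h2
    rcases h1.lt_or_eq with h1 | h1
    · have : (fun x => g (x - ⌊x - c + 1 / 2⌋)) =ᶠ[𝓝 x] fun y => g (y - n) := by
        have hI : Set.Ioo ((n : ℝ) + c - 1 / 2) (n + c + 1 / 2) ∈ 𝓝 x :=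
          Ioo_mem_nhds (by linarith) (by linarith)
        filter_upwards [hI] with y hy
        have : ⌊y - c + 1 / 2⌋ = n := Int.floor_eq_iff.2 ⟨by linarith [hy.1], by linarith [hy.2]⟩
        rw [this]
      exact (ContDiffAt.congr_of_eventuallyEq (hg.comp (contDiff_id.sub contDiff_const)).contDiffAt
        this)
    -- At a jump of the floor function both one-sided branches evaluate `g` at distance about `1/2 >
    -- r` from `c`, where it vanishes. The minimum with `1/2` keeps the neighbourhood short enough
    -- for the floor to take only the values `n - 1` and `n`, even if `r` is negative.
    · have : (fun x => g (x - ⌊x - c + 1 / 2⌋)) =ᶠ[𝓝 x] fun _ => 0 := by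
        have hI : Set.Ioo (x - min (1 / 2 - r) (1 / 2)) (x + min (1 / 2 - r) (1 / 2)) ∈ 𝓝 x :=
          Ioo_mem_nhds (by have : 0 < min (1 / 2 - r) (1 / 2) := lt_min (by linarith) (by norm_num)
                           linarith)
            (by have : 0 < min (1 / 2 - r) (1 / 2) := lt_min (by linarith) (by norm_num)
                linarith)
        filter_upwards [hI] with y hy
        have hm1 := min_le_left (1 / 2 - r) (1 / 2)
        have hm2 := min_le_right (1 / 2 - r) (1 / 2)
        rcases le_or_gt x y with hxy | hxy
        · have : ⌊y - c + 1 / 2⌋ = n :=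
            Int.floor_eq_iff.2 ⟨by linarith, by linarith [hy.2]⟩
          rw [this]
          exact hs _ (le_abs.2 (Or.inr (by linarith [hy.2])))
        · have : ⌊y - c + 1 / 2⌋ = n - 1 :=
            Int.floor_eq_iff.2 ⟨by push_cast; linarith [hy.1], by push_cast; linarith⟩
          rw [this]
          exact hs _ (le_abs.2 (Or.inl (by push_cast; linarith [hy.1])))
      exact contDiffAt_const.congr_of_eventuallyEq this
  · intro x
    have : ⌊x + 1 - c + 1 / 2⌋ = ⌊x - c + 1 / 2⌋ + 1 := by
      rw [← Int.floor_add_one]; congr 1; ring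
    simp only [this]
    push_cast
    congr 1; ring
  · intro x hx
    rcases hx.lt_or_eq with hx' | hx'
    · rw [abs_lt] at hx'
      have : ⌊x - c + 1 / 2⌋ = 0 := Int.floor_eq_iff.2 ⟨by push_cast; linarith, by
        push_cast; linarith⟩
      simp only [this, Int.cast_zero, sub_zero]
    · rw [hend x hx']
      apply hs
      rcases (abs_eq (by norm_num : (0:ℝ) ≤ 1 / 2)).1 hx' with h | h
      · have : ⌊x - c + 1 / 2⌋ = 1 := Int.floor_eq_iff.2 ⟨by push_cast; linarith, by
          push_cast; linarith⟩
        rw [this]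
        exact le_abs.2 (Or.inr (by push_cast; linarith))
      · have : ⌊x - c + 1 / 2⌋ = 0 := Int.floor_eq_iff.2 ⟨by push_cast; linarith, by
          push_cast; linarith⟩
        rw [this]
        exact le_abs.2 (Or.inr (by push_cast; linarith))

/-- Every real number is within `1/2` of `c`, up to an integer. -/
lemma exists_int_abs_sub_le (c x : ℝ) : ∃ n : ℤ, |x - n - c| ≤ 1 / 2 := by
  refine ⟨round (x - c), ?_⟩
  have := abs_sub_round (x - c)
  rwa [sub_right_comm]

lemma exists_bound_of_periodic {F : Type*} [NormedAddCommGroup F] {u : ℝ → F} (hu : Continuous u)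
    (hp : Function.Periodic u 1) :
    ∃ C, 0 < C ∧ ∀ x, ‖u x‖ ≤ C := by
  obtain ⟨C, hC⟩ := (isCompact_Icc (a := (0 : ℝ)) (b := 1)).exists_bound_of_continuousOn
    hu.continuousOn
  refine ⟨max C 1, by positivity, fun x => ?_⟩
  obtain ⟨y, hy, hxy⟩ := hp.exists_mem_Ico₀ one_pos x
  rw [hxy]
  exact (hC y ⟨hy.1, hy.2.le⟩).trans (le_max_left _ _)

/-- A smooth function near `c` extends to a smooth periodic function, with a cut-off. -/
lemma exists_periodic_cutoff (g : ℝ → E) (c r₁ r₂ : ℝ) (h₁ : 0 < r₁) (h₁₂ : r₁ < r₂)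
    (h₂ : r₂ < 1 / 2) (hg : ∀ x, |x - c| ≤ r₂ → ContDiffAt ℝ ∞ g x) :
    ∃ φ : ℝ → E, ContDiff ℝ ∞ φ ∧ Function.Periodic φ 1 ∧ (∀ x, |x - c| ≤ r₁ → φ x = g x) ∧
      ∀ x, r₂ ≤ |x - c| → |x - c| ≤ 1 / 2 → φ x = 0 := by
  let χ : ContDiffBump c := ⟨r₁, r₂, h₁, h₁₂⟩
  have h0 : ∀ x, r₂ ≤ |x - c| → χ x = 0 := fun x hx => χ.zero_of_le_dist (by
    rwa [Real.dist_eq])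
  obtain ⟨φ, hφ, hp, he⟩ := exists_periodization (fun x => χ x • g x) c r₂ h₂ (by
    rw [contDiff_iff_contDiffAt]
    intro x
    rcases le_or_gt (|x - c|) r₂ with hx | hx
    · exact χ.contDiffAt.smul (hg x hx)
    · have : (fun x => χ x • g x) =ᶠ[𝓝 x] fun _ => 0 := by
        have : ∀ᶠ y in 𝓝 x, r₂ < |y - c| :=
          (continuous_abs.comp (continuous_id.sub continuous_const)).continuousAt.eventually
            (lt_mem_nhds hx)
        filter_upwards [this] with y hy
        rw [h0 y hy.le, zero_smul]
      exact contDiffAt_const.congr_of_eventuallyEq this)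
    (fun x hx => by simp only [h0 x hx, zero_smul])
  refine ⟨φ, hφ, hp, fun x hx => ?_, fun x hx hx' => ?_⟩
  · rw [he x (by linarith), χ.one_of_mem_closedBall (by
      rwa [Metric.mem_closedBall, Real.dist_eq]), one_smul]
  · rw [he x hx', h0 x hx, zero_smul]

end Periodize

/-- The diffeomorphism `x ↦ x + u x` for a periodic `u` with `|u'| < 1`. -/
def CircleDiffeo.ofPerturbation (u : ℝ → ℝ) (hu : ContDiff ℝ ∞ u) (hp : Function.Periodic u 1)
    (hd : ∀ x, |deriv u x| < 1) : CircleDiffeo :=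
  have hF : ContDiff ℝ ∞ fun x => x + u x := contDiff_id.add hu
  have hder : ∀ x, HasDerivAt (fun x => x + u x) (1 + deriv u x) x := fun x =>
    (hasDerivAt_id x).add ((hu.differentiable (by simp)) x).hasDerivAt
  have hpos : ∀ x, 0 < 1 + deriv u x := fun x => by linarith [(abs_lt.1 (hd x)).1]
  have hmono : StrictMono fun x => x + u x := strictMono_of_deriv_pos fun x => by
    rw [(hder x).deriv]; exact hpos x
  have htop : Tendsto (fun x => x + u x) atTop atTop := by
    obtain ⟨C, -, hC⟩ := exists_bound_of_periodic hu.continuous hp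
    exact tendsto_atTop_add_right_of_le _ (-C) tendsto_id fun x => (abs_le.1 (hC x)).1
  have hbot : Tendsto (fun x => x + u x) atBot atBot := by
    obtain ⟨C, -, hC⟩ := exists_bound_of_periodic hu.continuous hp
    exact tendsto_atBot_add_right_of_ge _ C tendsto_id fun x => (abs_le.1 (hC x)).2
  let e : ℝ ≃o ℝ := StrictMono.orderIsoOfSurjective _ hmono (hF.continuous.surjective htop hbot)
  have he : ∀ x, e x = x + u x := fun _ => rfl
  { toEquiv := e.toEquiv
    contDiff_toFun := hF
    contDiff_invFun := e.toHomeomorph.contDiff_symm_deriv (fun x => (hpos x).ne') hder hF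
    map_add_one := fun x => by
      change x + 1 + u (x + 1) = x + u x + 1
      rw [hp]; ring
    deriv_pos := fun x => by
      change 0 < deriv (fun x => x + u x) x
      rw [(hder x).deriv]; exact hpos x }

@[simp] lemma CircleDiffeo.ofPerturbation_apply (u : ℝ → ℝ) (hu hp hd) (x : ℝ) :
    (CircleDiffeo.ofPerturbation u hu hp hd).toFun x = x + u x := rfl

lemma CircleDiffeo.deriv_ofPerturbation (u : ℝ → ℝ) (hu hp hd) (x : ℝ) :
    deriv (CircleDiffeo.ofPerturbation u hu hp hd).toFun x = 1 + deriv u x :=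
  ((hasDerivAt_id x).add ((hu.differentiable (by simp)) x).hasDerivAt).deriv

lemma periodic_deriv_of_periodic {E : Type*} [NormedAddCommGroup E] [NormedSpace ℝ E] {u : ℝ → E}
    (hp : Function.Periodic u 1) : Function.Periodic (deriv u) 1 := fun x => by
  rw [← deriv_comp_add_const]
  exact congrArg (fun g => deriv g x) (funext hp)

/-- Diffeomorphisms with the germ `x + ε xⁿ` at `0` and supported near `0`. -/
lemma exists_local_diffeo (n : ℕ) {r : ℝ} (hr : 0 < r) :
    ∃ ε₀ > 0, ∀ ε : ℝ, |ε| ≤ ε₀ → ∃ f : CircleDiffeo,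
      f.toFun =ᶠ[𝓝 0] (fun x => x + ε * x ^ n) ∧
      ∀ x, f.toFun =ᶠ[𝓝 x] id ∨ ∃ m : ℤ, |x - m| < r ∧ |f.toFun x - m| < r := by
  -- The perturbation lives within `s` of the integers. Since `s < r / 2` there is room to move
  -- points by `r / 4` and stay within `r`.
  obtain ⟨s, hs, hsr, hs2⟩ : ∃ s : ℝ, 0 < s ∧ s < r / 2 ∧ s < 1 / 2 :=
    ⟨min (r / 2) (1 / 2) / 2, by positivity, by
      have := min_le_left (r / 2) (1 / 2); linarith, by
      have := min_le_right (r / 2) (1 / 2); linarith⟩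
  obtain ⟨u, hu, hp, hin, hout⟩ := exists_periodic_cutoff (fun x : ℝ => x ^ n) 0 (s / 2) s
    (by positivity) (by linarith) hs2 fun x _ => (contDiff_id.pow n).contDiffAt
  obtain ⟨C, hC0, hC⟩ := exists_bound_of_periodic hu.continuous hp
  obtain ⟨C', hC0', hC'⟩ := exists_bound_of_periodic (hu.continuous_deriv (by simp))
    (periodic_deriv_of_periodic hp)
  -- The first bound gives `|ε u'| ≤ 1/2`, so that `x + ε u` is a diffeomorphism; the second gives
  -- `|ε u| ≤ r/4`.
  refine ⟨min (1 / (2 * C')) (r / 4 / C), by positivity, fun ε hε => ?_⟩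
  have hε1 : |ε| * C' ≤ 1 / 2 := by
    calc _ ≤ 1 / (2 * C') * C' := by gcongr; exact hε.trans (min_le_left _ _)
      _ = 1 / 2 := by field_simp
  have hε2 : |ε| * C ≤ r / 4 := by
    calc _ ≤ r / 4 / C * C := by gcongr; exact hε.trans (min_le_right _ _)
      _ = r / 4 := by field_simp
  have hder : ∀ x, deriv (fun x => ε * u x) x = ε * deriv u x := fun x =>
    deriv_const_mul_field _
  have hd : ∀ x, |deriv (fun x => ε * u x) x| < 1 := fun x => by
    rw [hder, abs_mul]
    calc _ ≤ |ε| * C' := by gcongr; exact hC' x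
      _ < 1 := by linarith
  have hvp : Function.Periodic (fun x => ε * u x) 1 := fun x => congrArg (ε * ·) (hp x)
  refine ⟨CircleDiffeo.ofPerturbation (fun x => ε * u x) (contDiff_const.mul hu) hvp hd, ?_, ?_⟩
  · have : ∀ᶠ x : ℝ in 𝓝 0, |x - 0| < s / 2 :=
      (continuous_abs.comp (continuous_id.sub continuous_const)).continuousAt.eventually
        (gt_mem_nhds (by simpa using hs))
    filter_upwards [this] with x hx
    rw [CircleDiffeo.ofPerturbation_apply, hin x hx.le]
  · intro x
    obtain ⟨m, hm⟩ := exists_int_abs_sub_le 0 x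
    rw [sub_zero] at hm
    rcases le_or_gt (|x - m|) (r / 2) with hx | hx
    · right
      refine ⟨m, by linarith, ?_⟩
      rw [CircleDiffeo.ofPerturbation_apply]
      have : |ε * u x| ≤ r / 4 := by
        rw [abs_mul]; exact (mul_le_mul_of_nonneg_left (hC x) (abs_nonneg _)).trans hε2
      have h3 := abs_add_le (x - m) (ε * u x)
      rw [show x + ε * u x - m = x - m + ε * u x by ring]
      linarith
    · left
      have : ∀ᶠ y : ℝ in 𝓝 x, s < |y - m| :=
        (continuous_abs.comp (continuous_id.sub continuous_const)).continuousAt.eventually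
          (lt_mem_nhds (by change s < |x - m|; linarith))
      have h' : ∀ᶠ y : ℝ in 𝓝 x, |y - m| < 1 - s :=
        (continuous_abs.comp (continuous_id.sub continuous_const)).continuousAt.eventually
          (gt_mem_nhds (by change |x - m| < 1 - s; linarith))
      filter_upwards [this, h'] with y hy hy'
      rw [CircleDiffeo.ofPerturbation_apply, id]
      suffices u y = 0 by rw [this]; ring
      obtain ⟨k, hk⟩ := exists_int_abs_sub_le 0 y
      rw [← hp.sub_int_mul_eq k, mul_one]
      refine hout _ ?_ hk
      rw [sub_zero] at hk ⊢
      by_contra hlt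
      push Not at hlt
      -- A point `y` within `s` of another integer `k` would satisfy `1 ≤ |k - m| ≤ |k - y| + |y -
      -- m| < s + (1 - s)`.
      have hkm : k ≠ m := by rintro rfl; linarith
      have h1 : (1 : ℝ) ≤ |((k - m : ℤ) : ℝ)| := by
        rw [← Int.cast_abs]; exact_mod_cast Int.one_le_abs (sub_ne_zero.2 hkm)
      have h2 := abs_sub_le (k : ℝ) y m
      push_cast at h1
      rw [abs_sub_comm (k : ℝ) y] at h2
      linarith

/-! ### Pullback of densities and its commutation with derivatives. -/

section Algebra

variable {𝕜 : Type*} [RCLike 𝕜]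

lemma hasDerivAt_smoothFun (φ : SmoothFun 𝕜) (x : ℝ) :
    HasDerivAt φ.1 ((ddx 𝕜 φ).1 x) x :=
  ((φ.2.1.differentiable (by simp)) x).hasDerivAt

lemma ddx_mul (a b : SmoothFun 𝕜) : ddx 𝕜 (a * b) = ddx 𝕜 a * b + a * ddx 𝕜 b :=
  LinearMap.congr_fun (ddx_mul_mulOp a) b

lemma ddx_algebraMap (c : 𝕜) : ddx 𝕜 (algebraMap 𝕜 (SmoothFun 𝕜) c) = 0 := by
  ext x
  exact deriv_const x c

lemma ddx_one : ddx 𝕜 1 = 0 := by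
  rw [← map_one (algebraMap 𝕜 (SmoothFun 𝕜)), ddx_algebraMap]

lemma ddx_pow_apply (φ : SmoothFun 𝕜) (n : ℕ) : ((ddx 𝕜 ^ n) φ).1 = iteratedDeriv n φ.1 := by
  induction n with
  | zero => rw [iteratedDeriv_zero]; rfl
  | succ n ih =>
    rw [pow_succ', iteratedDeriv_succ, ← ih]
    rfl

/-- The coefficients of `(d - (w + n - 1) p) ⋯ (d - (w + 1) p) (d - w p)`. -/
def mcoef (w : 𝕜) (p : SmoothFun 𝕜) : ℕ → ℕ → SmoothFun 𝕜
  | 0, 0 => 1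
  | 0, _ + 1 => 0
  | n + 1, 0 => ddx 𝕜 (mcoef w p n 0) - (w + n) • (p * mcoef w p n 0)
  | n + 1, i + 1 => mcoef w p n i + ddx 𝕜 (mcoef w p n (i + 1)) -
      (w + n) • (p * mcoef w p n (i + 1))

/-- The operator `(d - (w + n - 1) p) ⋯ (d - (w + 1) p) (d - w p)`. -/
def twistedPow (w : 𝕜) (p : SmoothFun 𝕜) : ℕ → Module.End 𝕜 (SmoothFun 𝕜)
  | 0 => 1
  | n + 1 => (ddx 𝕜 - (w + n) • mulOp 𝕜 p) * twistedPow w p n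

lemma mcoef_eq_zero (w : 𝕜) (p : SmoothFun 𝕜) {n i : ℕ} (h : n < i) : mcoef w p n i = 0 := by
  induction n generalizing i with
  | zero =>
    obtain ⟨i, rfl⟩ := Nat.exists_eq_succ_of_ne_zero h.ne'
    rfl
  | succ n ih =>
    obtain ⟨i, rfl⟩ := Nat.exists_eq_succ_of_ne_zero (Nat.zero_lt_of_lt h).ne'
    rw [mcoef, ih (by omega), ih (by omega)]
    simp

lemma mcoef_self (w : 𝕜) (p : SmoothFun 𝕜) (n : ℕ) : mcoef w p n n = 1 := by
  induction n with
  | zero => rfl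
  | succ n ih => rw [mcoef, ih, mcoef_eq_zero w p (Nat.lt_succ_self n)]; simp

lemma twistedPow_apply (w : 𝕜) (p φ : SmoothFun 𝕜) {n N : ℕ} (h : n < N) :
    twistedPow w p n φ = ∑ i ∈ Finset.range N, mcoef w p n i * (ddx 𝕜 ^ i) φ := by
  obtain ⟨N, rfl⟩ := Nat.exists_eq_succ_of_ne_zero (Nat.zero_lt_of_lt h).ne'
  induction n with
  | zero =>
    rw [Finset.sum_range_succ', Finset.sum_eq_zero fun i _ => ?_]
    · simp [mcoef, twistedPow]
    · simp [mcoef]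
  | succ n ih =>
    have h1 : twistedPow w p (n + 1) φ = ddx 𝕜 (twistedPow w p n φ)
      - (w + n) • (p * twistedPow w p n φ) := rfl
    have h2 : ∀ i, (ddx 𝕜) ((ddx 𝕜 ^ i) φ) = (ddx 𝕜 ^ (i + 1)) φ := fun i => by
      rw [pow_succ']; rfl
    rw [h1, ih (by omega), map_sum]
    simp only [ddx_mul, h2, Finset.sum_add_distrib]
    rw [Finset.sum_range_succ (fun i => mcoef w p n i * (ddx 𝕜 ^ (i + 1)) φ),
      mcoef_eq_zero w p (show n < N by omega), zero_mul, add_zero,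
      Finset.sum_range_succ' (fun i => mcoef w p (n + 1) i * _),
      Finset.sum_range_succ' (fun i => ddx 𝕜 (mcoef w p n i) * _),
      Finset.sum_range_succ' (fun i => mcoef w p n i * (ddx 𝕜 ^ i) φ)]
    simp only [mcoef, mul_add, sub_mul, add_mul, Finset.sum_add_distrib, Finset.sum_sub_distrib,
      Finset.mul_sum, smul_add, Finset.smul_sum, smul_mul_assoc, mul_assoc]
    ring

/-- The pullback of a density of weight `w` along `f`, `φ ↦ (f')^w (φ ∘ f)`. -/
abbrev pull (f : CircleDiffeo) (w : 𝕜) : Module.End 𝕜 (SmoothFun 𝕜) := densityAct f.inv w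

lemma pull_apply (f : CircleDiffeo) (w : 𝕜) (φ : SmoothFun 𝕜) (x : ℝ) :
    (pull f w φ).1 x = (jacPow f w).1 x * φ.1 (f.toFun x) := rfl

lemma jacPow_add (f : CircleDiffeo) (v w : 𝕜) : jacPow f (v + w) = jacPow f v * jacPow f w := by
  ext x
  change NormedSpace.exp ((v + w) * _) = NormedSpace.exp (v * _) * NormedSpace.exp (w * _)
  rw [add_mul, NormedSpace.exp_add]

lemma jacPow_zero (f : CircleDiffeo) : jacPow f (0 : 𝕜) = 1 := by
  ext x
  change NormedSpace.exp ((0 : 𝕜) * _) = 1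
  rw [zero_mul, NormedSpace.exp_zero]

lemma jacPow_one_apply (f : CircleDiffeo) (x : ℝ) :
    (jacPow f (1 : 𝕜)).1 x = ((deriv f.toFun x : ℝ) : 𝕜) := by
  change NormedSpace.exp ((1 : 𝕜) * _) = _
  have h : ∀ r : ℝ, NormedSpace.exp ((r : ℝ) : 𝕜) = ((NormedSpace.exp r : ℝ) : 𝕜) := fun r =>
    (NormedSpace.algebraMap_exp_comm (𝕂 := ℝ) (𝔸 := 𝕜) r).symm
  rw [one_mul, h, ← Real.exp_eq_exp_ℝ, Real.exp_log (f.deriv_pos x)]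

/-- For integral weights the exponential defining the Jacobian factor is an honest real power, which
lets the functionals below be studied on real-valued functions. -/
lemma jacPow_neg_natCast_apply (f : CircleDiffeo) (m : ℕ) (x : ℝ) :
    (jacPow f (-(m : 𝕜))).1 x = ((((deriv f.toFun x) ^ m)⁻¹ : ℝ) : 𝕜) := by
  have h1 : ∀ m : ℕ, (jacPow f (m : 𝕜)).1 x = (((deriv f.toFun x) ^ m : ℝ) : 𝕜) := by
    intro m
    induction m with
    | zero => simp [jacPow_zero]
    | succ m ih =>
      rw [Nat.cast_succ, jacPow_add, pow_succ, RCLike.ofReal_mul, ← ih, ← jacPow_one_apply]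
      rfl
  have h2 : (jacPow f (-(m : 𝕜))).1 x * (jacPow f (m : 𝕜)).1 x = 1 := by
    have := jacPow_add f (-(m : 𝕜)) m
    rw [neg_add_cancel, jacPow_zero] at this
    exact (congrArg (fun g => g.1 x) this).symm
  rw [RCLike.ofReal_inv, ← h1]
  exact eq_inv_of_mul_eq_one_left h2

lemma pull_mul (f : CircleDiffeo) (v w : 𝕜) (a b : SmoothFun 𝕜) :
    pull f (v + w) (a * b) = pull f v a * pull f w b := by
  ext x
  change (jacPow f (v + w)).1 x * (a.1 _ * b.1 _) =
    ((jacPow f v).1 x * a.1 _) * ((jacPow f w).1 x * b.1 _)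
  rw [jacPow_add]
  change ((jacPow f v).1 x * (jacPow f w).1 x) * _ = _
  ring

/-- `f''/f'`. -/
def logJac (f : CircleDiffeo) : SmoothFun 𝕜 :=
  ⟨fun x => ((deriv (deriv f.toFun) x / deriv f.toFun x : ℝ) : 𝕜),
    (RCLike.ofRealCLM (K := 𝕜)).contDiff.comp
      (((contDiff_infty_iff_deriv.1 (contDiff_deriv f)).2).div (contDiff_deriv f)
        fun x => (f.deriv_pos x).ne'),
    fun x => by
      simp only [periodic_deriv f x, periodic_deriv_of_periodic (periodic_deriv f) x]⟩

lemma ddx_jacPow (f : CircleDiffeo) (w : 𝕜) :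
    ddx 𝕜 (jacPow f w) = w • (logJac f * jacPow f w) := by
  ext x
  have h1 : HasDerivAt (fun x => Real.log (deriv f.toFun x))
      (deriv (deriv f.toFun) x / deriv f.toFun x) x :=
    (((contDiff_deriv f).differentiable (by simp)) x).hasDerivAt.log (f.deriv_pos x).ne'
  have h2 : HasDerivAt (fun x => ((Real.log (deriv f.toFun x) : ℝ) : 𝕜))
      ((deriv (deriv f.toFun) x / deriv f.toFun x : ℝ) : 𝕜) x :=
    (RCLike.ofRealCLM (K := 𝕜)).hasFDerivAt.comp_hasDerivAt x h1
  have h3 := (hasDerivAt_exp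
    (x := w * ((Real.log (deriv f.toFun x) : ℝ) : 𝕜))).scomp x (h2.const_mul w)
  refine h3.deriv.trans ?_
  change _ = w * ((logJac f : SmoothFun 𝕜).1 x * (jacPow f w).1 x)
  rw [smul_eq_mul, mul_assoc]
  rfl

/-- The chain rule for `φ ∘ f` raises the weight by one, and differentiating the factor `(f')^w`
produces the correction `w f''/f'`. -/
lemma pull_ddx (f : CircleDiffeo) (w : 𝕜) (φ : SmoothFun 𝕜) :
    pull f (w + 1) (ddx 𝕜 φ) = ddx 𝕜 (pull f w φ) - w • (logJac f * pull f w φ) := by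
  have h0 : pull f w φ = jacPow f w * compOp f φ := rfl
  have h1 : ddx 𝕜 (compOp f φ) = jacPow f 1 * compOp f (ddx 𝕜 φ) := by
    ext x
    have h1 : HasDerivAt f.toFun (deriv f.toFun x) x :=
      ((f.contDiff_toFun.differentiable (by simp)) x).hasDerivAt
    have h3 := ((hasDerivAt_smoothFun φ (f.toFun x)).scomp x h1).deriv
    rw [RCLike.real_smul_eq_coe_mul, ← jacPow_one_apply] at h3
    exact h3
  have h2 : pull f (w + 1) (ddx 𝕜 φ) = jacPow f (w + 1) * compOp f (ddx 𝕜 φ) := rfl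
  rw [h2, h0, ddx_mul, h1, ddx_jacPow, jacPow_add, smul_mul_assoc]
  rw [mul_assoc, mul_assoc]
  abel

/-- Each derivative raises the weight by one, so the corrections met along the way are `w p, (w + 1)
p, ...`, which are the factors of `twistedPow`. -/
lemma pull_ddx_pow (f : CircleDiffeo) (w : 𝕜) (n : ℕ) (φ : SmoothFun 𝕜) :
    pull f (w + n) ((ddx 𝕜 ^ n) φ) = twistedPow w (logJac f) n (pull f w φ) := by
  induction n with
  | zero => simp [twistedPow]
  | succ n ih =>
    rw [pow_succ', Nat.cast_succ, ← add_assoc]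
    refine (pull_ddx f (w + n) _).trans ?_
    rw [ih]
    rfl

lemma jacPow_inv_comp (f : CircleDiffeo) (w : 𝕜) (x : ℝ) :
    (jacPow f w).1 x * (jacPow f.inv w).1 (f.toFun x) = 1 := by
  change NormedSpace.exp (w * _) * NormedSpace.exp (w * _) = 1
  rw [← NormedSpace.exp_add, ← mul_add, ← RCLike.ofReal_add, ← Real.log_mul (f.deriv_pos _).ne'
    (f.inv.deriv_pos _).ne']
  have h1 : HasDerivAt f.toFun (deriv f.toFun x) x :=
    ((f.contDiff_toFun.differentiable (by simp)) x).hasDerivAt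
  have h2 : HasDerivAt f.inv.toFun (deriv f.inv.toFun (f.toFun x)) (f.toFun x) :=
    ((f.inv.contDiff_toFun.differentiable (by simp)) _).hasDerivAt
  have h3 := h2.comp x h1
  have h4 : f.inv.toFun ∘ f.toFun = id := funext f.left_inv
  rw [h4] at h3
  rw [mul_comm (deriv f.toFun x), ← (hasDerivAt_id x).unique h3]
  simp

lemma pull_mul_densityAct (f : CircleDiffeo) (w : 𝕜) : pull f w * densityAct f w = 1 := by
  ext φ x
  change (jacPow f w).1 x * ((jacPow f.inv w).1 (f.toFun x) * φ.1 (f.invFun (f.toFun x))) = φ.1 x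
  rw [← mul_assoc, jacPow_inv_comp, one_mul]
  exact congrArg φ.1 (f.left_inv x)

end Algebra

/-! ### Differential operators as tuples of coefficients. -/

section Coefficients

variable {𝕜 : Type*} [RCLike 𝕜]

lemma iteratedDeriv_ofReal_pow (k i : ℕ) (c : ℝ) :
    iteratedDeriv i (fun x : ℝ => ((x - c : ℝ) : 𝕜) ^ k) =
      fun x => (k.descFactorial i : 𝕜) * ((x - c : ℝ) : 𝕜) ^ (k - i) := by
  induction i with
  | zero => simp
  | succ i ih =>
    rw [iteratedDeriv_succ, ih]
    funext x
    have h1 : HasDerivAt (fun x : ℝ => ((x - c : ℝ) : 𝕜)) 1 x := by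
      have := (RCLike.ofRealCLM (K := 𝕜)).hasFDerivAt.comp_hasDerivAt x
        ((hasDerivAt_id x).sub_const c)
      rwa [RCLike.ofRealCLM_apply, RCLike.ofReal_one] at this
    rw [((h1.fun_pow (k - i)).const_mul (k.descFactorial i : 𝕜)).deriv, Nat.descFactorial_succ,
      Nat.sub_sub]
    push_cast
    ring

/-- There are periodic functions with the germ of `(x - c)^k` at `c`. -/
lemma exists_germ_pow (k : ℕ) (c : ℝ) :
    ∃ φ : SmoothFun 𝕜, φ.1 =ᶠ[𝓝 c] fun x : ℝ => ((x - c : ℝ) : 𝕜) ^ k := by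
  obtain ⟨φ, h1, h2, h3, -⟩ := exists_periodic_cutoff (fun x : ℝ => ((x - c : ℝ) : 𝕜) ^ k) c
    (1 / 8) (1 / 4) (by norm_num) (by norm_num) (by norm_num) fun x _ =>
      (((RCLike.ofRealCLM (K := 𝕜)).contDiff.comp
        (contDiff_id.sub contDiff_const)).pow k).contDiffAt
  refine ⟨⟨φ, h1, h2⟩, ?_⟩
  filter_upwards [Metric.closedBall_mem_nhds c (show (0 : ℝ) < 1 / 8 by norm_num)] with x hx
  exact h3 x (by rwa [Metric.mem_closedBall, Real.dist_eq] at hx)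

lemma ddx_pow_germ_pow {φ : SmoothFun 𝕜} {k : ℕ} {c : ℝ}
    (h : φ.1 =ᶠ[𝓝 c] fun x : ℝ => ((x - c : ℝ) : 𝕜) ^ k) (i : ℕ) :
    ((ddx 𝕜 ^ i) φ).1 c = if i = k then (k.factorial : 𝕜) else 0 := by
  rw [ddx_pow_apply, h.iteratedDeriv_eq, iteratedDeriv_ofReal_pow]
  split_ifs with hik
  · subst hik
    simp [Nat.descFactorial_self]
  · rcases lt_or_gt_of_ne hik with h' | h'
    · simp [Nat.sub_ne_zero_of_lt h']
    · simp [Nat.descFactorial_eq_zero_iff_lt.2 h']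

/-- The differential operator with coefficients `a`. -/
def ofCoeff : (Fin 5 → SmoothFun 𝕜) →ₗ[𝕜] DiffOp 𝕜 4 where
  toFun a := ⟨∑ i, mulOp 𝕜 (a i) * ddx 𝕜 ^ (i : ℕ), a, rfl⟩
  map_add' a b := by
    ext1
    change ∑ i, mulOp 𝕜 ((a + b) i) * ddx 𝕜 ^ (i : ℕ) =
      (∑ i, mulOp 𝕜 (a i) * ddx 𝕜 ^ (i : ℕ)) + ∑ i, mulOp 𝕜 (b i) * ddx 𝕜 ^ (i : ℕ)
    rw [← Finset.sum_add_distrib]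
    refine Finset.sum_congr rfl fun i _ => ?_
    ext φ : 1
    simp [add_mul]
  map_smul' c a := by
    ext1
    change ∑ i, mulOp 𝕜 ((c • a) i) * ddx 𝕜 ^ (i : ℕ) =
      c • ∑ i, mulOp 𝕜 (a i) * ddx 𝕜 ^ (i : ℕ)
    rw [Finset.smul_sum]
    refine Finset.sum_congr rfl fun i _ => ?_
    ext φ : 1
    simp

lemma ofCoeff_apply (a : Fin 5 → SmoothFun 𝕜) (φ : SmoothFun 𝕜) :
    (ofCoeff a).1 φ = ∑ i, a i * (ddx 𝕜 ^ (i : ℕ)) φ := by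
  simp [ofCoeff]

/-- A function with the germ of `(x - c)^k` at `c` has only its `k`-th derivative nonzero there, so
applying the operator to it isolates the value of the `k`-th coefficient at `c`. -/
lemma ofCoeff_bijective : Function.Bijective (ofCoeff (𝕜 := 𝕜)) := by
  constructor
  · refine (injective_iff_map_eq_zero _).2 fun a ha => ?_
    ext k c
    obtain ⟨φ, hφ⟩ := exists_germ_pow (𝕜 := 𝕜) k c
    have h1 : (ofCoeff a).1 φ = 0 := by rw [ha]; rfl
    rw [ofCoeff_apply] at h1
    have h2 : (∑ i, a i * (ddx 𝕜 ^ (i : ℕ)) φ).1 c =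
        ∑ i, (a i).1 c * ((ddx 𝕜 ^ (i : ℕ)) φ).1 c := by
      simp
    rw [h1, Finset.sum_eq_single k] at h2
    · rw [ddx_pow_germ_pow hφ, if_pos rfl] at h2
      have h3 := (mul_eq_zero.1 h2.symm).resolve_right (by
        exact_mod_cast Nat.factorial_ne_zero _)
      simpa using h3
    · intro i _ hi
      rw [ddx_pow_germ_pow hφ, if_neg (by simpa [Fin.ext_iff] using hi), mul_zero]
    · simp
  · rintro ⟨_, a, rfl⟩
    exact ⟨a, rfl⟩

/-- Operators of order at most four and their coefficients. -/
def coeffEquiv : (Fin 5 → SmoothFun 𝕜) ≃ₗ[𝕜] DiffOp 𝕜 4 :=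
  LinearEquiv.ofBijective ofCoeff ofCoeff_bijective

/-- The pullback of operators along `f`, in terms of coefficients. -/
def coeffAct (lam mu : 𝕜) (f : CircleDiffeo) : Module.End 𝕜 (Fin 5 → SmoothFun 𝕜) :=
  LinearMap.pi fun i => ∑ j : Fin 5,
    (mulOp 𝕜 (mcoef lam (logJac f) j i) * pull f (mu - lam - (j : ℕ))).comp (LinearMap.proj j)

lemma coeffAct_apply (lam mu : 𝕜) (f : CircleDiffeo) (a : Fin 5 → SmoothFun 𝕜) (i : Fin 5) :
    coeffAct lam mu f a i =
      ∑ j : Fin 5, mcoef lam (logJac f) j i * pull f (mu - lam - (j : ℕ)) (a j) := by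
  simp [coeffAct]

/-- Pullback is multiplicative with additive weights, so `a_j φ^(j)` splits into weights `(mu - lam
- j) + (lam + j)` and `pull_ddx_pow` handles the second factor. The inverse `f.inv` appears because
`diffOpAct` pushes forward while `coeffAct` pulls back. -/
lemma diffOpAct_ofCoeff (lam mu : 𝕜) (f : CircleDiffeo) (a : Fin 5 → SmoothFun 𝕜) :
    diffOpAct 4 lam mu f.inv (ofCoeff a) = ofCoeff (coeffAct lam mu f a) := by
  ext1
  refine LinearMap.ext fun φ => ?_
  have h1 : ∀ ψ, pull f mu ((ofCoeff a).1 ψ) = (ofCoeff (coeffAct lam mu f a)).1 (pull f lam ψ) := by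
    intro ψ
    have h2 : ∀ j : Fin 5, pull f mu (a j * (ddx 𝕜 ^ (j : ℕ)) ψ) =
        pull f (mu - lam - (j : ℕ)) (a j) * ∑ i : Fin 5, mcoef lam (logJac f) j i *
          (ddx 𝕜 ^ (i : ℕ)) (pull f lam ψ) := by
      intro j
      rw [Fin.sum_univ_eq_sum_range (fun i => mcoef lam (logJac f) j i *
          (ddx 𝕜 ^ i) (pull f lam ψ)), ← twistedPow_apply _ _ _ j.2, ← pull_ddx_pow, ← pull_mul]
      congr 2
      ring
    rw [ofCoeff_apply, ofCoeff_apply, map_sum, Finset.sum_congr rfl fun j _ => h2 j]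
    simp only [coeffAct_apply, Finset.mul_sum, Finset.sum_mul]
    rw [Finset.sum_comm]
    refine Finset.sum_congr rfl fun i _ => Finset.sum_congr rfl fun j _ => ?_
    ring
  have h3 := h1 (densityAct f lam φ)
  rw [show pull f lam (densityAct f lam φ) = φ from
    LinearMap.congr_fun (pull_mul_densityAct f lam) φ] at h3
  exact h3

/-- The symmetry algebra in terms of coefficients. -/
def CoeffSymmetryAlgebra (lam mu : 𝕜) : Subalgebra 𝕜 (Module.End 𝕜 (Fin 5 → SmoothFun 𝕜)) :=
  Subalgebra.centralizer 𝕜 (Set.range (coeffAct lam mu))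

lemma mem_coeffSymmetryAlgebra {lam mu : 𝕜} {T : Module.End 𝕜 (Fin 5 → SmoothFun 𝕜)} :
    T ∈ CoeffSymmetryAlgebra lam mu ↔
      ∀ f a, T (coeffAct lam mu f a) = coeffAct lam mu f (T a) := by
  rw [CoeffSymmetryAlgebra, Subalgebra.mem_centralizer_iff]
  constructor
  · intro h f a
    exact (LinearMap.congr_fun (h _ ⟨f, rfl⟩) a).symm
  · rintro h _ ⟨f, rfl⟩
    exact LinearMap.ext fun a => (h f a).symm

/-- The passage from `f` to `f.inv` is harmless: the commutation is required for every element of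
the group. -/
lemma mem_symmetryAlgebra_iff {lam mu : 𝕜} (T : Module.End 𝕜 (DiffOp 𝕜 4)) :
    T ∈ SymmetryAlgebra 4 lam mu ↔
      coeffEquiv.symm.conjAlgEquiv 𝕜 T ∈ CoeffSymmetryAlgebra lam mu := by
  rw [mem_coeffSymmetryAlgebra, SymmetryAlgebra, Subalgebra.mem_centralizer_iff]
  have h0 : ∀ a, coeffEquiv.symm.conjAlgEquiv 𝕜 T a = coeffEquiv.symm (T (coeffEquiv a)) :=
    fun a => rfl
  have h1 : ∀ f a, diffOpAct 4 lam mu f.inv (coeffEquiv a) = coeffEquiv (coeffAct lam mu f a) :=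
    diffOpAct_ofCoeff lam mu
  constructor
  · intro h f a
    rw [h0, h0, LinearEquiv.symm_apply_eq, ← h1, ← h1, LinearEquiv.apply_symm_apply]
    exact (LinearMap.congr_fun (h _ ⟨f.inv, rfl⟩) _).symm
  · rintro h _ ⟨f, rfl⟩
    refine LinearMap.ext fun A => ?_
    obtain ⟨a, rfl⟩ := coeffEquiv.surjective A
    have h2 := h f.inv a
    rw [h0, h0, LinearEquiv.symm_apply_eq, ← h1, ← h1, LinearEquiv.apply_symm_apply] at h2
    exact h2.symm

/-- Passing to coefficients identifies the two symmetry algebras. -/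
def symmetryAlgebraEquiv (lam mu : 𝕜) :
    SymmetryAlgebra 4 lam mu ≃ₐ[𝕜] CoeffSymmetryAlgebra lam mu :=
  (coeffEquiv.symm.conjAlgEquiv 𝕜).subalgebraMap _ |>.trans <| Subalgebra.equivOfEq _ _ <| by
    ext T
    rw [Subalgebra.mem_map]
    constructor
    · rintro ⟨T, hT, rfl⟩
      exact (mem_symmetryAlgebra_iff T).1 hT
    · intro hT
      refine ⟨(coeffEquiv.symm.conjAlgEquiv 𝕜).symm T, ?_, AlgEquiv.apply_symm_apply _ _⟩
      rw [mem_symmetryAlgebra_iff]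
      simpa using hT

end Coefficients

/-! ### Values of a symmetry away from the support. -/

section Locality

variable {𝕜 : Type*} [RCLike 𝕜]

lemma mcoef_eventuallyEq (w : 𝕜) {p : SmoothFun 𝕜} {x : ℝ} (hp : p.1 =ᶠ[𝓝 x] fun _ => 0)
    (n i : ℕ) : (mcoef w p n i).1 =ᶠ[𝓝 x] fun _ => if n = i then 1 else 0 := by
  have hd : ∀ {φ : SmoothFun 𝕜} {c : 𝕜}, φ.1 =ᶠ[𝓝 x] (fun _ => c) →
      (ddx 𝕜 φ).1 =ᶠ[𝓝 x] fun _ => 0 := fun {φ c} h => by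
    have := h.deriv
    simp only [deriv_const'] at this
    exact this
  induction n generalizing i with
  | zero =>
    cases i with
    | zero => exact EventuallyEq.rfl
    | succ i => simp only [(Nat.succ_ne_zero i).symm, if_false]; exact EventuallyEq.rfl
  | succ n ih =>
    cases i with
    | zero =>
      filter_upwards [hp, hd (ih 0)] with y h1 h2
      change (ddx 𝕜 (mcoef w p n 0)).1 y - (w + n) * (p.1 y * (mcoef w p n 0).1 y) = _
      rw [h1, h2]
      simp
    | succ i =>
      filter_upwards [hp, ih i, hd (ih (i + 1))] with y h1 h2 h3
      change (mcoef w p n i).1 y + (ddx 𝕜 (mcoef w p n (i + 1))).1 y -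
        (w + n) * (p.1 y * (mcoef w p n (i + 1)).1 y) = _
      rw [h1, h2, h3]
      simp

/-- The subleading coefficient collects `-(w + k) p` for `k = 0, ..., n`. It is what a germ `x + ε
x²` sees. -/
lemma mcoef_succ_self (w : 𝕜) (p : SmoothFun 𝕜) (n : ℕ) :
    mcoef w p (n + 1) n = -((n + 1) * w + (n + 1) * n / 2) • p := by
  induction n with
  | zero => simp [mcoef, ddx_one]
  | succ n ih =>
    rw [mcoef, ih, mcoef_self, ddx_one, mul_one, add_zero, ← sub_smul]
    congr 1
    push_cast
    ring

/-- Where `p` vanishes only the terms that differentiate `p` once survive, so this is the sum of the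
previous subleading coefficients. It is what a germ `x + ε x³` sees. -/
lemma mcoef_add_two_apply (w : 𝕜) {p : SmoothFun 𝕜} {x : ℝ} (hp : p.1 x = 0) (n : ℕ) :
    (mcoef w p (n + 2) n).1 x =
      -((n + 2) * (n + 1) / 2 * w + (n + 2) * (n + 1) * n / 6) * (ddx 𝕜 p).1 x := by
  induction n with
  | zero =>
    have h1 := mcoef_succ_self w p 0
    change (ddx 𝕜 (mcoef w p 1 0)).1 x - (w + (1 : ℕ)) * (p.1 x * (mcoef w p 1 0).1 x) = _
    rw [hp, h1, map_smul]
    change _ * (ddx 𝕜 p).1 x - _ = _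
    push_cast
    ring
  | succ n ih =>
    change (mcoef w p (n + 2) n).1 x + (ddx 𝕜 (mcoef w p (n + 2) (n + 1))).1 x -
      (w + (n + 2 : ℕ)) * (p.1 x * (mcoef w p (n + 2) (n + 1)).1 x) = _
    rw [hp, ih, mcoef_succ_self w p (n + 1), map_smul]
    change _ + _ * (ddx 𝕜 p).1 x - _ = _
    push_cast
    ring

lemma jacPow_apply (f : CircleDiffeo) (w : 𝕜) (x : ℝ) :
    (jacPow f w).1 x = NormedSpace.exp (w * ((Real.log (deriv f.toFun x) : ℝ) : 𝕜)) := rfl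

lemma jacPow_apply_of_deriv_eq_one {f : CircleDiffeo} {x : ℝ} (h : deriv f.toFun x = 1) (w : 𝕜) :
    (jacPow f w).1 x = 1 := by
  rw [jacPow_apply, h, Real.log_one, RCLike.ofReal_zero, mul_zero, NormedSpace.exp_zero]

lemma jacPow_ne_zero (f : CircleDiffeo) (w : 𝕜) (x : ℝ) : (jacPow f w).1 x ≠ 0 :=
  left_ne_zero_of_mul_eq_one (jacPow_inv_comp f w x)

lemma logJac_eventuallyEq_zero {f : CircleDiffeo} {x c d : ℝ}
    (h : f.toFun =ᶠ[𝓝 x] fun y => c * y + d) :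
    (logJac f : SmoothFun 𝕜).1 =ᶠ[𝓝 x] fun _ => 0 := by
  have h1 : deriv f.toFun =ᶠ[𝓝 x] fun _ => c := by
    refine h.deriv.trans (Eventually.of_forall fun y => ?_)
    simp
  have h2 := h1.deriv
  filter_upwards [h2] with y hy
  change ((deriv (deriv f.toFun) y / deriv f.toFun y : ℝ) : 𝕜) = 0
  rw [hy]
  simp

lemma coeffAct_apply_apply (lam mu : 𝕜) (f : CircleDiffeo) (a : Fin 5 → SmoothFun 𝕜) (i : Fin 5)
    (x : ℝ) : (coeffAct lam mu f a i).1 x =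
      ∑ j : Fin 5, (mcoef lam (logJac f) j i).1 x *
        ((jacPow f (mu - lam - (j : ℕ))).1 x * (a j).1 (f.toFun x)) := by
  rw [coeffAct_apply]
  simp [pull_apply]

/-- Where `f` is affine, it acts diagonally. -/
lemma coeffAct_apply_of_affine (lam mu : 𝕜) {f : CircleDiffeo} (a : Fin 5 → SmoothFun 𝕜)
    (i : Fin 5) {x c d : ℝ} (h : f.toFun =ᶠ[𝓝 x] fun y => c * y + d) :
    (coeffAct lam mu f a i).1 x =
      (jacPow f (mu - lam - (i : ℕ))).1 x * (a i).1 (f.toFun x) := by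
  rw [coeffAct_apply_apply, Finset.sum_eq_single i]
  · rw [(mcoef_eventuallyEq lam (logJac_eventuallyEq_zero h) i i).eq_of_nhds, if_pos rfl, one_mul]
  · intro j _ hj
    rw [(mcoef_eventuallyEq lam (logJac_eventuallyEq_zero h) j i).eq_of_nhds,
      if_neg (by simpa [Fin.ext_iff] using hj), zero_mul]
  · simp

/-- Diffeomorphisms that are trivial on the support act trivially. -/
lemma coeffAct_eq_self (lam mu : 𝕜) {f : CircleDiffeo} {a : Fin 5 → SmoothFun 𝕜}
    (h : ∀ x, f.toFun =ᶠ[𝓝 x] id ∨ ∀ j, (a j).1 x = 0 ∧ (a j).1 (f.toFun x) = 0) :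
    coeffAct lam mu f a = a := by
  ext i x
  rcases h x with hx | hx
  · have h1 : f.toFun =ᶠ[𝓝 x] fun y => 1 * y + 0 := by
      filter_upwards [hx] with y hy
      rw [hy, one_mul, add_zero, id]
    rw [coeffAct_apply_of_affine lam mu a i h1, jacPow_apply_of_deriv_eq_one, one_mul,
      hx.eq_of_nhds]
    · rfl
    · rw [hx.deriv_eq]; simp
  · rw [coeffAct_apply_apply]
    simp only [(hx _).2, mul_zero, Finset.sum_const_zero]
    exact ((hx i).1).symm

/-- All coefficients vanish near `0`. -/
def VanishesNearZero (a : Fin 5 → SmoothFun 𝕜) : Prop := ∀ j, (a j).1 =ᶠ[𝓝 0] fun _ => 0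

lemma VanishesNearZero.exists_radius {a : Fin 5 → SmoothFun 𝕜} (h : VanishesNearZero a) :
    ∃ r > 0, ∀ j (m : ℤ) (x : ℝ), |x - m| < r → (a j).1 x = 0 := by
  obtain ⟨r, hr, h1⟩ := Metric.eventually_nhds_iff.1 (eventually_all.2 h)
  refine ⟨r, hr, fun j m x hx => ?_⟩
  have h2 := h1 (y := x - m) (by simpa [Real.dist_eq] using hx) j
  rwa [← mul_one (m : ℝ), (a j).2.2.sub_int_mul_eq] at h2

/-- A diffeomorphism moving points only inside the neighbourhood of `0` where `a` vanishes cannot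
change `a`, and its germ at `0` may still be prescribed. -/
lemma exists_diffeo_fixing {a : Fin 5 → SmoothFun 𝕜} (h : VanishesNearZero a) (lam mu : 𝕜)
    (n : ℕ) : ∃ ε₀ > 0, ∀ ε : ℝ, |ε| ≤ ε₀ → ∃ f : CircleDiffeo,
      f.toFun =ᶠ[𝓝 0] (fun x => x + ε * x ^ n) ∧ coeffAct lam mu f a = a := by
  obtain ⟨r, hr, h1⟩ := h.exists_radius
  obtain ⟨ε₀, hε₀, h2⟩ := exists_local_diffeo n hr
  refine ⟨ε₀, hε₀, fun ε hε => ?_⟩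
  obtain ⟨f, h3, h4⟩ := h2 ε hε
  refine ⟨f, h3, coeffAct_eq_self lam mu fun x => (h4 x).imp id ?_⟩
  rintro ⟨m, hm1, hm2⟩ j
  exact ⟨h1 j m _ hm1, h1 j m _ hm2⟩

lemma exp_mul_ofReal_ne_one {w : 𝕜} (hw : w ≠ 0) :
    ∀ᶠ t : ℝ in 𝓝[≠] 0, NormedSpace.exp (w * (t : 𝕜)) ≠ 1 := by
  have h1 : HasDerivAt (fun t : ℝ => NormedSpace.exp (w * (t : 𝕜))) w 0 := by
    have h2 : HasDerivAt (fun t : ℝ => (t : 𝕜)) 1 0 := by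
      have := (RCLike.ofRealCLM (K := 𝕜)).hasFDerivAt.comp_hasDerivAt 0 (hasDerivAt_id (0 : ℝ))
      rwa [RCLike.ofRealCLM_apply, RCLike.ofReal_one] at this
    have h3 := (hasDerivAt_exp (x := w * ((0 : ℝ) : 𝕜))).scomp (0 : ℝ) (h2.const_mul w)
    simp only [RCLike.ofReal_zero, mul_zero, NormedSpace.exp_zero, mul_one, smul_eq_mul] at h3
    exact h3
  have := h1.eventually_ne (c := 1) hw
  simpa using this

/-- Away from the support of `a`, only the coefficient of weight zero of `T a` can be nonzero. -/
lemma eval_zero_of_ne {lam mu : 𝕜} {T : Module.End 𝕜 (Fin 5 → SmoothFun 𝕜)}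
    (hT : T ∈ CoeffSymmetryAlgebra lam mu) {a : Fin 5 → SmoothFun 𝕜} (ha : VanishesNearZero a)
    {j : Fin 5} (hj : mu - lam ≠ (j : ℕ)) : (T a j).1 0 = 0 := by
  obtain ⟨ε₀, hε₀, h⟩ := exists_diffeo_fixing ha lam mu 1
  -- Under the dilation `(1 + ε) x` the value `(T a)_j(0)` is multiplied by `exp ((mu - lam - j) log
  -- (1 + ε))`. For small `ε > 0` this factor differs from `1`.
  have hlog : Tendsto (fun ε : ℝ => Real.log (1 + ε)) (𝓝[>] 0) (𝓝[≠] 0) := by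
    refine tendsto_nhdsWithin_iff.2 ⟨?_, ?_⟩
    · have : ContinuousAt (fun ε : ℝ => Real.log (1 + ε)) 0 :=
        (continuousAt_const.add continuousAt_id).log (by simp)
      have h2 := this.tendsto.mono_left (nhdsWithin_le_nhds (s := Set.Ioi 0))
      simpa using h2
    · filter_upwards [self_mem_nhdsWithin] with ε hε
      have hε' : (0 : ℝ) < ε := hε
      exact (Real.log_pos (by linarith)).ne'
  have h1 := hlog.eventually (exp_mul_ofReal_ne_one (sub_ne_zero.2 hj))
  have h2 : ∀ᶠ ε : ℝ in 𝓝[>] 0, |ε| ≤ ε₀ := by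
    filter_upwards [Ioo_mem_nhdsGT hε₀] with ε hε
    rw [abs_of_pos hε.1]
    exact hε.2.le
  obtain ⟨ε, h3, h4⟩ := (h1.and h2).exists
  obtain ⟨f, hf, hfa⟩ := h ε h4
  have h5 : f.toFun =ᶠ[𝓝 0] fun y => (1 + ε) * y + 0 := by
    filter_upwards [hf] with y hy
    rw [hy]; ring
  have h6 := congrArg (fun c => (c j).1 0) (mem_coeffSymmetryAlgebra.1 hT f a)
  simp only [hfa] at h6
  rw [coeffAct_apply_of_affine lam mu _ _ h5, jacPow_apply, h5.deriv_eq, hf.eq_of_nhds] at h6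
  have h7 : deriv (fun y => (1 + ε) * y + 0) 0 = 1 + ε := by simp
  rw [h7] at h6
  norm_num at h6
  by_contra hne
  refine h3 (mul_right_cancel₀ hne ?_)
  rw [one_mul]
  exact h6.symm

lemma deriv_of_germ_sq {f : CircleDiffeo} {ε : ℝ} (hf : f.toFun =ᶠ[𝓝 0] fun x => x + ε * x ^ 2) :
    f.toFun 0 = 0 ∧ deriv f.toFun 0 = 1 ∧ (logJac f : SmoothFun 𝕜).1 0 = ((2 * ε : ℝ) : 𝕜) := by
  have h1 : deriv f.toFun =ᶠ[𝓝 0] fun x => 1 + ε * (2 * x) := by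
    refine hf.deriv.trans (Eventually.of_forall fun y => ?_)
    simpa using ((hasDerivAt_id' y).fun_add ((hasDerivAt_pow 2 y).const_mul ε)).deriv
  have h2 : deriv (deriv f.toFun) 0 = ε * 2 := by
    rw [h1.deriv_eq]
    simp
  refine ⟨by rw [hf.eq_of_nhds]; simp, by rw [h1.eq_of_nhds]; simp, ?_⟩
  change ((deriv (deriv f.toFun) 0 / deriv f.toFun 0 : ℝ) : 𝕜) = _
  rw [h2, h1.eq_of_nhds]
  congr 1
  ring

lemma deriv_of_germ_cube {f : CircleDiffeo} {ε : ℝ}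
    (hf : f.toFun =ᶠ[𝓝 0] fun x => x + ε * x ^ 3) :
    f.toFun 0 = 0 ∧ deriv f.toFun 0 = 1 ∧ (logJac f : SmoothFun 𝕜).1 0 = 0 ∧
      (ddx 𝕜 (logJac f)).1 0 = ((6 * ε : ℝ) : 𝕜) := by
  have h1 : deriv f.toFun =ᶠ[𝓝 0] fun x => 1 + ε * (3 * x ^ 2) := by
    refine hf.deriv.trans (Eventually.of_forall fun y => ?_)
    simpa using ((hasDerivAt_id' y).fun_add ((hasDerivAt_pow 3 y).const_mul ε)).deriv
  have h2 : deriv (deriv f.toFun) =ᶠ[𝓝 0] fun x => ε * (3 * (2 * x)) := by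
    refine h1.deriv.trans (Eventually.of_forall fun y => ?_)
    simp
  have h3 : HasDerivAt (fun x : ℝ => (ε * (3 * (2 * x))) / (1 + ε * (3 * x ^ 2))) (6 * ε) 0 := by
    have h4 : HasDerivAt (fun x : ℝ => ε * (3 * (2 * x))) (ε * (3 * (2 * 1))) 0 :=
      (((hasDerivAt_id (0 : ℝ)).const_mul 2).const_mul 3).const_mul ε
    have h5 : HasDerivAt (fun x : ℝ => 1 + ε * (3 * x ^ 2)) (ε * (3 * (2 * 0))) 0 := by
      simpa using (((hasDerivAt_pow 2 (0 : ℝ)).const_mul 3).const_mul ε |>.const_add 1)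
    have h6 := h4.fun_div h5 (by simp)
    exact h6.congr_deriv (by ring)
  refine ⟨by rw [hf.eq_of_nhds]; simp, by rw [h1.eq_of_nhds]; simp, ?_, ?_⟩
  · change ((deriv (deriv f.toFun) 0 / deriv f.toFun 0 : ℝ) : 𝕜) = _
    rw [h2.eq_of_nhds]
    simp
  · have h7 : (logJac f : SmoothFun 𝕜).1 =ᶠ[𝓝 0]
        fun x => (((ε * (3 * (2 * x))) / (1 + ε * (3 * x ^ 2)) : ℝ) : 𝕜) := by
      filter_upwards [h1, h2] with x hx hx'
      change ((deriv (deriv f.toFun) x / deriv f.toFun x : ℝ) : 𝕜) = _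
      rw [hx, hx']
    change deriv (logJac f : SmoothFun 𝕜).1 0 = _
    rw [h7.deriv_eq]
    exact ((RCLike.ofRealCLM (K := 𝕜)).hasFDerivAt.comp_hasDerivAt 0 h3).deriv

/-- The values at `0` of `T a`, where `a` vanishes near `0`, can only be nonzero in two cases. -/
lemma eval_zero_eq_zero {lam mu : 𝕜} {T : Module.End 𝕜 (Fin 5 → SmoothFun 𝕜)}
    (hT : T ∈ CoeffSymmetryAlgebra lam mu) {a : Fin 5 → SmoothFun 𝕜} (ha : VanishesNearZero a)
    {j : Fin 5} (hj : ¬ (mu = lam ∧ j = 0) ∧ ¬ (lam = 0 ∧ mu = 1 ∧ j = 1)) :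
    (T a j).1 0 = 0 := by
  by_cases hδ : mu - lam = (j : ℕ)
  swap
  · exact eval_zero_of_ne hT ha hδ
  have hother : ∀ i : Fin 5, i ≠ j → (T a i).1 0 = 0 := by
    intro i hi
    refine eval_zero_of_ne hT ha fun h => hi ?_
    rw [hδ] at h
    exact (Fin.ext (by exact_mod_cast h)).symm
  -- Only the `j`-th value can be nonzero. The `i`-th component of the pullback of `T a` at `0` is
  -- therefore a multiple of it, and it must equal `(T a)_i(0) = 0`.
  have key : ∀ (f : CircleDiffeo) (i : Fin 5), i ≠ j → f.toFun 0 = 0 → deriv f.toFun 0 = 1 →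
      coeffAct lam mu f a = a →
      (mcoef lam (logJac f) j i).1 0 * (T a j).1 0 = 0 := by
    intro f i hi h0 h1 hfa
    have h6 := congrArg (fun c => (c i).1 0) (mem_coeffSymmetryAlgebra.1 hT f a)
    simp only [hfa] at h6
    rw [hother i hi, coeffAct_apply_apply, Finset.sum_eq_single j] at h6
    · rw [jacPow_apply_of_deriv_eq_one h1, h0, one_mul] at h6
      exact h6.symm
    · intro k _ hk
      rw [h0, hother k hk, mul_zero, mul_zero]
    · simp
  by_contra hne
  obtain ⟨n, hn⟩ : ∃ n, (j : ℕ) = n + 1 := by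
    refine Nat.exists_eq_succ_of_ne_zero fun h0 => hj.1 ⟨?_, Fin.ext h0⟩
    rw [h0, Nat.cast_zero] at hδ
    exact sub_eq_zero.1 hδ
  -- A germ `x + ε x²` and the component just below `j = n + 1` force `lam = -n / 2`.
  have hs : ((n + 1) * lam + (n + 1) * n / 2 : 𝕜) = 0 := by
    obtain ⟨ε₀, hε₀, h⟩ := exists_diffeo_fixing ha lam mu 2
    obtain ⟨f, hf, hfa⟩ := h ε₀ (abs_of_pos hε₀).le
    obtain ⟨h0, h1, h2⟩ := deriv_of_germ_sq (𝕜 := 𝕜) hf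
    have h3 := key f ⟨n, by omega⟩ (by simp [Fin.ext_iff]; omega) h0 h1 hfa
    rw [hn, mcoef_succ_self] at h3
    have h4 := (mul_eq_zero.1 h3).resolve_right hne
    change -_ * (logJac f : SmoothFun 𝕜).1 0 = 0 at h4
    rw [h2] at h4
    exact neg_eq_zero.1 ((mul_eq_zero.1 h4).resolve_right (by
      exact_mod_cast (mul_pos two_pos hε₀).ne'))
  have hlam : lam + n / 2 = 0 := by
    have h1 : ((n : 𝕜) + 1) ≠ 0 := by exact_mod_cast Nat.succ_ne_zero n
    refine (mul_eq_zero.1 (?_ : ((n : 𝕜) + 1) * (lam + n / 2) = 0)).resolve_left h1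
    rw [← hs]; ring
  obtain rfl | ⟨m, rfl⟩ : n = 0 ∨ ∃ m, n = m + 1 := by
    rcases n with - | m
    · exact Or.inl rfl
    · exact Or.inr ⟨m, rfl⟩
  · have h1 : lam = 0 := by simpa using hlam
    refine hj.2 ⟨h1, ?_, Fin.ext hn⟩
    rw [h1, hn] at hδ
    simpa using hδ
  · obtain ⟨ε₀, hε₀, h⟩ := exists_diffeo_fixing ha lam mu 3
    obtain ⟨f, hf, hfa⟩ := h ε₀ (abs_of_pos hε₀).le
    obtain ⟨h0, h1, h2, h2'⟩ := deriv_of_germ_cube (𝕜 := 𝕜) hf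
    have h3 := key f ⟨m, by omega⟩ (by simp [Fin.ext_iff]; omega) h0 h1 hfa
    rw [hn, mcoef_add_two_apply lam h2, h2'] at h3
    have h4 := (mul_eq_zero.1 h3).resolve_right hne
    have h5 := neg_eq_zero.1 ((mul_eq_zero.1 h4).resolve_right (by
      exact_mod_cast (mul_pos (by norm_num : (0 : ℝ) < 6) hε₀).ne'))
    -- Substituting `lam = -(m + 1) / 2` into the condition from `x + ε x³` leaves a multiple of
    -- this positive integer.
    have h6 : ((m + 2 : ℕ) : 𝕜) * ((m + 1 : ℕ) : 𝕜) * ((m + 3 : ℕ) : 𝕜) = 0 := by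
      push_cast at hlam ⊢
      linear_combination (-12) * h5 + 6 * ((m : 𝕜) + 2) * (m + 1) * hlam
    norm_cast at h6

end Locality

/-! ### Invariant functionals on functions and on `1`-densities. -/

section Coinvariants

/-- `a` vanishes on the points of the circle at distance at least `ρ` from `1/2`. -/
def SupportedIn (ρ : ℝ) (a : ℝ → ℝ) : Prop :=
  ∀ x, ρ ≤ |x - 1 / 2| → |x - 1 / 2| ≤ 1 / 2 → a x = 0

lemma SupportedIn.eventually_zero {ρ : ℝ} (hρ : ρ < 1 / 2) {a : ℝ → ℝ} (ha : SupportedIn ρ a)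
    (hp : Function.Periodic a 1) : a =ᶠ[𝓝 0] fun _ => 0 := by
  filter_upwards [Ioo_mem_nhds (show -(1 / 2 - ρ) < 0 by linarith) (show 0 < 1 / 2 - ρ by linarith),
    Ioo_mem_nhds (show (-1 / 2 : ℝ) < 0 by norm_num) (show (0 : ℝ) < 1 / 2 by norm_num)]
    with x hx hx2
  rcases le_or_gt 0 x with h | h
  · exact ha x (le_abs.2 (Or.inr (by linarith [hx.2])))
      (abs_le.2 ⟨by linarith, by linarith [hx2.2]⟩)
  · rw [← hp x]
    exact ha _ (le_abs.2 (Or.inl (by linarith [hx.1])))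
      (abs_le.2 ⟨by linarith [hx2.1], by linarith⟩)

lemma exists_supportedIn {a : ℝ → ℝ} (h : a =ᶠ[𝓝 0] fun _ => 0) (hp : Function.Periodic a 1) :
    ∃ ρ, 0 < ρ ∧ ρ < 1 / 2 ∧ SupportedIn ρ a := by
  obtain ⟨r, hr, h1⟩ := Metric.eventually_nhds_iff.1 h
  have hm1 := min_le_left r (1 / 2)
  have hm2 := min_le_right r (1 / 2)
  have hm3 : 0 < min r (1 / 2) := by positivity
  refine ⟨1 / 2 - min r (1 / 2) / 2, by linarith, by linarith, fun x hx hx' => ?_⟩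
  rw [abs_le] at hx'
  rcases le_abs.1 hx with h | h
  · rw [← hp.sub_eq x]
    exact h1 (by rw [Real.dist_eq, sub_zero, abs_lt]; constructor <;> linarith)
  · exact h1 (by rw [Real.dist_eq, sub_zero, abs_lt]; constructor <;> linarith)

lemma ext_on_period {a b : ℝ → ℝ} (ha : Function.Periodic a 1) (hb : Function.Periodic b 1)
    (h : ∀ x, |x - 1 / 2| ≤ 1 / 2 → a x = b x) (x : ℝ) : a x = b x := by
  obtain ⟨n, hn⟩ := exists_int_abs_sub_le (1 / 2) x
  rw [← ha.sub_int_mul_eq n, ← hb.sub_int_mul_eq n, mul_one]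
  exact h _ hn

/-- Vanishing of the integral makes the primitive periodic and makes it vanish on both sides of the
support of `q`. -/
lemma exists_primitive {q : ℝ → ℝ} (hq : ContDiff ℝ ∞ q) (hp : Function.Periodic q 1) {ρ : ℝ}
    (hs : SupportedIn ρ q) (hint : ∫ x in (0 : ℝ)..1, q x = 0) :
    ∃ P : ℝ → ℝ, ContDiff ℝ ∞ P ∧ Function.Periodic P 1 ∧ SupportedIn ρ P ∧
      ∀ x, deriv P x = q x := by
  have hder : ∀ x, HasDerivAt (fun x => ∫ t in (0 : ℝ)..x, q t) (q x) x := fun x =>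
    hq.continuous.integral_hasStrictDerivAt 0 x |>.hasDerivAt
  have hd : deriv (fun x => ∫ t in (0 : ℝ)..x, q t) = q := funext fun x => (hder x).deriv
  have hI : ∀ a b, IntervalIntegrable q MeasureTheory.volume a b := fun a b =>
    hq.continuous.intervalIntegrable a b
  refine ⟨fun x => ∫ t in (0 : ℝ)..x, q t, ?_, ?_, ?_, fun x => congrFun hd x⟩
  · rw [contDiff_infty_iff_deriv, hd]
    exact ⟨fun x => (hder x).differentiableAt, hq⟩
  · intro x
    have h1 := hp.intervalIntegral_add_eq x 0
    have h2 := intervalIntegral.integral_add_adjacent_intervals (hI 0 x) (hI x (x + 1))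
    rw [zero_add, hint] at h1
    rw [h1, add_zero] at h2
    exact h2.symm
  · intro x hx hx'
    rw [abs_le] at hx'
    rcases le_abs.1 hx with h | h
    · have h2 := intervalIntegral.integral_add_adjacent_intervals (hI 0 x) (hI x 1)
      rw [hint] at h2
      have h3 : ∫ t in x..1, q t = ∫ t in x..1, (0 : ℝ) := by
        refine intervalIntegral.integral_congr fun t ht => ?_
        rw [Set.uIcc_of_le (by linarith)] at ht
        exact hs t (le_abs.2 (Or.inl (by linarith [ht.1])))
          (abs_le.2 ⟨by linarith [ht.1], by linarith [ht.2]⟩)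
      rw [h3, intervalIntegral.integral_zero, add_zero] at h2
      exact h2
    · have h3 : ∫ t in (0 : ℝ)..x, q t = ∫ t in (0 : ℝ)..x, (0 : ℝ) := by
        refine intervalIntegral.integral_congr fun t ht => ?_
        rw [Set.uIcc_of_le (by linarith)] at ht
        exact hs t (le_abs.2 (Or.inr (by linarith [ht.2])))
          (abs_le.2 ⟨by linarith [ht.1], by linarith [ht.2]⟩)
      exact h3.trans intervalIntegral.integral_zero

lemma CircleDiffeo.strictMono (f : CircleDiffeo) : StrictMono f.toFun :=
  strictMono_of_deriv_pos f.deriv_pos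

variable {M : Type*} [AddCommGroup M] [Module ℝ M]

/-- Invariance of a functional under the diffeomorphisms with the germ of the identity at `0`,
acting on functions vanishing near `0` by `u ↦ J(f') (u ∘ f)`. -/
def CutInvariant (J : ℝ → ℝ) (l : SmoothFun ℝ →ₗ[ℝ] M) : Prop :=
  ∀ (f : CircleDiffeo) (u v : SmoothFun ℝ), f.toFun =ᶠ[𝓝 0] id → u.1 =ᶠ[𝓝 0] (fun _ => 0) →
    (∀ x, v.1 x = J (deriv f.toFun x) * u.1 (f.toFun x)) → l v = l u

/-- A perturbation of the identity supported near `1/2`. -/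
lemma exists_diffeo_supportedIn {P : ℝ → ℝ} (hP : ContDiff ℝ ∞ P) (hp : Function.Periodic P 1)
    {ρ : ℝ} (hρ0 : 0 < ρ) (hρ : ρ < 1 / 2) (hs : SupportedIn ρ P) (hd : ∀ x, |deriv P x| < 1) :
    ∃ f : CircleDiffeo, (∀ x, f.toFun x = x + P x) ∧ (∀ x, deriv f.toFun x = 1 + deriv P x) ∧
      f.toFun =ᶠ[𝓝 0] id ∧ (∀ x, |x - 1 / 2| ≤ ρ → |f.toFun x - 1 / 2| ≤ ρ) := by
  refine ⟨CircleDiffeo.ofPerturbation P hP hp hd, fun _ => rfl,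
    CircleDiffeo.deriv_ofPerturbation _ _ _ _, ?_, fun x hx => ?_⟩
  · filter_upwards [hs.eventually_zero hρ hp] with x hx
    rw [CircleDiffeo.ofPerturbation_apply, hx, add_zero, id]
  · have hm := (CircleDiffeo.ofPerturbation P hP hp hd).strictMono.monotone
    rw [abs_le] at hx ⊢
    have h1 := hm (show 1 / 2 - ρ ≤ x by linarith)
    have h2 := hm (show x ≤ 1 / 2 + ρ by linarith)
    simp only [CircleDiffeo.ofPerturbation_apply] at h1 h2 ⊢
    rw [hs (1 / 2 - ρ)] at h1
    · rw [hs (1 / 2 + ρ)] at h2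
      · constructor <;> linarith
      · rw [add_sub_cancel_left]; exact le_abs_self ρ
      · rw [add_sub_cancel_left, abs_of_pos hρ0]; exact hρ.le
    · rw [sub_sub_cancel_left, abs_neg]; exact le_abs_self ρ
    · rw [sub_sub_cancel_left, abs_neg, abs_of_pos hρ0]; exact hρ.le

/-- Provides test functions equal to `1` or to `x` on the support of a given function; comparing
such a function with its pullback yields the elements killed by invariant functionals. -/
lemma exists_plateau {ρ : ℝ} (hρ0 : 0 < ρ) (hρ : ρ < 1 / 2) (g : ℝ → ℝ) (hg : ContDiff ℝ ∞ g) :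
    ∃ u : SmoothFun ℝ, u.1 =ᶠ[𝓝 0] (fun _ => 0) ∧ ∀ x, |x - 1 / 2| ≤ ρ → u.1 x = g x := by
  obtain ⟨u, h1, h2, h3, h4⟩ := exists_periodic_cutoff g (1 / 2) ρ ((ρ + 1 / 2) / 2) hρ0
    (by linarith) (by linarith) fun x _ => hg.contDiffAt
  have h5 : SupportedIn ((ρ + 1 / 2) / 2) u := h4
  exact ⟨⟨u, h1, h2⟩, h5.eventually_zero (by linarith) h2, h3⟩

lemma exists_pos_bound (a : SmoothFun ℝ) : ∃ C, 0 < C ∧ ∀ x, |a.1 x| ≤ C :=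
  exists_bound_of_periodic a.2.1.continuous a.2.2

/-- There are no invariant functionals on functions. -/
lemma CutInvariant.eq_zero_of_weight_zero {l : SmoothFun ℝ →ₗ[ℝ] M}
    (h : CutInvariant (fun _ => 1) l) {a : SmoothFun ℝ} (ha : a.1 =ᶠ[𝓝 0] fun _ => 0) :
    l a = 0 := by
  obtain ⟨ρ, hρ0, hρ, hs⟩ := exists_supportedIn ha a.2.2
  obtain ⟨C, hC0, hC⟩ := exists_pos_bound (ddx ℝ a)
  -- With `f(x) = x + a(x) / (2 C)` and `u(x) = x` on the support, `u ∘ f - u = a / (2 C)`, so `a`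
  -- is killed by every invariant functional.
  obtain ⟨f, hf1, -, hf2, hf3⟩ := exists_diffeo_supportedIn (P := fun x => (2 * C)⁻¹ * a.1 x)
    (contDiff_const.mul a.2.1) (fun x => congrArg _ (a.2.2 x)) hρ0 hρ
    (fun x h1 h2 => by simp only [hs x h1 h2, mul_zero]) (fun x => by
      rw [deriv_const_mul_field, abs_mul, abs_of_pos (by positivity)]
      calc _ ≤ (2 * C)⁻¹ * C := by gcongr; exact hC x
        _ < 1 := by field_simp; norm_num)
  obtain ⟨u, hu0, hu⟩ := exists_plateau hρ0 hρ (fun x => x) contDiff_id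
  have h1 := h f u (u + (2 * C)⁻¹ • a) hf2 hu0 (by
    refine ext_on_period (u + (2 * C)⁻¹ • a).2.2 ?_ fun x hx => ?_
    · intro x
      simp only [f.map_add_one, u.2.2 (f.toFun x)]
    · change u.1 x + (2 * C)⁻¹ * a.1 x = _
      rw [one_mul]
      rcases le_total (|x - 1 / 2|) ρ with h | h
      · rw [hu _ (hf3 x h), hf1, hu x h]
      · rw [hf1, hs x h hx, mul_zero, add_zero, add_zero])
  rw [map_add, add_eq_left, map_smul] at h1
  exact (smul_eq_zero.1 h1).resolve_left (by positivity)

/-- Take `f' = 1 + q`, with `f - x` the primitive of `q`, and a function `u` equal to `1` on the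
support. The pullback of `u` differs from `u` exactly by `J(1 + q) - 1`. -/
lemma CutInvariant.apply_jacobian {J : ℝ → ℝ} (hJ : J 1 = 1) {l : SmoothFun ℝ →ₗ[ℝ] M}
    (h : CutInvariant J l) {ρ : ℝ} (hρ0 : 0 < ρ) (hρ : ρ < 1 / 2) {q a : SmoothFun ℝ}
    (hs : SupportedIn ρ q.1) (hint : ∫ x in (0 : ℝ)..1, q.1 x = 0) (hq : ∀ x, |q.1 x| < 1)
    (ha : ∀ x, a.1 x = J (1 + q.1 x) - 1) : l a = 0 := by
  obtain ⟨P, hP, hp, hPs, hPd⟩ := exists_primitive q.2.1 q.2.2 hs hint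
  obtain ⟨f, hf1, hfd, hf2, hf3⟩ := exists_diffeo_supportedIn hP hp hρ0 hρ hPs
    (fun x => by rw [hPd]; exact hq x)
  obtain ⟨u, hu0, hu⟩ := exists_plateau hρ0 hρ (fun _ => 1) contDiff_const
  have h1 := h f u (u + a) hf2 hu0 (by
    refine ext_on_period (u + a).2.2 ?_ fun x hx => ?_
    · intro x
      simp only [f.map_add_one, u.2.2 (f.toFun x), periodic_deriv f x]
    · change u.1 x + a.1 x = _
      rw [hfd, hPd, ha]
      rcases le_total (|x - 1 / 2|) ρ with h | h
      · rw [hu _ (hf3 x h), hu x h]; ring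
      · rw [hf1, hPs x h hx, hs x h hx, add_zero, add_zero, hJ]; ring)
  rwa [map_add, add_eq_left] at h1

lemma exists_unit_bump {c r : ℝ} (hr : 0 < r) (hr' : r < 1 / 2) :
    ∃ β : SmoothFun ℝ, (∀ x, r ≤ |x - c| → |x - c| ≤ 1 / 2 → β.1 x = 0) ∧
      ∫ x in (0 : ℝ)..1, β.1 x = 1 := by
  let χ : ContDiffBump c := ⟨r / 2, r, by positivity, by linarith⟩
  obtain ⟨φ, h1, h2, h3⟩ := exists_periodization χ c r hr' χ.contDiff (fun x hx =>
    χ.zero_of_le_dist (by rwa [Real.dist_eq]))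
  have hpos : 0 < ∫ x in (0 : ℝ)..1, φ x := by
    have h4 := h2.intervalIntegral_add_eq 0 (c - 1 / 2)
    rw [zero_add] at h4
    rw [h4]
    refine intervalIntegral.integral_pos (by linarith) h1.continuous.continuousOn
      (fun x hx => ?_) ⟨c, ⟨by linarith, by linarith⟩, ?_⟩
    · rw [h3 x (abs_le.2 ⟨by linarith [hx.1], by linarith [hx.2]⟩)]
      exact χ.nonneg
    · rw [h3 c (by simp)]
      exact χ.pos_of_mem_ball (by simpa using hr)
  refine ⟨⟨fun x => (∫ x in (0 : ℝ)..1, φ x)⁻¹ * φ x, contDiff_const.mul h1,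
    fun x => congrArg _ (h2 x)⟩, fun x hx hx' => ?_, ?_⟩
  · change _ * φ x = 0
    rw [h3 x hx', χ.zero_of_le_dist (by rwa [Real.dist_eq]), mul_zero]
  · change ∫ x in (0 : ℝ)..1, _ * φ x = 1
    rw [intervalIntegral.integral_const_mul, inv_mul_cancel₀ hpos.ne']

lemma integral_add_val (a b : SmoothFun ℝ) : ∫ x in (0 : ℝ)..1, (a + b).1 x =
    (∫ x in (0 : ℝ)..1, a.1 x) + ∫ x in (0 : ℝ)..1, b.1 x :=
  intervalIntegral.integral_add (a.2.1.continuous.intervalIntegrable _ _)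
    (b.2.1.continuous.intervalIntegrable _ _)

lemma integral_smul_val (c : ℝ) (a : SmoothFun ℝ) : ∫ x in (0 : ℝ)..1, (c • a).1 x =
    c * ∫ x in (0 : ℝ)..1, a.1 x :=
  intervalIntegral.integral_const_mul c _

/-- The only invariant functional on `1`-densities is the integral. -/
lemma CutInvariant.eq_integral {l : SmoothFun ℝ →ₗ[ℝ] M} (h : CutInvariant (fun y => y) l) :
    ∃ κ : M, ∀ a : SmoothFun ℝ, a.1 =ᶠ[𝓝 0] (fun _ => 0) →
      l a = (∫ x in (0 : ℝ)..1, a.1 x) • κ := by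
  obtain ⟨β, hβ, hβ1⟩ := exists_unit_bump (c := 1 / 2) (r := 1 / 4) (by norm_num) (by norm_num)
  refine ⟨l β, fun a ha => ?_⟩
  obtain ⟨ρ, hρ0, hρ, hs⟩ := exists_supportedIn ha a.2.2
  set I := ∫ x in (0 : ℝ)..1, a.1 x with hI
  obtain ⟨C, hC0, hC⟩ := exists_pos_bound (a + (-I) • β)
  -- For `J = id` the defect `J(1 + q) - 1` is `q` itself, so `l` kills all functions of integral
  -- zero, here `a - I β` rescaled to be smaller than `1`.
  have h1 : l ((2 * C)⁻¹ • (a + (-I) • β)) = 0 := by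
    refine h.apply_jacobian rfl (ρ := max ρ (1 / 4)) (by positivity) (max_lt hρ (by norm_num))
      (q := (2 * C)⁻¹ • (a + (-I) • β)) (fun x h1 h2 => ?_) ?_ (fun x => ?_) (fun x => ?_)
    · change (2 * C)⁻¹ * (a.1 x + -I * β.1 x) = 0
      rw [hs x ((le_max_left _ _).trans h1) h2, hβ x ((le_max_right _ _).trans h1) h2]
      simp
    · rw [integral_smul_val, integral_add_val, integral_smul_val, hβ1, ← hI]
      ring
    · change |(2 * C)⁻¹ * (a + (-I) • β).1 x| < 1
      rw [abs_mul, abs_of_pos (by positivity)]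
      calc _ ≤ (2 * C)⁻¹ * C := by gcongr; exact hC x
        _ < 1 := by field_simp; norm_num
    · ring
  rw [map_smul, map_add, map_smul] at h1
  have h2 := (smul_eq_zero.1 h1).resolve_left (by positivity)
  rw [neg_smul, ← sub_eq_add_neg] at h2
  exact sub_eq_zero.1 h2

end Coinvariants

/-! ### Invariant functionals on densities of negative weight. -/

section NegativeWeight

/-- Near `0`, the even function `(1 + q)⁻ᵐ + (1 - q)⁻ᵐ - 2` is the square of a local coordinate. -/
lemma exists_local_sqrt {m : ℕ} (hm : 1 ≤ m) (hm4 : m ≤ 4) :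
    ∃ Θ : ℝ → ℝ, Θ 0 = 0 ∧ ∀ᶠ y in 𝓝 0, ContDiffAt ℝ ∞ Θ y ∧
      ((1 + Θ y) ^ m)⁻¹ + ((1 - Θ y) ^ m)⁻¹ - 2 = y ^ 2 := by
  -- Over the common denominator `(1 - q²)^m` the numerator is even in `q` and divisible by `q²`,
  -- with leading coefficient `m (m + 1)`.
  obtain ⟨N, hN, hN0, hNq⟩ : ∃ N : ℝ → ℝ, ContDiff ℝ ω N ∧ 0 < N 0 ∧
      ∀ q, (1 - q) ^ m + (1 + q) ^ m - 2 * (1 - q ^ 2) ^ m = q ^ 2 * N q := by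
    have hid : ContDiff ℝ ω fun q : ℝ => q := contDiff_id
    interval_cases m
    · exact ⟨fun _ => 2, contDiff_const, by norm_num, fun q => by ring⟩
    · exact ⟨fun q => 6 - 2 * q ^ 2, by fun_prop, by norm_num, fun q => by ring⟩
    · exact ⟨fun q => 12 - 6 * q ^ 2 + 2 * q ^ 4, by fun_prop, by norm_num, fun q => by ring⟩
    · exact ⟨fun q => 20 - 10 * q ^ 2 + 8 * q ^ 4 - 2 * q ^ 6, by fun_prop, by norm_num,
        fun q => by ring⟩
  let K : ℝ → ℝ := fun q => N q / (1 - q ^ 2) ^ m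
  -- Analyticity at a point propagates to a neighbourhood, while being `C^∞` at a point does not;
  -- hence `ω` instead of `∞`.
  have hK : ContDiffAt ℝ ω K 0 := hN.contDiffAt.div
    ((contDiff_const.sub (contDiff_id.pow 2)).pow m).contDiffAt (by simp)
  have hK0 : 0 < K 0 := by simpa [K] using hN0
  -- The even function is `q² K(q) = σ(q)²`, and `σ` has nonzero derivative at `0`, so its local
  -- inverse is the required `Θ`.
  let σ : ℝ → ℝ := fun q => q * √(K q)
  have hσ : ContDiffAt ℝ ω σ 0 := contDiffAt_id.mul (hK.sqrt hK0.ne')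
  have hσd : HasDerivAt σ (√(K 0)) 0 := by
    have h1 := (hasDerivAt_id (0 : ℝ)).fun_mul
      ((hK.sqrt hK0.ne').differentiableAt (by simp)).hasDerivAt
    simpa using h1
  have hne : √(K 0) ≠ 0 := (Real.sqrt_pos.2 hK0).ne'
  have hσF : HasFDerivAt σ ((ContinuousLinearEquiv.unitsEquivAut ℝ (Units.mk0 _ hne) :
      ℝ ≃L[ℝ] ℝ) : ℝ →L[ℝ] ℝ) 0 := by
    have h1 : ((ContinuousLinearEquiv.unitsEquivAut ℝ (Units.mk0 _ hne) : ℝ ≃L[ℝ] ℝ) : ℝ →L[ℝ] ℝ) =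
        ContinuousLinearMap.toSpanSingleton ℝ (√(K 0)) := by
      ext
      simp
    rw [h1]
    exact hσd.hasFDerivAt
  have hω : (ω : WithTop ℕ∞) ≠ 0 := by simp
  refine ⟨hσ.localInverse hσF hω, ?_, ?_⟩
  · have := hσ.localInverse_apply_image hσF hω
    simpa [σ] using this
  · have h1 : ContDiffAt ℝ ω (hσ.localInverse hσF hω) 0 := by
      have := hσ.to_localInverse hσF hω
      simpa [σ] using this
    have h2 : ∀ᶠ y in 𝓝 (0 : ℝ), σ (hσ.localInverse hσF hω y) = y := by
      have := (hσ.hasStrictFDerivAt' hσF hω).eventually_right_inverse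
      have hσ0 : σ 0 = 0 := zero_mul _
      rwa [hσ0] at this
    have h0 : hσ.localInverse hσF hω 0 = 0 := by
      have := hσ.localInverse_apply_image hσF hω
      simpa [σ] using this
    have h3 : ∀ᶠ q in 𝓝 (0 : ℝ), 0 < K q ∧ |q| < 1 :=
      (hK.continuousAt.eventually (lt_mem_nhds hK0)).and
        (continuous_abs.continuousAt.eventually (gt_mem_nhds (by simp)))
    have h4 : Tendsto (hσ.localInverse hσF hω) (𝓝 0) (𝓝 0) := by
      have := h1.continuousAt.tendsto
      rwa [h0] at this
    filter_upwards [h1.eventually (by simp), h2, h4.eventually h3] with y hy1 hy2 hy3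
    refine ⟨hy1.of_le (by simp), ?_⟩
    generalize hσ.localInverse hσF hω y = q at hy2 hy3
    obtain ⟨hKq, hq⟩ := hy3
    rw [← hy2]
    have h5 : σ q ^ 2 = q ^ 2 * K q := by
      change (q * √(K q)) ^ 2 = _
      rw [mul_pow, Real.sq_sqrt hKq.le]
    have h6 : (1 + q) ≠ 0 := by linarith [(abs_lt.1 hq).1]
    have h7 : (1 - q) ≠ 0 := by linarith [(abs_lt.1 hq).2]
    have h8 : (1 - q ^ 2) ^ m = (1 + q) ^ m * (1 - q) ^ m := by
      rw [← mul_pow]; ring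
    rw [h5]
    change _ = q ^ 2 * (N q / (1 - q ^ 2) ^ m)
    rw [mul_div_assoc', ← hNq, h8]
    field_simp

variable {M : Type*} [AddCommGroup M] [Module ℝ M]

/-- The function `(1 + q)⁻ᵐ - 1`. -/
def jacDefect (m : ℕ) (q : SmoothFun ℝ) (hq : ∀ x, |q.1 x| < 1) : SmoothFun ℝ :=
  ⟨fun x => ((1 + q.1 x) ^ m)⁻¹ - 1,
    (((contDiff_const.add q.2.1).pow m).inv fun x =>
      pow_ne_zero _ (by linarith [(abs_lt.1 (hq x)).1])).sub contDiff_const,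
    fun x => by simp only [q.2.2 x]⟩

lemma jacDefect_add {m : ℕ} {q r : SmoothFun ℝ} (hq : ∀ x, |q.1 x| < 1) (hr : ∀ x, |r.1 x| < 1)
    (hqr : ∀ x, |(q + r).1 x| < 1) (h : ∀ x, q.1 x = 0 ∨ r.1 x = 0) :
    jacDefect m (q + r) hqr = jacDefect m q hq + jacDefect m r hr := by
  ext x
  change ((1 + (q.1 x + r.1 x)) ^ m)⁻¹ - 1 =
    (((1 + q.1 x) ^ m)⁻¹ - 1) + (((1 + r.1 x) ^ m)⁻¹ - 1)
  rcases h x with h | h <;> simp [h]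

/-- The defect `(1 + q)⁻ᵐ - 1` is nonlinear in `q`, but additive over disjoint supports; only the
total integral of the pieces has to vanish. -/
lemma CutInvariant.apply_jacDefect {m : ℕ} {l : SmoothFun ℝ →ₗ[ℝ] M}
    (h : CutInvariant (fun y => (y ^ m)⁻¹) l) {ρ : ℝ} (hρ0 : 0 < ρ) (hρ : ρ < 1 / 2)
    {q r : SmoothFun ℝ} (hqs : SupportedIn ρ q.1) (hrs : SupportedIn ρ r.1)
    (hint : (∫ x in (0 : ℝ)..1, q.1 x) + ∫ x in (0 : ℝ)..1, r.1 x = 0) (hq : ∀ x, |q.1 x| < 1)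
    (hr : ∀ x, |r.1 x| < 1) (hqr : ∀ x, q.1 x = 0 ∨ r.1 x = 0) :
    l (jacDefect m q hq) + l (jacDefect m r hr) = 0 := by
  have hlt : ∀ x, |(q + r).1 x| < 1 := fun x => by
    change |q.1 x + r.1 x| < 1
    rcases hqr x with h | h
    · rw [h, zero_add]; exact hr x
    · rw [h, add_zero]; exact hq x
  rw [← map_add, ← jacDefect_add hq hr hlt hqr]
  refine h.apply_jacobian (by simp) hρ0 hρ (q := q + r) (fun x h1 h2 => ?_) ?_ hlt fun x => rfl
  · change q.1 x + r.1 x = 0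
    rw [hqs x h1 h2, hrs x h1 h2, add_zero]
  · rw [integral_add_val, hint]

lemma abs_integral_le {q : SmoothFun ℝ} {C : ℝ} (h : ∀ x, |q.1 x| ≤ C) :
    |∫ x in (0 : ℝ)..1, q.1 x| ≤ C := by
  have := intervalIntegral.norm_integral_le_of_norm_le_const (a := 0) (b := 1) (f := q.1) (C := C)
    fun x _ => h x
  simpa using this

/-- The integral constraint on `q` is removed by compensating with bumps outside the support of `a`.
Combining the relations for the pairs `(q, -s β₁)`, `(-q, s β₂)` and `(s β₂, -s β₁)`, where `s = ∫
q`, shows that `l` kills the even part `(1 + q)⁻ᵐ + (1 - q)⁻ᵐ - 2`. By `exists_local_sqrt` this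
equals `ε² a²` for a suitable `q`. -/
lemma CutInvariant.apply_sq {m : ℕ} (hm : 1 ≤ m) (hm4 : m ≤ 4) {l : SmoothFun ℝ →ₗ[ℝ] M}
    (h : CutInvariant (fun y => (y ^ m)⁻¹) l) {a : SmoothFun ℝ} (ha : a.1 =ᶠ[𝓝 0] fun _ => 0) :
    l (a * a) = 0 := by
  obtain ⟨ρ, hρ0, hρ, hs⟩ := exists_supportedIn ha a.2.2
  -- two disjoint bumps away from the support of `a`
  obtain ⟨d, hd0, hd⟩ : ∃ d : ℝ, 0 < d ∧ 1 / 2 = ρ + 5 * d :=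
      ⟨(1 / 2 - ρ) / 5, by linarith, by ring⟩
  obtain ⟨β₁, hβ₁, hβ₁'⟩ := exists_unit_bump (c := 1 / 2 + ρ + d) (r := d) hd0 (by linarith)
  obtain ⟨β₂, hβ₂, hβ₂'⟩ := exists_unit_bump (c := 1 / 2 + ρ + 3 * d) (r := d) hd0 (by linarith)
  have hz : ∀ x, |x - 1 / 2| ≤ 1 / 2 → (x ≤ 1 / 2 + ρ ∨ 1 / 2 + ρ + 2 * d ≤ x → β₁.1 x = 0) ∧
      (x ≤ 1 / 2 + ρ + 2 * d ∨ 1 / 2 + ρ + 4 * d ≤ x → β₂.1 x = 0) := by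
    intro x hx
    rw [abs_le] at hx
    constructor
    · intro h
      -- The vanishing of `β₁` is known only within `1/2` of its centre `1/2 + ρ + d`; points
      -- further to the left are first shifted by one period.
      rcases le_or_gt (ρ + d) x with h' | h'
      · exact hβ₁ x (le_abs.2
          (h.elim (fun h => Or.inr (by linarith)) fun h => Or.inl (by linarith)))
          (abs_le.2 ⟨by linarith, by linarith⟩)
      · rw [← β₁.2.2 x]
        exact hβ₁ _ (le_abs.2 (Or.inl (by linarith))) (abs_le.2 ⟨by linarith, by linarith⟩)
    · intro h
      rcases le_or_gt (ρ + 3 * d) x with h' | h'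
      · exact hβ₂ x (le_abs.2
          (h.elim (fun h => Or.inr (by linarith)) fun h => Or.inl (by linarith)))
          (abs_le.2 ⟨by linarith, by linarith⟩)
      · rw [← β₂.2.2 x]
        exact hβ₂ _ (le_abs.2 (Or.inl (by linarith))) (abs_le.2 ⟨by linarith, by linarith⟩)
  have hρ' : ρ + 4 * d < 1 / 2 := by linarith
  have hs₁ : SupportedIn (ρ + 4 * d) β₁.1 := fun x h1 h2 => (hz x h2).1 (by
    rcases le_abs.1 h1 with h | h
    · exact Or.inr (by linarith)
    · exact Or.inl (by linarith))
  have hs₂ : SupportedIn (ρ + 4 * d) β₂.1 := fun x h1 h2 => (hz x h2).2 (by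
    rcases le_abs.1 h1 with h | h
    · exact Or.inr (by linarith)
    · exact Or.inl (by linarith))
  have hperm : ∀ u v : SmoothFun ℝ, (∀ x, |x - 1 / 2| ≤ 1 / 2 → u.1 x = 0 ∨ v.1 x = 0) →
      ∀ x, u.1 x = 0 ∨ v.1 x = 0 := by
    intro u v huv x
    obtain ⟨n, hn⟩ := exists_int_abs_sub_le (1 / 2) x
    have := huv _ hn
    rwa [← mul_one (n : ℝ), u.2.2.sub_int_mul_eq, v.2.2.sub_int_mul_eq] at this
  have h12 : ∀ x, β₂.1 x = 0 ∨ β₁.1 x = 0 := hperm _ _ fun x hx => by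
    rcases le_total x (1 / 2 + ρ + 2 * d) with h | h
    · exact Or.inl ((hz x hx).2 (Or.inl h))
    · exact Or.inr ((hz x hx).1 (Or.inr h))
  have ha1 : ∀ x, a.1 x = 0 ∨ β₁.1 x = 0 := hperm _ _ fun x hx => by
    rcases le_total x (1 / 2 + ρ) with h | h
    · exact Or.inr ((hz x hx).1 (Or.inl h))
    · exact Or.inl (hs x (le_abs.2 (Or.inl (by linarith))) hx)
  have ha2 : ∀ x, a.1 x = 0 ∨ β₂.1 x = 0 := hperm _ _ fun x hx => by
    rcases le_total x (1 / 2 + ρ) with h | h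
    · exact Or.inr ((hz x hx).2 (Or.inl (by linarith)))
    · exact Or.inl (hs x (le_abs.2 (Or.inl (by linarith))) hx)
  obtain ⟨B₁, hB₁0, hB₁⟩ := exists_pos_bound β₁
  obtain ⟨B₂, hB₂0, hB₂⟩ := exists_pos_bound β₂
  obtain ⟨Θ, hΘ0, hΘ⟩ := exists_local_sqrt hm hm4
  -- A bound `|q| ≤ η` gives `|s| ≤ η`, and then `q`, `s β₁` and `s β₂` are all smaller than `1`.
  set η := (1 + B₁ + B₂)⁻¹ / 2 with hη
  have hη0 : 0 < η := by positivity
  have hη1 : η * (1 + B₁ + B₂) = 1 / 2 := by rw [hη]; field_simp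
  have hΘc : ∀ᶠ y in 𝓝 (0 : ℝ), |Θ y| < η := by
    have h1 : ContinuousAt Θ 0 := (hΘ.self_of_nhds.1).continuousAt
    exact (h1.abs).eventually (gt_mem_nhds (by simpa [hΘ0] using hη0))
  obtain ⟨r, hr, hball⟩ := Metric.eventually_nhds_iff.1 (hΘ.and hΘc)
  obtain ⟨C, hC0, hC⟩ := exists_pos_bound a
  set ε := r / (2 * C) with hε
  have hε0 : 0 < ε := by positivity
  have hεa : ∀ x, dist (ε * a.1 x) 0 < r := fun x => by
    rw [Real.dist_eq, sub_zero, abs_mul, abs_of_pos hε0]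
    calc _ ≤ r / (2 * C) * C := by gcongr; exact hC x
      _ < r := by field_simp; norm_num
  -- The scale `ε` keeps the argument of `Θ` in the ball where `Θ` is smooth, small and satisfies
  -- its equation.
  let q : SmoothFun ℝ := ⟨fun x => Θ (ε * a.1 x), by
    rw [contDiff_iff_contDiffAt]
    intro x
    exact (hball (hεa x)).1.1.comp x (contDiff_const.mul a.2.1).contDiffAt,
    fun x => by simp only [a.2.2 x]⟩
  have hqη : ∀ x, |q.1 x| ≤ η := fun x => (hball (hεa x)).2.le
  have hqa : ∀ x, a.1 x = 0 → q.1 x = 0 := fun x hx => by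
    change Θ (ε * a.1 x) = 0
    rw [hx, mul_zero, hΘ0]
  set s := ∫ x in (0 : ℝ)..1, q.1 x with hsq
  have hsη : |s| ≤ η := abs_integral_le hqη
  have hη2 : η < 1 := by nlinarith
  have hq1 : ∀ x, |q.1 x| < 1 := fun x => (hqη x).trans_lt hη2
  have hnq1 : ∀ x, |((-1 : ℝ) • q).1 x| < 1 := fun x => by
    change |(-1) * q.1 x| < 1
    rw [neg_one_mul, abs_neg]; exact hq1 x
  have hb1 : ∀ x, |((-s) • β₁).1 x| < 1 := fun x => by
    change |(-s) * β₁.1 x| < 1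
    rw [abs_mul, abs_neg]
    calc _ ≤ η * B₁ := mul_le_mul hsη (hB₁ x) (abs_nonneg _) hη0.le
      _ < 1 := by nlinarith
  have hb2 : ∀ x, |(s • β₂).1 x| < 1 := fun x => by
    change |s * β₂.1 x| < 1
    rw [abs_mul]
    calc _ ≤ η * B₂ := mul_le_mul hsη (hB₂ x) (abs_nonneg _) hη0.le
      _ < 1 := by nlinarith
  have hqs : SupportedIn (ρ + 4 * d) q.1 := fun x h1 h2 => hqa x (hs x (by linarith) h2)
  have hnqs : SupportedIn (ρ + 4 * d) ((-1 : ℝ) • q).1 := fun x h1 h2 => by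
    change (-1) * q.1 x = 0
    rw [hqs x h1 h2, mul_zero]
  have hbs1 : SupportedIn (ρ + 4 * d) ((-s) • β₁).1 := fun x h1 h2 => by
    change (-s) * β₁.1 x = 0
    rw [hs₁ x h1 h2, mul_zero]
  have hbs2 : SupportedIn (ρ + 4 * d) (s • β₂).1 := fun x h1 h2 => by
    change s * β₂.1 x = 0
    rw [hs₂ x h1 h2, mul_zero]
  have hρ4 : 0 < ρ + 4 * d := by linarith
  have e1 := h.apply_jacDefect hρ4 hρ' hqs hbs1 (by
    rw [integral_smul_val, hβ₁', ← hsq]; ring) hq1 hb1 fun x =>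
      (ha1 x).imp (hqa x) fun h => by
        change (-s) * β₁.1 x = 0
        rw [h, mul_zero]
  have e2 := h.apply_jacDefect hρ4 hρ' hnqs hbs2 (by
    rw [integral_smul_val, integral_smul_val, hβ₂', ← hsq]; ring) hnq1 hb2 fun x =>
      (ha2 x).imp (fun h => by
        change (-1) * q.1 x = 0
        rw [hqa x h, mul_zero]) fun h => by
        change s * β₂.1 x = 0
        rw [h, mul_zero]
  have e3 := h.apply_jacDefect hρ4 hρ' hbs2 hbs1 (by
    rw [integral_smul_val, integral_smul_val, hβ₁', hβ₂']; ring) hb2 hb1 fun x =>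
      (h12 x).imp (fun h => by
        change s * β₂.1 x = 0
        rw [h, mul_zero]) fun h => by
        change (-s) * β₁.1 x = 0
        rw [h, mul_zero]
  -- Adding `e1` and `e2` and subtracting `e3` removes both bumps.
  have e4 : l (jacDefect m q hq1) + l (jacDefect m ((-1 : ℝ) • q) hnq1) = 0 := by
    have h1 := congrArg₂ (· + ·) e1 e2
    simp only [add_zero] at h1
    rw [add_add_add_comm, add_comm (l (jacDefect m ((-s) • β₁) hb1)), e3, add_zero] at h1
    exact h1
  have e5 : jacDefect m q hq1 + jacDefect m ((-1 : ℝ) • q) hnq1 = (ε ^ 2) • (a * a) := by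
    ext x
    change (((1 + q.1 x) ^ m)⁻¹ - 1) + (((1 + (-1) * q.1 x) ^ m)⁻¹ - 1) =
      ε ^ 2 * (a.1 x * a.1 x)
    have h1 := (hball (hεa x)).1.2
    change ((1 + q.1 x) ^ m)⁻¹ + ((1 - q.1 x) ^ m)⁻¹ - 2 = _ at h1
    rw [neg_one_mul, ← sub_eq_add_neg]
    linear_combination h1
  rw [← map_add, e5, map_smul] at e4
  exact (smul_eq_zero.1 e4).resolve_left (by positivity)

/-- There are no invariant functionals on densities of negative weight. -/
lemma CutInvariant.eq_zero_of_weight_neg {m : ℕ} (hm : 1 ≤ m) (hm4 : m ≤ 4)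
    {l : SmoothFun ℝ →ₗ[ℝ] M} (h : CutInvariant (fun y => (y ^ m)⁻¹) l) {a : SmoothFun ℝ}
    (ha : a.1 =ᶠ[𝓝 0] fun _ => 0) : l a = 0 := by
  obtain ⟨ρ, hρ0, hρ, hs⟩ := exists_supportedIn ha a.2.2
  obtain ⟨u, hu0, hu⟩ := exists_plateau hρ0 hρ (fun _ => 1) contDiff_const
  -- Polarization: `a = a u` with `u = 1` on the support of `a`, and `2 a u = (a + u)² - a² - u²`.
  have hau : a * u = a := by
    ext x
    refine ext_on_period (a * u).2.2 a.2.2 (fun x hx => ?_) x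
    change a.1 x * u.1 x = a.1 x
    rcases le_total (|x - 1 / 2|) ρ with h | h
    · rw [hu x h, mul_one]
    · rw [hs x h hx, zero_mul]
  have h1 : l ((a + u) * (a + u)) = 0 := h.apply_sq hm hm4 (by
    filter_upwards [ha, hu0] with x hx hx'
    change a.1 x + u.1 x = 0
    rw [hx, hx', add_zero])
  have h2 := h.apply_sq hm hm4 ha
  have h3 := h.apply_sq hm hm4 hu0
  have h4 : (a + u) * (a + u) = a * a + u * u + (2 : ℝ) • (a * u) := by
    rw [two_smul]; ring
  rw [h4, map_add, map_add, h2, h3, zero_add, zero_add, map_smul, hau] at h1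
  exact (smul_eq_zero.1 h1).resolve_left two_ne_zero

end NegativeWeight

/-! ### From invariant functionals to locality of symmetries. -/

section Functionals

variable {𝕜 : Type*} [RCLike 𝕜]

/-- Real smooth functions as `𝕜`-valued functions. -/
def ofRealFun : SmoothFun ℝ →ₗ[ℝ] SmoothFun 𝕜 where
  toFun a := ⟨fun x => ((a.1 x : ℝ) : 𝕜), (RCLike.ofRealCLM (K := 𝕜)).contDiff.comp a.2.1,
    fun x => by simp only [a.2.2 x]⟩
  map_add' a b := by
    ext x
    exact RCLike.ofReal_add _ _
  map_smul' c a := by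
    ext x
    change ((c * a.1 x : ℝ) : 𝕜) = c • ((a.1 x : ℝ) : 𝕜)
    rw [RCLike.ofReal_mul, RCLike.real_smul_eq_coe_mul]

lemma exists_re_im (u : SmoothFun 𝕜) (hu : u.1 =ᶠ[𝓝 0] fun _ => 0) :
    ∃ a b : SmoothFun ℝ, a.1 =ᶠ[𝓝 0] (fun _ => 0) ∧ b.1 =ᶠ[𝓝 0] (fun _ => 0) ∧
      u = ofRealFun a + (RCLike.I : 𝕜) • ofRealFun b := by
  refine ⟨⟨fun x => RCLike.re (u.1 x), (RCLike.reCLM (K := 𝕜)).contDiff.comp u.2.1,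
    fun x => by simp only [u.2.2 x]⟩, ⟨fun x => RCLike.im (u.1 x),
    (RCLike.imCLM (K := 𝕜)).contDiff.comp u.2.1, fun x => by simp only [u.2.2 x]⟩, ?_, ?_, ?_⟩
  · filter_upwards [hu] with x hx
    simp [hx]
  · filter_upwards [hu] with x hx
    simp [hx]
  · ext x
    change u.1 x = ((RCLike.re (u.1 x) : ℝ) : 𝕜) + RCLike.I * ((RCLike.im (u.1 x) : ℝ) : 𝕜)
    rw [mul_comm, RCLike.re_add_im]

lemma vanishesNearZero_single {j : Fin 5} {u : SmoothFun 𝕜} (hu : u.1 =ᶠ[𝓝 0] fun _ => 0) :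
    VanishesNearZero (Pi.single j u : Fin 5 → SmoothFun 𝕜) := by
  intro i
  rcases eq_or_ne i j with rfl | h
  · rwa [Pi.single_eq_same]
  · rw [Pi.single_eq_of_ne h]; exact EventuallyEq.rfl

lemma coeffAct_single (lam mu : 𝕜) (f : CircleDiffeo) (j : Fin 5) (u : SmoothFun 𝕜) (i : Fin 5) :
    coeffAct lam mu f (Pi.single j u) i =
      mcoef lam (logJac f) j i * pull f (mu - lam - (j : ℕ)) u := by
  rw [coeffAct_apply, Finset.sum_eq_single j]
  · rw [Pi.single_eq_same]
  · intro k _ hk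
    rw [Pi.single_eq_of_ne hk, map_zero, mul_zero]
  · simp

lemma pull_eventually_zero {f : CircleDiffeo} (hf : f.toFun =ᶠ[𝓝 0] id) {u : SmoothFun 𝕜}
    (hu : u.1 =ᶠ[𝓝 0] fun _ => 0) (w : 𝕜) : (pull f w u).1 =ᶠ[𝓝 0] fun _ => 0 := by
  filter_upwards [hu, hf] with x hx hx'
  rw [pull_apply, hx', id, hx, mul_zero]

/-- A functional invariant under the diffeomorphisms that are trivial near `0`. -/
def IsCutInvariant (lam mu : 𝕜) (l : (Fin 5 → SmoothFun 𝕜) →ₗ[𝕜] 𝕜) : Prop :=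
  ∀ (f : CircleDiffeo) (a : Fin 5 → SmoothFun 𝕜), f.toFun =ᶠ[𝓝 0] id → VanishesNearZero a →
    l (coeffAct lam mu f a) = l a

/-- The restriction of an invariant functional to the principal symbols. -/
lemma IsCutInvariant.cutInvariant_single {lam mu : 𝕜} {l : (Fin 5 → SmoothFun 𝕜) →ₗ[𝕜] 𝕜}
    (h : IsCutInvariant lam mu l) {j : Fin 5}
    (hlt : ∀ i < j, ∀ u : SmoothFun 𝕜, u.1 =ᶠ[𝓝 0] (fun _ => 0) → l (Pi.single i u) = 0)
    {J : ℝ → ℝ} (hJ : ∀ (f : CircleDiffeo) (x : ℝ),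
      (jacPow f (mu - lam - (j : ℕ))).1 x = ((J (deriv f.toFun x) : ℝ) : 𝕜)) :
    CutInvariant J ((l.restrictScalars ℝ).comp
      (((LinearMap.single 𝕜 (fun _ : Fin 5 => SmoothFun 𝕜) j).restrictScalars ℝ).comp
        ofRealFun)) := by
  intro f u v hf hu hv
  change l (Pi.single j (ofRealFun v)) = l (Pi.single j (ofRealFun u))
  have hu' : (ofRealFun u : SmoothFun 𝕜).1 =ᶠ[𝓝 0] fun _ => 0 := by
    filter_upwards [hu] with x hx
    change ((u.1 x : ℝ) : 𝕜) = 0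
    rw [hx, RCLike.ofReal_zero]
  have hv' : (ofRealFun v : SmoothFun 𝕜) = pull f (mu - lam - (j : ℕ)) (ofRealFun u) := by
    ext x
    rw [pull_apply, hJ]
    change ((v.1 x : ℝ) : 𝕜) = _ * ((u.1 (f.toFun x) : ℝ) : 𝕜)
    rw [hv, RCLike.ofReal_mul]
  -- The pullback of an operator with a single coefficient has the transported coefficient on top
  -- and lower order terms, which `l` kills by hypothesis.
  rw [← h f _ hf (vanishesNearZero_single hu'), ← Finset.univ_sum_single (coeffAct lam mu f _),
    map_sum, Finset.sum_eq_single j]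
  · rw [coeffAct_single, mcoef_self, one_mul, hv']
  · intro i _ hij
    rw [coeffAct_single]
    rcases lt_or_gt_of_ne hij with hij | hij
    · refine hlt i hij _ ?_
      filter_upwards [pull_eventually_zero hf hu' (mu - lam - (j : ℕ))] with x hx
      change _ * (pull f (mu - lam - (j : ℕ)) (ofRealFun u)).1 x = 0
      rw [hx, mul_zero]
    · rw [mcoef_eq_zero _ _ (by exact_mod_cast hij), zero_mul, Pi.single_zero, map_zero]
  · simp

lemma apply_single_eq_zero_of_real {l : (Fin 5 → SmoothFun 𝕜) →ₗ[𝕜] 𝕜} {j : Fin 5}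
    (h : ∀ a : SmoothFun ℝ, a.1 =ᶠ[𝓝 0] (fun _ => 0) → l (Pi.single j (ofRealFun a)) = 0)
    {u : SmoothFun 𝕜} (hu : u.1 =ᶠ[𝓝 0] fun _ => 0) : l (Pi.single j u) = 0 := by
  obtain ⟨a, b, ha, hb, rfl⟩ := exists_re_im u hu
  rw [Pi.single_add, Pi.single_smul, map_add, map_smul, h a ha, h b hb, smul_zero, add_zero]

/-- Induction on the order. Once the lower orders are killed, the order `j` coefficient is seen only
as a density of weight `d - j`, which for `j ≥ d` is zero or a negative integer; there are no
invariant functionals on such densities. -/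
lemma IsCutInvariant.eq_zero {lam mu : 𝕜} {l : (Fin 5 → SmoothFun 𝕜) →ₗ[𝕜] 𝕜}
    (h : IsCutInvariant lam mu l) {d : ℕ} (hd : mu - lam = d)
    (h0 : ∀ i : Fin 5, (i : ℕ) < d → ∀ u : SmoothFun 𝕜, u.1 =ᶠ[𝓝 0] (fun _ => 0) →
      l (Pi.single i u) = 0)
    {a : Fin 5 → SmoothFun 𝕜} (ha : VanishesNearZero a) : l a = 0 := by
  have key : ∀ (n : ℕ) (j : Fin 5), (j : ℕ) = n → ∀ u : SmoothFun 𝕜, u.1 =ᶠ[𝓝 0] (fun _ => 0) →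
      l (Pi.single j u) = 0 := by
    intro n
    induction n using Nat.strong_induction_on with
    | _ n ih =>
      intro j hj u hu
      by_cases hjd : (j : ℕ) < d
      · exact h0 j hjd u hu
      · obtain ⟨m, hm⟩ := Nat.exists_eq_add_of_le (not_lt.1 hjd)
        have hinv := h.cutInvariant_single (j := j) (J := fun y => (y ^ m)⁻¹)
          (fun i hi => ih i (hj ▸ hi) i rfl) (fun f x => by
            rw [hd, hm, Nat.cast_add, sub_add_cancel_left, jacPow_neg_natCast_apply])
        refine apply_single_eq_zero_of_real (fun a ha => ?_) hu
        rcases Nat.eq_zero_or_pos m with rfl | hm0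
        · simp only [pow_zero, inv_one] at hinv
          exact hinv.eq_zero_of_weight_zero ha
        · exact hinv.eq_zero_of_weight_neg hm0 (by omega) ha
  rw [← Finset.univ_sum_single a, map_sum]
  exact Finset.sum_eq_zero fun j _ => key j j rfl _ (ha j)

lemma isCutInvariant_eval {lam mu : 𝕜} {T : Module.End 𝕜 (Fin 5 → SmoothFun 𝕜)}
    (hT : T ∈ CoeffSymmetryAlgebra lam mu) (j : Fin 5) {l : (Fin 5 → SmoothFun 𝕜) →ₗ[𝕜] 𝕜}
    (hl : ∀ a, l a = (T a j).1 0) : IsCutInvariant lam mu l := by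
  intro f a hf _
  have h1 : f.toFun =ᶠ[𝓝 0] fun y => 1 * y + 0 := by
    filter_upwards [hf] with y hy
    rw [hy, one_mul, add_zero, id]
  rw [hl, hl, mem_coeffSymmetryAlgebra.1 hT, coeffAct_apply_of_affine lam mu _ _ h1,
    jacPow_apply_of_deriv_eq_one, one_mul, hf.eq_of_nhds]
  · rfl
  · rw [hf.deriv_eq]; simp

/-- Evaluation of the `j`-th coefficient at `0`. -/
def evalZero (j : Fin 5) : (Fin 5 → SmoothFun 𝕜) →ₗ[𝕜] 𝕜 where
  toFun a := (a j).1 0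
  map_add' _ _ := rfl
  map_smul' _ _ := rfl

/-- A linear map whose values at `0` only depend on germs at `0`. -/
def IsLocalAtZero (T : Module.End 𝕜 (Fin 5 → SmoothFun 𝕜)) : Prop :=
  ∀ a, VanishesNearZero a → ∀ j, (T a j).1 0 = 0

/-- The only value not covered by `eval_zero_eq_zero` is the one with `mu = lam`, `j = 0`. There all
coefficients have weight at most `0`, so `IsCutInvariant.eq_zero` applies with `d = 0`. -/
lemma isLocalAtZero_of_ne {lam mu : 𝕜} (hne : ¬ (lam = 0 ∧ mu = 1))
    {T : Module.End 𝕜 (Fin 5 → SmoothFun 𝕜)} (hT : T ∈ CoeffSymmetryAlgebra lam mu) :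
    IsLocalAtZero T := by
  intro a ha j
  by_cases h : mu = lam ∧ j = 0
  · obtain ⟨rfl, rfl⟩ := h
    exact (isCutInvariant_eval hT 0 (l := (evalZero 0).comp T) fun _ => rfl).eq_zero (d := 0)
      (by simp) (by simp) ha
  · exact eval_zero_eq_zero hT ha ⟨h, fun h' => hne ⟨h'.1, h'.2.1⟩⟩

lemma mcoef_zero_right (p : SmoothFun 𝕜) (n : ℕ) : mcoef (0 : 𝕜) p (n + 1) 0 = 0 := by
  induction n with
  | zero => simp [mcoef, ddx_one]
  | succ n ih => rw [mcoef, ih]; simp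

/-- For `lam = 0` the constant function `1` is invariant, so `a_0 = A(1)` transforms as a density of
weight `mu`. -/
lemma coeffAct_zero_left (mu : 𝕜) (f : CircleDiffeo) (a : Fin 5 → SmoothFun 𝕜) :
    coeffAct 0 mu f a 0 = pull f mu (a 0) := by
  rw [coeffAct_apply, Finset.sum_eq_single 0]
  · simp [mcoef]
  · intro j _ hj
    obtain ⟨n, hn⟩ := Nat.exists_eq_succ_of_ne_zero (show (j : ℕ) ≠ 0 from
      fun h => hj (Fin.ext h))
    rw [hn, Nat.succ_eq_add_one, Fin.val_zero, mcoef_zero_right, zero_mul]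
  · simp

/-- The integral over the circle. -/
def integralCircle : SmoothFun 𝕜 →ₗ[𝕜] 𝕜 where
  toFun u := ∫ x in (0 : ℝ)..1, u.1 x
  map_add' a b := intervalIntegral.integral_add (a.2.1.continuous.intervalIntegrable _ _)
    (b.2.1.continuous.intervalIntegrable _ _)
  map_smul' c _ := intervalIntegral.integral_const_mul c _

lemma integralCircle_pull (f : CircleDiffeo) (u : SmoothFun 𝕜) :
    integralCircle (pull f 1 u) = integralCircle u := by
  have h1 : ∀ x, (pull f 1 u).1 x = deriv f.toFun x • (u.1 ∘ f.toFun) x := fun x => by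
    rw [pull_apply, jacPow_one_apply, RCLike.real_smul_eq_coe_mul]
    rfl
  change ∫ x in (0 : ℝ)..1, (pull f 1 u).1 x = ∫ x in (0 : ℝ)..1, u.1 x
  simp only [h1]
  rw [intervalIntegral.integral_deriv_smul_comp (fun x _ =>
    ((f.contDiff_toFun.differentiable (by simp)) x).hasDerivAt)
    (contDiff_deriv f).continuous.continuousOn u.2.1.continuous]
  have h2 : f.toFun 1 = f.toFun 0 + 1 := by
    have := f.map_add_one 0
    rwa [zero_add] at this
  rw [h2, u.2.2.intervalIntegral_add_eq (f.toFun 0) 0, zero_add]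

/-- The nonlocal symmetry `A ↦ (∫ A(1)) d/dx`. -/
def nonlocalOp : Module.End 𝕜 (Fin 5 → SmoothFun 𝕜) :=
  (LinearMap.single 𝕜 (fun _ : Fin 5 => SmoothFun 𝕜) 1).comp
    ((Algebra.linearMap 𝕜 (SmoothFun 𝕜)).comp (integralCircle.comp (LinearMap.proj 0)))

lemma nonlocalOp_apply (a : Fin 5 → SmoothFun 𝕜) :
    nonlocalOp a = Pi.single 1 (algebraMap 𝕜 _ (integralCircle (a 0))) := rfl

/-- At `(0, 1)` the coefficient `A(1)` is a `1`-density with invariant integral, and `d/dx` is an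
invariant operator from functions to `1`-densities. -/
lemma nonlocalOp_mem : nonlocalOp ∈ CoeffSymmetryAlgebra (0 : 𝕜) 1 := by
  rw [mem_coeffSymmetryAlgebra]
  intro f a
  rw [nonlocalOp_apply, nonlocalOp_apply, coeffAct_zero_left, integralCircle_pull]
  ext i : 1
  rw [coeffAct_single]
  have h1 : pull f ((1 : 𝕜) - 0 - ((1 : Fin 5) : ℕ))
      (algebraMap 𝕜 (SmoothFun 𝕜) (integralCircle (a 0))) =
      algebraMap 𝕜 (SmoothFun 𝕜) (integralCircle (a 0)) := by
    have h2 : (1 : 𝕜) - 0 - ((1 : Fin 5) : ℕ) = 0 := by simp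
    ext x
    rw [h2, pull_apply, jacPow_zero]
    exact one_mul _
  rw [h1]
  rcases eq_or_ne i 1 with rfl | hi
  · rw [Pi.single_eq_same, mcoef_self, one_mul]
  · rw [Pi.single_eq_of_ne hi]
    rcases eq_or_ne i 0 with rfl | hi0
    · rw [Fin.val_one, Fin.val_zero, mcoef_zero_right _ 0, zero_mul]
    · rw [mcoef_eq_zero _ _ (by
        have h2 : (i : ℕ) ≠ 0 := fun h => hi0 (Fin.ext h)
        have h3 : (i : ℕ) ≠ 1 := fun h => hi (Fin.ext h)
        rw [Fin.val_one]; omega), zero_mul]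

lemma integralCircle_ofRealFun (a : SmoothFun ℝ) :
    integralCircle (ofRealFun a : SmoothFun 𝕜) = ((∫ x in (0 : ℝ)..1, a.1 x : ℝ) : 𝕜) :=
  ContinuousLinearMap.intervalIntegral_comp_comm (RCLike.ofRealCLM (K := 𝕜))
    (a.2.1.continuous.intervalIntegrable _ _)

lemma evalZero_comp_apply (T : Module.End 𝕜 (Fin 5 → SmoothFun 𝕜)) (j : Fin 5)
    (a : Fin 5 → SmoothFun 𝕜) : ((evalZero j).comp T) a = (T a j).1 0 := rfl

/-- At `(0, 1)` with `j = 1`, the coefficients of order at least `1` have weight at most `0` and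
cause no obstruction. Only the order zero coefficient, of weight `1`, has to be tested. -/
lemma isLocalAtZero_of_apply_single_eq_zero {T : Module.End 𝕜 (Fin 5 → SmoothFun 𝕜)}
    (hT : T ∈ CoeffSymmetryAlgebra (0 : 𝕜) 1)
    (h : ∀ a : SmoothFun ℝ, a.1 =ᶠ[𝓝 0] (fun _ => 0) →
      (T (Pi.single 0 (ofRealFun a)) 1).1 0 = 0) : IsLocalAtZero T := by
  intro a ha j
  by_cases hj : j = 1
  · subst hj
    rw [← evalZero_comp_apply]
    refine (isCutInvariant_eval hT 1 (evalZero_comp_apply T 1)).eq_zero (d := 1)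
      (by rw [sub_zero, Nat.cast_one]) (fun i hi u hu => ?_) ha
    have hi0 : i = 0 := Fin.ext (Nat.lt_one_iff.1 hi)
    subst hi0
    exact apply_single_eq_zero_of_real (fun a ha => h a ha) hu
  · exact eval_zero_eq_zero hT ha
      ⟨fun h => one_ne_zero (α := 𝕜) h.1, fun h => hj h.2.2⟩

lemma sub_smul_nonlocalOp_mem {T : Module.End 𝕜 (Fin 5 → SmoothFun 𝕜)}
    (hT : T ∈ CoeffSymmetryAlgebra (0 : 𝕜) 1) (κ : 𝕜) :
    T - κ • nonlocalOp ∈ CoeffSymmetryAlgebra (0 : 𝕜) 1 := by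
  rw [mem_coeffSymmetryAlgebra]
  intro f a
  rw [LinearMap.sub_apply, LinearMap.sub_apply, LinearMap.smul_apply, LinearMap.smul_apply,
    mem_coeffSymmetryAlgebra.1 hT, mem_coeffSymmetryAlgebra.1 nonlocalOp_mem, map_sub, map_smul]

lemma nonlocalOp_single_apply (u : SmoothFun 𝕜) :
    (nonlocalOp (Pi.single 0 u : Fin 5 → SmoothFun 𝕜) 1).1 0 = integralCircle u := by
  rw [nonlocalOp_apply, Pi.single_eq_same, Pi.single_eq_same]
  rfl

/-- There are no orders below `0`, so the restriction to order zero is already an invariant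
functional on `1`-densities. -/
lemma exists_apply_single_eq_integral {T : Module.End 𝕜 (Fin 5 → SmoothFun 𝕜)}
    (hT : T ∈ CoeffSymmetryAlgebra (0 : 𝕜) 1) : ∃ κ : 𝕜, ∀ a : SmoothFun ℝ,
      a.1 =ᶠ[𝓝 0] (fun _ => 0) →
      (T (Pi.single 0 (ofRealFun a)) 1).1 0 = (∫ x in (0 : ℝ)..1, a.1 x) • κ := by
  have hinv := isCutInvariant_eval hT 1 (evalZero_comp_apply T 1)
  obtain ⟨κ, hκ⟩ := (hinv.cutInvariant_single (j := 0) (J := fun y => y)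
    (fun i hi => absurd hi (Fin.not_lt_zero i)) (fun f x => by
      rw [Fin.val_zero, Nat.cast_zero, sub_zero, sub_zero, jacPow_one_apply])).eq_integral
  exact ⟨κ, hκ⟩

/-- At `(0, 1)`, symmetries are local up to a multiple of `nonlocalOp`. -/
lemma exists_isLocalAtZero_sub {T : Module.End 𝕜 (Fin 5 → SmoothFun 𝕜)}
    (hT : T ∈ CoeffSymmetryAlgebra (0 : 𝕜) 1) : ∃ κ : 𝕜, IsLocalAtZero (T - κ • nonlocalOp) := by
  obtain ⟨κ, hκ⟩ := exists_apply_single_eq_integral hT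
  refine ⟨κ, isLocalAtZero_of_apply_single_eq_zero (sub_smul_nonlocalOp_mem hT κ) fun a ha => ?_⟩
  have hS : ∀ a, ((T - κ • nonlocalOp : Module.End 𝕜 (Fin 5 → SmoothFun 𝕜)) a 1).1 0 =
      (T a 1).1 0 - κ * (nonlocalOp a 1).1 0 := fun a => rfl
  rw [hS, hκ a ha, nonlocalOp_single_apply, integralCircle_ofRealFun,
    RCLike.real_smul_eq_coe_mul, mul_comm κ, sub_self]

end Functionals

/-! ### Homogeneous functionals on germs depend on finite jets. -/

section FiniteJets

variable {𝕜 : Type*} [RCLike 𝕜]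

lemma contDiffOn_of_forall_hasDerivAt {E : Type*} [NormedAddCommGroup E] [NormedSpace ℝ E]
    {s : Set ℝ} (hs : IsOpen s) (F : ℕ → ℝ → E)
    (hF : ∀ l, ∀ x ∈ s, HasDerivAt (F l) (F (l + 1) x) x) : ContDiffOn ℝ ∞ (F 0) s := by
  rw [contDiffOn_infty]
  intro n
  suffices ∀ l, ContDiffOn ℝ n (F l) s from this 0
  induction n with
  | zero =>
    intro l
    exact contDiffOn_zero.2 fun x hx => (hF l x hx).continuousAt.continuousWithinAt
  | succ n ih =>
    intro l
    rw [Nat.cast_succ, contDiffOn_succ_iff_deriv_of_isOpen hs]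
    refine ⟨fun x hx => (hF l x hx).differentiableAt.differentiableWithinAt, by simp, ?_⟩
    exact (ih (l + 1)).congr fun x hx => (hF l x hx).deriv

/-- Derivatives of a function vanishing to order `m` at `0`. -/
lemma exists_bound_of_flat (r : SmoothFun 𝕜) {m : ℕ}
    (hr : ∀ p < m, ((ddx 𝕜 ^ p) r).1 0 = 0) (l : ℕ) :
    ∃ C, 0 < C ∧ ∀ x : ℝ, ‖((ddx 𝕜 ^ l) r).1 x‖ ≤ C * |x| ^ (m - l) := by
  obtain ⟨k, hk⟩ : ∃ k, k = m - l := ⟨_, rfl⟩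
  rw [← hk]
  induction k generalizing l with
  | zero =>
    obtain ⟨C, hC0, hC⟩ := exists_bound_of_periodic ((ddx 𝕜 ^ l) r).2.1.continuous
      ((ddx 𝕜 ^ l) r).2.2
    exact ⟨C, hC0, fun x => by simpa using hC x⟩
  | succ k ih =>
    obtain ⟨C, hC0, hC⟩ := ih (l + 1) (by omega)
    refine ⟨C, hC0, fun x => ?_⟩
    have h1 : ∀ y ∈ Set.uIcc 0 x, ‖((ddx 𝕜 ^ (l + 1)) r).1 y‖ ≤ C * |x| ^ k := fun y hy => by
      refine (hC y).trans ?_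
      have h2 : |y| ≤ |x| := by simpa using Set.abs_sub_left_of_mem_uIcc hy
      gcongr
    have h2 := (convex_uIcc (0 : ℝ) x).norm_image_sub_le_of_norm_hasDerivWithin_le
      (f := ((ddx 𝕜 ^ l) r).1) (f' := ((ddx 𝕜 ^ (l + 1)) r).1) (C := C * |x| ^ k)
      (fun y _ => by
        rw [pow_succ']
        exact (hasDerivAt_smoothFun ((ddx 𝕜 ^ l) r) y).hasDerivWithinAt) h1
      Set.left_mem_uIcc Set.right_mem_uIcc
    rw [hr l (by omega), sub_zero, sub_zero, Real.norm_eq_abs] at h2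
    rwa [pow_succ, ← mul_assoc]

/-- The equation `b(x) - ρ b(q x) = r(x)` is solvable near `0` if `r` is flat enough. -/
lemma exists_solution_of_flat (r : SmoothFun 𝕜) {m : ℕ}
    (hr : ∀ p < m, ((ddx 𝕜 ^ p) r).1 0 = 0) {q ρ : ℝ} (hq0 : 0 < q) (hq1 : q < 1) (hρ0 : 0 < ρ)
    (hρ : ρ * q ^ m < 1) :
    ∃ b : ℝ → 𝕜, ContDiffOn ℝ ∞ b (Set.Ioo (-1) 1) ∧
      ∀ x ∈ Set.Ioo (-1 : ℝ) 1, b x - ρ * b (q * x) = r.1 x := by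
  -- The solution is `b = ∑ ρ^k r(q^k x)`, and `g l k` is the `l`-th derivative of its `k`-th term.
  -- Flatness of `r` bounds each of these by a constant times `(ρ q^m)^k`, so the series may be
  -- differentiated termwise.
  let g : ℕ → ℕ → ℝ → 𝕜 := fun l k x =>
    (((ρ * q ^ l) ^ k : ℝ) : 𝕜) * ((ddx 𝕜 ^ l) r).1 (q ^ k * x)
  have hg : ∀ l k x, HasDerivAt (g l k) (g (l + 1) k x) x := by
    intro l k x
    have h1 : HasDerivAt (fun x : ℝ => q ^ k * x) (q ^ k) x := by
      simpa using (hasDerivAt_id x).const_mul (q ^ k)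
    have h2 := ((hasDerivAt_smoothFun ((ddx 𝕜 ^ l) r) (q ^ k * x)).scomp x h1).const_mul
      ((((ρ * q ^ l) ^ k : ℝ) : 𝕜))
    refine h2.congr_deriv ?_
    rw [RCLike.real_smul_eq_coe_mul, ← mul_assoc, ← RCLike.ofReal_mul]
    change _ * (ddx 𝕜 ((ddx 𝕜 ^ l) r)).1 _ = _ * ((ddx 𝕜 ^ (l + 1)) r).1 _
    rw [pow_succ' (ddx 𝕜)]
    congr 2
    rw [pow_succ, ← mul_pow, mul_assoc]
  have hbound : ∀ l, ∃ C, 0 < C ∧ ∀ k, ∀ x ∈ Set.Ioo (-1 : ℝ) 1, ‖g l k x‖ ≤ C * (ρ * q ^ m) ^ k := by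
    intro l
    obtain ⟨C, hC0, hC⟩ := exists_bound_of_flat r hr l
    refine ⟨C, hC0, fun k x hx => ?_⟩
    have hx1 : |x| ≤ 1 := abs_le.2 ⟨hx.1.le, hx.2.le⟩
    have h1 : ‖g l k x‖ ≤ (ρ * q ^ l) ^ k * (C * |q ^ k * x| ^ (m - l)) := by
      rw [norm_mul, RCLike.norm_ofReal, abs_of_pos (by positivity)]
      gcongr
      exact hC _
    refine h1.trans ?_
    rw [abs_mul, abs_of_pos (by positivity : 0 < q ^ k)]
    calc _ ≤ (ρ * q ^ l) ^ k * (C * (q ^ k * 1) ^ (m - l)) := by gcongr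
      _ = C * (ρ * (q ^ l * q ^ (m - l))) ^ k := by
        rw [mul_one, ← pow_mul, mul_comm k, pow_mul]; ring
      _ ≤ C * (ρ * q ^ m) ^ k := by
        gcongr C * (ρ * ?_) ^ k
        rw [← pow_add]
        exact pow_le_pow_of_le_one hq0.le hq1.le (by omega)
  have hsumm : ∀ C : ℝ, Summable fun k => C * (ρ * q ^ m) ^ k := fun C =>
    (summable_geometric_of_lt_one (by positivity) hρ).mul_left C
  have hS : ∀ l, ∀ x ∈ Set.Ioo (-1 : ℝ) 1, Summable fun k => g l k x := by
    intro l x hx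
    obtain ⟨C, -, hC⟩ := hbound l
    exact Summable.of_norm_bounded (hsumm C) fun k => hC k x hx
  refine ⟨fun x => ∑' k, g 0 k x, contDiffOn_of_forall_hasDerivAt isOpen_Ioo
    (fun l x => ∑' k, g l k x) fun l x hx => ?_, fun x hx => ?_⟩
  · obtain ⟨C, -, hC⟩ := hbound (l + 1)
    exact hasDerivAt_tsum_of_isPreconnected (hsumm C) isOpen_Ioo isPreconnected_Ioo
      (fun k y _ => hg l k y) (fun k y hy => hC k y hy) hx (hS l x hx) hx
  · have h1 := (hS 0 x hx).tsum_eq_zero_add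
    have h2 : ∀ k, g 0 (k + 1) x = (ρ : 𝕜) * g 0 k (q * x) := fun k => by
      simp only [g, pow_zero, mul_one]
      rw [pow_succ', RCLike.ofReal_mul, mul_assoc, pow_succ, mul_assoc]
    simp only [h2] at h1
    rw [tsum_mul_left] at h1
    change (∑' k, g 0 k x) - ρ * ∑' k, g 0 k (q * x) = r.1 x
    rw [h1, add_sub_cancel_right]
    simp [g]

/-- A linear functional on germs at `0` that is homogeneous under a contraction is a
derivative at `0`. -/
lemma exists_eq_deriv_of_homogeneous {L : SmoothFun 𝕜 →ₗ[𝕜] 𝕜}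
    (hloc : ∀ φ : SmoothFun 𝕜, φ.1 =ᶠ[𝓝 0] (fun _ => 0) → L φ = 0) {q : ℝ} (hq0 : 0 < q)
    (hq1 : q < 1) (i j : ℕ)
    (h : ∀ φ ψ : SmoothFun 𝕜, ψ.1 =ᶠ[𝓝 0] (fun x => φ.1 (q * x)) →
      ((q ^ i : ℝ) : 𝕜) * L ψ = ((q ^ j : ℝ) : 𝕜) * L φ) :
    ∃ c : 𝕜, ∀ φ, L φ = if i ≤ j then c * ((ddx 𝕜 ^ (j - i)) φ).1 0 else 0 := by
  have hcongr : ∀ φ ψ : SmoothFun 𝕜, φ.1 =ᶠ[𝓝 0] ψ.1 → L φ = L ψ := fun φ ψ hφψ => by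
    rw [← sub_eq_zero, ← map_sub]
    refine hloc _ ?_
    filter_upwards [hφψ] with x hx
    exact sub_eq_zero.2 hx
  choose e he using fun k => exists_germ_pow (𝕜 := 𝕜) k 0
  have he' : ∀ k, (e k).1 =ᶠ[𝓝 0] fun x : ℝ => ((x : ℝ) : 𝕜) ^ k := fun k => by
    simpa using he k
  have hscale : Tendsto (fun x : ℝ => q * x) (𝓝 0) (𝓝 0) := by
    have : ContinuousAt (fun x : ℝ => q * x) 0 := continuousAt_const.mul continuousAt_id
    simpa using this.tendsto
  -- On the germ `x^p` the contraction acts by `q^p`, so homogeneity reads `q^(i + p) L = q^j L`.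
  have hLe : ∀ p, i + p ≠ j → L (e p) = 0 := by
    intro p hp
    have h1 := h (e p) ((((q ^ p : ℝ)) : 𝕜) • e p) (by
      filter_upwards [he' p, hscale.eventually (he' p)] with x hx hx'
      rw [hx']
      change ((q ^ p : ℝ) : 𝕜) * (e p).1 x = _
      rw [hx, RCLike.ofReal_mul, mul_pow, RCLike.ofReal_pow])
    rw [map_smul, smul_eq_mul, ← mul_assoc, ← RCLike.ofReal_mul, ← pow_add, ← sub_eq_zero,
      ← sub_mul, ← RCLike.ofReal_sub] at h1
    refine (mul_eq_zero.1 h1).resolve_left ?_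
    exact RCLike.ofReal_ne_zero.2 (sub_ne_zero.2 fun h => hp (pow_right_injective₀ hq0 hq1.ne h))
  -- If `φ(x) - q^(i - j) φ(q x) = r(x)` near `0`, homogeneity gives `L φ - L r = L φ`. Such a `φ`
  -- exists because flatness to order `j + 1` turns the ratio of the series into `q^(i + 1) < 1`.
  have hflat : ∀ r : SmoothFun 𝕜, (∀ p < j + 1, ((ddx 𝕜 ^ p) r).1 0 = 0) → L r = 0 := by
    intro r hr
    have hρ0 : 0 < q ^ i / q ^ j := by positivity
    obtain ⟨b, hb, hbr⟩ := exists_solution_of_flat r hr hq0 hq1 hρ0 (by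
      rw [pow_succ, div_mul_eq_mul_div, div_lt_one (by positivity)]
      calc q ^ i * (q ^ j * q) = (q ^ i * q) * q ^ j := by ring
        _ < 1 * q ^ j := by
          gcongr
          exact mul_lt_one_of_nonneg_of_lt_one_right (pow_le_one₀ hq0.le hq1.le) hq0.le hq1
        _ = q ^ j := one_mul _)
    obtain ⟨φ, h1, h2, h3, -⟩ := exists_periodic_cutoff b 0 (1 / 8) (1 / 4) (by norm_num)
      (by norm_num) (by norm_num) fun x hx => by
        rw [sub_zero, abs_le] at hx
        exact (hb x ⟨by linarith, by linarith⟩).contDiffAt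
          (Ioo_mem_nhds (by linarith) (by linarith))
    let φ' : SmoothFun 𝕜 := ⟨φ, h1, h2⟩
    let ψ : SmoothFun 𝕜 := (((q ^ i / q ^ j : ℝ) : 𝕜))⁻¹ • (φ' - r)
    have hφ : φ =ᶠ[𝓝 0] b := by
      filter_upwards [Metric.closedBall_mem_nhds 0 (show (0 : ℝ) < 1 / 8 by norm_num)] with x hx
      exact h3 x (by rwa [Metric.mem_closedBall, Real.dist_eq] at hx)
    have h4 := h φ' ψ (by
      filter_upwards [hφ, hscale.eventually hφ, Ioo_mem_nhds (show (-1 : ℝ) < 0 by norm_num)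
        (show (0 : ℝ) < 1 by norm_num)] with x hx hx' hx1
      change _ * (φ x - r.1 x) = φ (q * x)
      rw [hx, hx', ← hbr x hx1, sub_sub_cancel, inv_mul_cancel_left₀]
      exact RCLike.ofReal_ne_zero.2 hρ0.ne')
    have hqi : ((q ^ i : ℝ) : 𝕜) ≠ 0 := RCLike.ofReal_ne_zero.2 (by positivity)
    have hqj : ((q ^ j : ℝ) : 𝕜) ≠ 0 := RCLike.ofReal_ne_zero.2 (by positivity)
    rw [map_smul, map_sub, smul_eq_mul, RCLike.ofReal_div] at h4
    field_simp at h4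
    simpa using h4
  -- Subtracting the Taylor polynomial of degree `j` leaves a flat remainder; of the monomials only
  -- `p = j - i` contributes.
  have htaylor : ∀ φ, L φ = ∑ p ∈ Finset.range (j + 1),
      ((ddx 𝕜 ^ p) φ).1 0 / (p.factorial : 𝕜) * L (e p) := by
    intro φ
    have h1 := hflat (φ - ∑ p ∈ Finset.range (j + 1),
        (((ddx 𝕜 ^ p) φ).1 0 / (p.factorial : 𝕜)) • e p) (by
      intro p hp
      rw [map_sub, map_sum]
      have h2 : ∀ s : SmoothFun 𝕜, (((ddx 𝕜 ^ p) φ) - s).1 0 = ((ddx 𝕜 ^ p) φ).1 0 - s.1 0 :=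
        fun s => rfl
      have h3 : (∑ x ∈ Finset.range (j + 1), (ddx 𝕜 ^ p)
          ((((ddx 𝕜 ^ x) φ).1 0 / (x.factorial : 𝕜)) • e x)).1 0 =
          ∑ x ∈ Finset.range (j + 1), ((ddx 𝕜 ^ x) φ).1 0 / (x.factorial : 𝕜) *
            ((ddx 𝕜 ^ p) (e x)).1 0 := by
        simp
      rw [h2, h3, Finset.sum_eq_single p]
      · rw [ddx_pow_germ_pow (he p), if_pos rfl, div_mul_cancel₀, sub_self]
        exact_mod_cast p.factorial_ne_zero
      · intro k _ hk
        rw [ddx_pow_germ_pow (he k), if_neg hk.symm, mul_zero]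
      · intro h
        exact absurd (Finset.mem_range.2 hp) h)
    rw [map_sub, sub_eq_zero, map_sum] at h1
    simpa using h1
  by_cases hij : i ≤ j
  · refine ⟨L (e (j - i)) / ((j - i).factorial : 𝕜), fun φ => ?_⟩
    rw [if_pos hij, htaylor, Finset.sum_eq_single (j - i)]
    · ring
    · intro p _ hp
      rw [hLe p (by omega), mul_zero]
    · intro h
      exact absurd (Finset.mem_range.2 (by omega)) h
  · refine ⟨0, fun φ => ?_⟩
    rw [if_neg hij, htaylor]
    exact Finset.sum_eq_zero fun p _ => by rw [hLe p (by omega), mul_zero]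

end FiniteJets

/-! ### Local symmetries have constant coefficients. -/

section LocalOperators

variable {𝕜 : Type*} [RCLike 𝕜]

/-- The operator `a ↦ (∑ j, C i j • a_j^{(j - i)})_i` with constant coefficients. -/
def opV (C : Matrix (Fin 5) (Fin 5) 𝕜) : Module.End 𝕜 (Fin 5 → SmoothFun 𝕜) :=
  LinearMap.pi fun i => ∑ j : Fin 5,
    C i j • (ddx 𝕜 ^ ((j : ℕ) - i)).comp (LinearMap.proj j)

lemma opV_apply (C : Matrix (Fin 5) (Fin 5) 𝕜) (a : Fin 5 → SmoothFun 𝕜) (i : Fin 5) :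
    opV C a i = ∑ j : Fin 5, C i j • (ddx 𝕜 ^ ((j : ℕ) - i)) (a j) := by
  simp [opV]

lemma opV_apply_apply (C : Matrix (Fin 5) (Fin 5) 𝕜) (a : Fin 5 → SmoothFun 𝕜) (i : Fin 5)
    (x : ℝ) : (opV C a i).1 x = ∑ j : Fin 5, C i j * ((ddx 𝕜 ^ ((j : ℕ) - i)) (a j)).1 x := by
  rw [opV_apply]
  simp

/-- Upper triangular matrices. -/
def IsUpper (C : Matrix (Fin 5) (Fin 5) 𝕜) : Prop := ∀ i j, j < i → C i j = 0

lemma IsUpper.mul {C C' : Matrix (Fin 5) (Fin 5) 𝕜} (h : IsUpper C) (h' : IsUpper C') :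
    IsUpper (C * C') := by
  intro i j hij
  rw [Matrix.mul_apply]
  refine Finset.sum_eq_zero fun k _ => ?_
  rcases lt_or_ge k i with hk | hk
  · rw [h i k hk, zero_mul]
  · rw [h' k j (hij.trans_le hk), mul_zero]

/-- The orders of differentiation add up, `(j - k) + (k - i) = j - i`, as long as `i ≤ k ≤ j`.
Triangularity removes the terms where natural subtraction would truncate. -/
lemma opV_mul {C C' : Matrix (Fin 5) (Fin 5) 𝕜} (h : IsUpper C) (h' : IsUpper C') :
    opV (C * C') = opV C * opV C' := by
  refine LinearMap.ext fun a => funext fun i => ?_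
  rw [Module.End.mul_apply, opV_apply, opV_apply]
  simp only [opV_apply, map_sum, map_smul, Finset.smul_sum, smul_smul, Matrix.mul_apply,
    Finset.sum_smul]
  rw [Finset.sum_comm]
  refine Finset.sum_congr rfl fun k _ => Finset.sum_congr rfl fun j _ => ?_
  rcases lt_or_ge k i with hk | hk
  · rw [h i k hk, zero_mul, zero_smul, zero_smul]
  rcases lt_or_ge j k with hj | hj
  · rw [h' k j hj, mul_zero, zero_smul, zero_smul]
  · have h1 : (j : ℕ) - i = (k - i) + (j - k) := by
      have := Fin.le_def.1 hk
      have := Fin.le_def.1 hj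
      omega
    rw [h1, pow_add, Module.End.mul_apply]

lemma opV_one : opV (1 : Matrix (Fin 5) (Fin 5) 𝕜) = 1 := by
  refine LinearMap.ext fun a => funext fun i => ?_
  rw [opV_apply, Finset.sum_eq_single i]
  · simp
  · intro j _ hj
    rw [Matrix.one_apply_ne hj.symm, zero_smul]
  · simp

lemma opV_add (C C' : Matrix (Fin 5) (Fin 5) 𝕜) : opV (C + C') = opV C + opV C' := by
  refine LinearMap.ext fun a => funext fun i => ?_
  rw [LinearMap.add_apply, Pi.add_apply, opV_apply, opV_apply, opV_apply,
    ← Finset.sum_add_distrib]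
  simp only [Matrix.add_apply, add_smul]

lemma opV_smul (c : 𝕜) (C : Matrix (Fin 5) (Fin 5) 𝕜) : opV (c • C) = c • opV C := by
  refine LinearMap.ext fun a => funext fun i => ?_
  rw [LinearMap.smul_apply, Pi.smul_apply, opV_apply, opV_apply, Finset.smul_sum]
  simp only [Matrix.smul_apply, smul_eq_mul, mul_smul]

lemma eq_zero_of_opV_eq_zero {C : Matrix (Fin 5) (Fin 5) 𝕜} (h : IsUpper C)
    (h0 : ∀ a, opV C a = 0) :
    C = 0 := by
  ext i j
  rcases lt_or_ge j i with hij | hij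
  · exact h i j hij
  obtain ⟨φ, hφ⟩ := exists_germ_pow (𝕜 := 𝕜) ((j : ℕ) - i) 0
  have h1 : (opV C (Pi.single j φ) i).1 0 = 0 := by rw [h0]; rfl
  rw [opV_apply_apply, Finset.sum_eq_single j, Pi.single_eq_same, ddx_pow_germ_pow hφ,
    if_pos rfl] at h1
  · exact (mul_eq_zero.1 h1).resolve_right (by exact_mod_cast Nat.factorial_ne_zero _)
  · intro k _ hk
    rw [Pi.single_eq_of_ne hk, map_zero]
    exact mul_zero _
  · simp

lemma opV_injOn {C C' : Matrix (Fin 5) (Fin 5) 𝕜} (h : IsUpper C) (h' : IsUpper C')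
    (he : opV C = opV C') : C = C' := by
  rw [← sub_eq_zero]
  refine eq_zero_of_opV_eq_zero (fun i j hij => ?_) ?_
  · rw [Matrix.sub_apply, h i j hij, h' i j hij, sub_zero]
  · intro a
    rw [← add_eq_right (b := opV C' a), ← LinearMap.add_apply, ← opV_add, sub_add_cancel, he]

lemma exists_contraction : ∃ (f : CircleDiffeo) (q : ℝ), 0 < q ∧ q < 1 ∧
    f.toFun =ᶠ[𝓝 0] fun x => q * x + 0 := by
  obtain ⟨ε₀, hε₀, h⟩ := exists_local_diffeo 1 one_pos
  have h1 : 0 < min ε₀ (1 / 2) := by positivity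
  obtain ⟨f, hf, -⟩ := h (-min ε₀ (1 / 2)) (by
    rw [abs_neg, abs_of_pos h1]
    exact min_le_left _ _)
  refine ⟨f, 1 - min ε₀ (1 / 2), ?_, by linarith, ?_⟩
  · have := min_le_right ε₀ (1 / 2)
    linarith
  · filter_upwards [hf] with x hx
    rw [hx]
    ring

lemma jacPow_of_affine {f : CircleDiffeo} {q : ℝ} (hf : f.toFun =ᶠ[𝓝 0] fun x => q * x + 0)
    (w : 𝕜) (m : ℕ) :
    ∀ᶠ x in 𝓝 0, (jacPow f (w - m)).1 x = (jacPow f w).1 0 * ((q ^ m : ℝ) : 𝕜)⁻¹ := by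
  have h1 : deriv f.toFun =ᶠ[𝓝 0] fun _ => q := by
    refine hf.deriv.trans (Eventually.of_forall fun y => ?_)
    simp
  filter_upwards [h1] with x hx
  rw [sub_eq_add_neg, jacPow_add]
  change (jacPow f w).1 x * (jacPow f (-(m : 𝕜))).1 x = _
  rw [jacPow_neg_natCast_apply, hx, jacPow_apply, jacPow_apply, hx, h1.eq_of_nhds,
    RCLike.ofReal_inv]

/-- Near `0` the diffeomorphism is `q x`, and the order `k` coefficient is multiplied by `E q^(-k)`
for a common factor `E`. By locality only these germs matter, and `E` cancels. -/
lemma homogeneous_of_mem {lam mu : 𝕜} {T : Module.End 𝕜 (Fin 5 → SmoothFun 𝕜)}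
    (hT : T ∈ CoeffSymmetryAlgebra lam mu) (hloc : IsLocalAtZero T) {f : CircleDiffeo} {q : ℝ}
    (hq : 0 < q) (hf : f.toFun =ᶠ[𝓝 0] fun x => q * x + 0) (i j : Fin 5) {φ ψ : SmoothFun 𝕜}
    (h : ψ.1 =ᶠ[𝓝 0] fun x => φ.1 (q * x)) :
    ((q ^ (i : ℕ) : ℝ) : 𝕜) * (T (Pi.single j ψ) i).1 0 =
      ((q ^ (j : ℕ) : ℝ) : 𝕜) * (T (Pi.single j φ) i).1 0 := by
  let E := (jacPow f (mu - lam)).1 0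
  have hE : E ≠ 0 := jacPow_ne_zero f _ 0
  have h0 : f.toFun 0 = 0 := by rw [hf.eq_of_nhds]; simp
  have h1 : VanishesNearZero (coeffAct lam mu f (Pi.single j φ) -
      (E * ((q ^ (j : ℕ) : ℝ) : 𝕜)⁻¹) • (Pi.single j ψ : Fin 5 → SmoothFun 𝕜)) := by
    intro k
    filter_upwards [hf.eventuallyEq_nhds, h, jacPow_of_affine hf (mu - lam) k, hf]
      with x hx hx' hx'' hx3
    change (coeffAct lam mu f (Pi.single j φ) k).1 x -
      _ * ((Pi.single j ψ : Fin 5 → SmoothFun 𝕜) k).1 x = 0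
    rw [coeffAct_apply_of_affine lam mu _ k hx, hx'', hx3]
    rcases eq_or_ne k j with rfl | hk
    · rw [Pi.single_eq_same, Pi.single_eq_same, hx', add_zero, sub_self]
    · rw [Pi.single_eq_of_ne hk, Pi.single_eq_of_ne hk]
      change _ * (0 : 𝕜) - _ * (0 : 𝕜) = 0
      ring
  have h2 := hloc _ h1 i
  rw [map_sub, map_smul, mem_coeffSymmetryAlgebra.1 hT] at h2
  change (coeffAct lam mu f _ i).1 0 - _ * _ = 0 at h2
  rw [coeffAct_apply_of_affine lam mu _ i hf, (jacPow_of_affine hf (mu - lam) i).self_of_nhds,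
    h0] at h2
  have hi : ((q ^ (i : ℕ) : ℝ) : 𝕜) ≠ 0 := RCLike.ofReal_ne_zero.2 (by positivity)
  have hj : ((q ^ (j : ℕ) : ℝ) : 𝕜) ≠ 0 := RCLike.ofReal_ne_zero.2 (by positivity)
  change E * _ * _ - _ = 0 at h2
  field_simp at h2
  rw [mul_zero, mul_eq_zero] at h2
  linear_combination -h2.resolve_left hE

/-- Each component `φ ↦ (T (Pi.single j φ) i)(0)` is a local homogeneous functional, hence a
multiple of `φ^(j - i)(0)`, and zero for `j < i`. -/
lemma exists_opV_eval_zero {lam mu : 𝕜} {T : Module.End 𝕜 (Fin 5 → SmoothFun 𝕜)}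
    (hT : T ∈ CoeffSymmetryAlgebra lam mu) (hloc : IsLocalAtZero T) :
    ∃ C, IsUpper C ∧ ∀ a i, (T a i).1 0 = (opV C a i).1 0 := by
  obtain ⟨f, q, hq0, hq1, hf⟩ := exists_contraction
  have key : ∀ i j : Fin 5, ∃ c : 𝕜, ∀ φ, (T (Pi.single j φ) i).1 0 =
      if (i : ℕ) ≤ j then c * ((ddx 𝕜 ^ ((j : ℕ) - i)) φ).1 0 else 0 := fun i j =>
    exists_eq_deriv_of_homogeneous
      (L := ((evalZero i).comp T).comp (LinearMap.single 𝕜 (fun _ : Fin 5 => SmoothFun 𝕜) j))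
      (fun φ hφ => hloc _ (vanishesNearZero_single hφ) i) hq0 hq1 i j
      fun φ ψ h => homogeneous_of_mem hT hloc hq0 hf i j h
  choose c hc using key
  refine ⟨Matrix.of fun i j => if i ≤ j then c i j else 0, fun i j hij => if_neg (not_le.2 hij),
    fun a i => ?_⟩
  have h1 : (T a i).1 0 = ∑ j, (T (Pi.single j (a j)) i).1 0 := by
    conv_lhs => rw [← Finset.univ_sum_single a, map_sum, Finset.sum_apply]
    simp
  rw [h1, opV_apply_apply]
  refine Finset.sum_congr rfl fun j _ => ?_
  rw [hc, Matrix.of_apply]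
  by_cases hij : i ≤ j
  · rw [if_pos (Fin.le_def.1 hij), if_pos hij]
  · rw [if_neg (fun h => hij (Fin.le_def.2 h)), if_neg hij, zero_mul]

lemma exists_translation (t : ℝ) : ∃ f : CircleDiffeo, ∀ x, f.toFun x = 1 * x + t := by
  refine ⟨CircleDiffeo.ofPerturbation (fun _ => t) contDiff_const
    (show Function.Periodic _ _ from fun _ => rfl) (by simp), fun x => ?_⟩
  rw [one_mul]
  rfl

/-- Local symmetries are differential operators with constant coefficients. -/
lemma exists_eq_opV {lam mu : 𝕜} {T : Module.End 𝕜 (Fin 5 → SmoothFun 𝕜)}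
    (hT : T ∈ CoeffSymmetryAlgebra lam mu) (hloc : IsLocalAtZero T) :
    ∃ C, IsUpper C ∧ T = opV C := by
  obtain ⟨C, hC, h⟩ := exists_opV_eval_zero hT hloc
  refine ⟨C, hC, LinearMap.ext fun a => funext fun i => Subtype.ext (funext fun t => ?_)⟩
  obtain ⟨f, hf⟩ := exists_translation t
  have hf' : f.toFun = fun x => 1 * x + t := funext hf
  have h1 : ∀ (b : Fin 5 → SmoothFun 𝕜) (k : Fin 5) (x : ℝ),
      (coeffAct lam mu f b k).1 x = (b k).1 (x + t) := by
    intro b k x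
    rw [coeffAct_apply_of_affine lam mu b k (x := x) (c := 1) (d := t)
      (Eventually.of_forall hf), jacPow_apply_of_deriv_eq_one (by rw [hf']; simp), one_mul, hf,
      one_mul]
  -- Invariance under the translation by `t` moves the formula at `0` to the point `t`, with the
  -- same constants.
  have h2 := h (coeffAct lam mu f a) i
  rw [mem_coeffSymmetryAlgebra.1 hT, h1, zero_add, opV_apply_apply] at h2
  rw [h2, opV_apply_apply]
  refine Finset.sum_congr rfl fun j _ => ?_
  have h3 : (coeffAct lam mu f a j).1 = fun x => (a j).1 (x + t) := funext (h1 a j)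
  rw [ddx_pow_apply, ddx_pow_apply, h3, iteratedDeriv_comp_add_const]
  simp only [zero_add]

end LocalOperators

set_option linter.unusedSimpArgs false

/-! ### The equations imposed by germs of diffeomorphisms. -/

section JetRelations

variable {𝕜 : Type*} [RCLike 𝕜]

lemma val_add (a b : SmoothFun 𝕜) (x : ℝ) : (a + b).1 x = a.1 x + b.1 x := rfl

lemma val_sub (a b : SmoothFun 𝕜) (x : ℝ) : (a - b).1 x = a.1 x - b.1 x := rfl

lemma val_mul (a b : SmoothFun 𝕜) (x : ℝ) : (a * b).1 x = a.1 x * b.1 x := rfl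

lemma val_smul (c : 𝕜) (a : SmoothFun 𝕜) (x : ℝ) : (c • a).1 x = c * a.1 x := rfl

lemma val_one (x : ℝ) : (1 : SmoothFun 𝕜).1 x = 1 := rfl

lemma val_zero (x : ℝ) : (0 : SmoothFun 𝕜).1 x = 0 := rfl

lemma mcoef_succ_zero (w : 𝕜) (p : SmoothFun 𝕜) (n : ℕ) :
    mcoef w p (n + 1) 0 = ddx 𝕜 (mcoef w p n 0) - (w + n) • (p * mcoef w p n 0) := by
  rw [mcoef]

lemma mcoef_succ_succ (w : 𝕜) (p : SmoothFun 𝕜) (n i : ℕ) :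
    mcoef w p (n + 1) (i + 1) = mcoef w p n i + ddx 𝕜 (mcoef w p n (i + 1)) -
      (w + n) • (p * mcoef w p n (i + 1)) := by
  rw [mcoef]

section Explicit

variable (w : 𝕜) (p b : SmoothFun 𝕜)

lemma mcoef_1_0 : mcoef w p 1 0 =
    (-w) • p := by
  rw [mcoef_succ_zero w p 0]
  ext x
  simp only [mcoef_self, zero_add, one_add_one_eq_two, two_add_one_eq_three, ddx_mul, ddx_one,
    map_add, map_smul, Nat.cast_zero, Nat.cast_one, Nat.cast_ofNat, val_add, val_mul, val_sub,
    val_smul, val_one, val_zero]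
  ring

lemma mcoef_2_0 : mcoef w p 2 0 =
    (w + w ^ 2) • (p * p) + (-w) • (ddx 𝕜 p) := by
  rw [mcoef_succ_zero w p 1]
  ext x
  simp only [mcoef_1_0, mcoef_self, zero_add, one_add_one_eq_two, two_add_one_eq_three,
    ddx_mul, ddx_one, map_add, map_smul, Nat.cast_zero, Nat.cast_one, Nat.cast_ofNat, val_add,
    val_mul, val_sub, val_smul, val_one, val_zero]
  ring

lemma mcoef_2_1 : mcoef w p 2 1 =
    (-1 - 2 * w) • p := by
  rw [mcoef_succ_succ w p 1 0]
  ext x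
  simp only [mcoef_1_0, mcoef_self, zero_add, one_add_one_eq_two, two_add_one_eq_three,
    ddx_mul, ddx_one, map_add, map_smul, Nat.cast_zero, Nat.cast_one, Nat.cast_ofNat, val_add,
    val_mul, val_sub, val_smul, val_one, val_zero]
  ring

lemma mcoef_3_0 : mcoef w p 3 0 =
    (-2 * w - 3 * w ^ 2 - w ^ 3) • (p * p * p) + (4 * w + 3 * w ^ 2) • (p * ddx 𝕜 p) + (-w) •
    (ddx 𝕜 (ddx 𝕜 p)) := by
  rw [mcoef_succ_zero w p 2]
  ext x
  simp only [mcoef_2_0, mcoef_self, zero_add, one_add_one_eq_two, two_add_one_eq_three,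
    ddx_mul, ddx_one, map_add, map_smul, Nat.cast_zero, Nat.cast_one, Nat.cast_ofNat, val_add,
    val_mul, val_sub, val_smul, val_one, val_zero]
  ring

lemma mcoef_3_1 : mcoef w p 3 1 =
    (2 + 6 * w + 3 * w ^ 2) • (p * p) + (-1 - 3 * w) • (ddx 𝕜 p) := by
  rw [mcoef_succ_succ w p 2 0]
  ext x
  simp only [mcoef_2_0, mcoef_2_1, mcoef_self, zero_add, one_add_one_eq_two,
    two_add_one_eq_three, ddx_mul, ddx_one, map_add, map_smul, Nat.cast_zero, Nat.cast_one,
    Nat.cast_ofNat, val_add, val_mul, val_sub, val_smul, val_one, val_zero]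
  ring

lemma mcoef_3_2 : mcoef w p 3 2 =
    (-3 - 3 * w) • p := by
  rw [mcoef_succ_succ w p 2 1]
  ext x
  simp only [mcoef_2_1, mcoef_self, zero_add, one_add_one_eq_two, two_add_one_eq_three,
    ddx_mul, ddx_one, map_add, map_smul, Nat.cast_zero, Nat.cast_one, Nat.cast_ofNat, val_add,
    val_mul, val_sub, val_smul, val_one, val_zero]
  ring

lemma mcoef_4_0 : mcoef w p 4 0 =
    (6 * w + 11 * w ^ 2 + 6 * w ^ 3 + w ^ 4) • (p * p * p * p) + (-18 * w - 22 * w ^ 2 - 6 * w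
    ^ 3) • (p * p * ddx 𝕜 p) + (7 * w + 4 * w ^ 2) • (p * ddx 𝕜 (ddx 𝕜 p)) + (4 * w + 3 * w ^
    2) • (ddx 𝕜 p * ddx 𝕜 p) + (-w) • (ddx 𝕜 (ddx 𝕜 (ddx 𝕜 p))) := by
  rw [mcoef_succ_zero w p 3]
  ext x
  simp only [mcoef_3_0, mcoef_self, zero_add, one_add_one_eq_two, two_add_one_eq_three,
    ddx_mul, ddx_one, map_add, map_smul, Nat.cast_zero, Nat.cast_one, Nat.cast_ofNat, val_add,
    val_mul, val_sub, val_smul, val_one, val_zero]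
  ring

lemma mcoef_4_1 : mcoef w p 4 1 =
    (-6 - 22 * w - 18 * w ^ 2 - 4 * w ^ 3) • (p * p * p) + (7 + 26 * w + 12 * w ^ 2) • (p * ddx
    𝕜 p) + (-1 - 4 * w) • (ddx 𝕜 (ddx 𝕜 p)) := by
  rw [mcoef_succ_succ w p 3 0]
  ext x
  simp only [mcoef_3_0, mcoef_3_1, mcoef_self, zero_add, one_add_one_eq_two,
    two_add_one_eq_three, ddx_mul, ddx_one, map_add, map_smul, Nat.cast_zero, Nat.cast_one,
    Nat.cast_ofNat, val_add, val_mul, val_sub, val_smul, val_one, val_zero]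
  ring

lemma mcoef_4_2 : mcoef w p 4 2 =
    (11 + 18 * w + 6 * w ^ 2) • (p * p) + (-4 - 6 * w) • (ddx 𝕜 p) := by
  rw [mcoef_succ_succ w p 3 1]
  ext x
  simp only [mcoef_3_1, mcoef_3_2, mcoef_self, zero_add, one_add_one_eq_two,
    two_add_one_eq_three, ddx_mul, ddx_one, map_add, map_smul, Nat.cast_zero, Nat.cast_one,
    Nat.cast_ofNat, val_add, val_mul, val_sub, val_smul, val_one, val_zero]
  ring

lemma mcoef_4_3 : mcoef w p 4 3 =
    (-6 - 4 * w) • p := by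
  rw [mcoef_succ_succ w p 3 2]
  ext x
  simp only [mcoef_3_2, mcoef_self, zero_add, one_add_one_eq_two, two_add_one_eq_three,
    ddx_mul, ddx_one, map_add, map_smul, Nat.cast_zero, Nat.cast_one, Nat.cast_ofNat, val_add,
    val_mul, val_sub, val_smul, val_one, val_zero]
  ring

lemma twistedPow_0_apply : twistedPow w p 0 b =
    b := by
  rw [twistedPow_apply w p b (Nat.lt_succ_self 0)]
  simp only [Finset.sum_range_succ, Finset.sum_range_zero, mcoef_self, pow_succ', pow_zero,
    Module.End.mul_apply, Module.End.one_apply, one_mul, zero_add]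

lemma twistedPow_1_apply : twistedPow w p 1 b =
    mcoef w p 1 0 * b + ddx 𝕜 b := by
  rw [twistedPow_apply w p b (Nat.lt_succ_self 1)]
  simp only [Finset.sum_range_succ, Finset.sum_range_zero, mcoef_self, pow_succ', pow_zero,
    Module.End.mul_apply, Module.End.one_apply, one_mul, zero_add]

lemma twistedPow_2_apply : twistedPow w p 2 b =
    mcoef w p 2 0 * b + mcoef w p 2 1 * ddx 𝕜 b + ddx 𝕜 (ddx 𝕜 b) := by
  rw [twistedPow_apply w p b (Nat.lt_succ_self 2)]
  simp only [Finset.sum_range_succ, Finset.sum_range_zero, mcoef_self, pow_succ', pow_zero,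
    Module.End.mul_apply, Module.End.one_apply, one_mul, zero_add]

lemma twistedPow_3_apply : twistedPow w p 3 b =
    mcoef w p 3 0 * b + mcoef w p 3 1 * ddx 𝕜 b + mcoef w p 3 2 * ddx 𝕜 (ddx 𝕜 b) + ddx 𝕜 (ddx
    𝕜 (ddx 𝕜 b)) := by
  rw [twistedPow_apply w p b (Nat.lt_succ_self 3)]
  simp only [Finset.sum_range_succ, Finset.sum_range_zero, mcoef_self, pow_succ', pow_zero,
    Module.End.mul_apply, Module.End.one_apply, one_mul, zero_add]

lemma twistedPow_4_apply : twistedPow w p 4 b =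
    mcoef w p 4 0 * b + mcoef w p 4 1 * ddx 𝕜 b + mcoef w p 4 2 * ddx 𝕜 (ddx 𝕜 b) + mcoef w p 4
    3 * ddx 𝕜 (ddx 𝕜 (ddx 𝕜 b)) + ddx 𝕜 (ddx 𝕜 (ddx 𝕜 (ddx 𝕜 b))) := by
  rw [twistedPow_apply w p b (Nat.lt_succ_self 4)]
  simp only [Finset.sum_range_succ, Finset.sum_range_zero, mcoef_self, pow_succ', pow_zero,
    Module.End.mul_apply, Module.End.one_apply, one_mul, zero_add]

end Explicit

lemma val_three : ((3 : Fin 5) : ℕ) = 3 := rfl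

lemma val_four : ((4 : Fin 5) : ℕ) = 4 := rfl

/-- The equation imposed on an intertwining operator by the germs `x + ε x²`. -/
def relOne (lam lam' del : 𝕜) (C : Matrix (Fin 5) (Fin 5) 𝕜) (i j : Fin 5) : 𝕜 :=
  ((j : ℕ) * lam + (j : ℕ) * ((j : ℕ) - 1) / 2) * C i (j - 1) -
    (((i : ℕ) + 1) * lam' + ((i : ℕ) + 1) * (i : ℕ) / 2) * C (i + 1) j -
    (((j : ℕ) - (i : ℕ)) * (del - (j : ℕ)) +
      ((j : ℕ) - (i : ℕ)) * ((j : ℕ) - (i : ℕ) - 1) / 2) * C i j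

/-- The equation imposed on an intertwining operator by the germs `x + ε x³`. -/
def relTwo (lam lam' del : 𝕜) (C : Matrix (Fin 5) (Fin 5) 𝕜) (i j : Fin 5) : 𝕜 :=
  ((j : ℕ) * lam + (j : ℕ) * ((j : ℕ) - 1) / 2) * ((j : ℕ) - (i : ℕ) - 1) * C i (j - 1) +
    ((j : ℕ) * ((j : ℕ) - 1) / 2 * lam + (j : ℕ) * ((j : ℕ) - 1) * ((j : ℕ) - 2) / 6) *
      C i (j - 2) -
    (((i : ℕ) + 2) * ((i : ℕ) + 1) / 2 * lam' + ((i : ℕ) + 2) * ((i : ℕ) + 1) * (i : ℕ) / 6) *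
      C (i + 2) j -
    (((j : ℕ) - (i : ℕ)) * ((j : ℕ) - (i : ℕ) - 1) / 2 * (del - (j : ℕ)) +
      ((j : ℕ) - (i : ℕ)) * ((j : ℕ) - (i : ℕ) - 1) * ((j : ℕ) - (i : ℕ) - 2) / 6) * C i j

/-- The `(i, j)` component of the failure of `opV C` to intertwine the actions of a diffeomorphism
`f` with `p = f''/f'`, on a pulled back coefficient `b`. -/
def jetDefect (lam lam' del : 𝕜) (C : Matrix (Fin 5) (Fin 5) 𝕜) (i j : Fin 5)
    (p b : SmoothFun 𝕜) : SmoothFun 𝕜 :=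
  ∑ k : Fin 5, (C i k • (ddx 𝕜 ^ ((k : ℕ) - i)) (mcoef lam p j k * b) -
    mcoef lam' p k i * (C k j • twistedPow (del - (j : ℕ)) p ((j : ℕ) - k) b))

/-- Everything is triangular, so the only possible contribution is `k = i = j`, where both terms
equal `C i i • b`. -/
lemma jetDefect_of_le {lam lam' del : 𝕜} {C : Matrix (Fin 5) (Fin 5) 𝕜} (hC : IsUpper C)
    {i j : Fin 5} (hij : j ≤ i) (p b : SmoothFun 𝕜) : jetDefect lam lam' del C i j p b = 0 := by
  refine Finset.sum_eq_zero fun k _ => ?_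
  rcases lt_trichotomy k i with hk | rfl | hk
  · rw [hC i k hk, zero_smul, mcoef_eq_zero _ _ (by exact_mod_cast hk), zero_mul, sub_zero]
  · rcases eq_or_lt_of_le hij with rfl | hij
    · simp [mcoef_self, twistedPow]
    · rw [hC k j hij, mcoef_eq_zero _ _ (by exact_mod_cast hij)]
      simp
  · rw [hC k j (hij.trans_lt hk), mcoef_eq_zero _ _ (by exact_mod_cast hij.trans_lt hk)]
    simp

section Expansions

variable {lam lam' del : 𝕜} {C : Matrix (Fin 5) (Fin 5) 𝕜}

/-- These expansions make the equations explicit polynomials in the weights. The index shifts are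
taken in `Fin 5`, but never wrap around for `i < j` in `relOne` and `i + 1 < j` in `relTwo`. -/
lemma relOne_0_1 : relOne lam lam' del C 0 1 =
    (lam) * C 0 0 + (1 - del) * C 0 1 + (-lam') * C 1 1 := by
  simp only [relOne, val_three, val_four, Fin.val_zero, Fin.val_one, Fin.val_two,
    Nat.cast_zero, Nat.cast_one, Nat.cast_ofNat, show (1 : Fin 5) - 1 = 0 from rfl, show (0 : Fin
    5) + 1 = 1 from rfl]
  ring

lemma relOne_0_2 : relOne lam lam' del C 0 2 =
    (1 + 2 * lam) * C 0 1 + (3 - 2 * del) * C 0 2 + (-lam') * C 1 2 := by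
  simp only [relOne, val_three, val_four, Fin.val_zero, Fin.val_one, Fin.val_two,
    Nat.cast_zero, Nat.cast_one, Nat.cast_ofNat, show (2 : Fin 5) - 1 = 1 from rfl, show (0 : Fin
    5) + 1 = 1 from rfl]
  ring

lemma relOne_0_3 : relOne lam lam' del C 0 3 =
    (3 + 3 * lam) * C 0 2 + (6 - 3 * del) * C 0 3 + (-lam') * C 1 3 := by
  simp only [relOne, val_three, val_four, Fin.val_zero, Fin.val_one, Fin.val_two,
    Nat.cast_zero, Nat.cast_one, Nat.cast_ofNat, show (3 : Fin 5) - 1 = 2 from rfl, show (0 : Fin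
    5) + 1 = 1 from rfl]
  ring

lemma relOne_0_4 : relOne lam lam' del C 0 4 =
    (6 + 4 * lam) * C 0 3 + (10 - 4 * del) * C 0 4 + (-lam') * C 1 4 := by
  simp only [relOne, val_three, val_four, Fin.val_zero, Fin.val_one, Fin.val_two,
    Nat.cast_zero, Nat.cast_one, Nat.cast_ofNat, show (4 : Fin 5) - 1 = 3 from rfl, show (0 : Fin
    5) + 1 = 1 from rfl]
  ring

lemma relOne_1_2 : relOne lam lam' del C 1 2 =
    (1 + 2 * lam) * C 1 1 + (2 - del) * C 1 2 + (-1 - 2 * lam') * C 2 2 := by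
  simp only [relOne, val_three, val_four, Fin.val_zero, Fin.val_one, Fin.val_two,
    Nat.cast_zero, Nat.cast_one, Nat.cast_ofNat, show (2 : Fin 5) - 1 = 1 from rfl, show (1 : Fin
    5) + 1 = 2 from rfl]
  ring

lemma relOne_1_3 : relOne lam lam' del C 1 3 =
    (3 + 3 * lam) * C 1 2 + (5 - 2 * del) * C 1 3 + (-1 - 2 * lam') * C 2 3 := by
  simp only [relOne, val_three, val_four, Fin.val_zero, Fin.val_one, Fin.val_two,
    Nat.cast_zero, Nat.cast_one, Nat.cast_ofNat, show (3 : Fin 5) - 1 = 2 from rfl, show (1 : Fin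
    5) + 1 = 2 from rfl]
  ring

lemma relOne_1_4 : relOne lam lam' del C 1 4 =
    (6 + 4 * lam) * C 1 3 + (9 - 3 * del) * C 1 4 + (-1 - 2 * lam') * C 2 4 := by
  simp only [relOne, val_three, val_four, Fin.val_zero, Fin.val_one, Fin.val_two,
    Nat.cast_zero, Nat.cast_one, Nat.cast_ofNat, show (4 : Fin 5) - 1 = 3 from rfl, show (1 : Fin
    5) + 1 = 2 from rfl]
  ring

lemma relOne_2_3 : relOne lam lam' del C 2 3 =
    (3 + 3 * lam) * C 2 2 + (3 - del) * C 2 3 + (-3 - 3 * lam') * C 3 3 := by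
  simp only [relOne, val_three, val_four, Fin.val_zero, Fin.val_one, Fin.val_two,
    Nat.cast_zero, Nat.cast_one, Nat.cast_ofNat, show (3 : Fin 5) - 1 = 2 from rfl, show (2 : Fin
    5) + 1 = 3 from rfl]
  ring

lemma relOne_2_4 : relOne lam lam' del C 2 4 =
    (6 + 4 * lam) * C 2 3 + (7 - 2 * del) * C 2 4 + (-3 - 3 * lam') * C 3 4 := by
  simp only [relOne, val_three, val_four, Fin.val_zero, Fin.val_one, Fin.val_two,
    Nat.cast_zero, Nat.cast_one, Nat.cast_ofNat, show (4 : Fin 5) - 1 = 3 from rfl, show (2 : Fin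
    5) + 1 = 3 from rfl]
  ring

lemma relOne_3_4 : relOne lam lam' del C 3 4 =
    (6 + 4 * lam) * C 3 3 + (4 - del) * C 3 4 + (-6 - 4 * lam') * C 4 4 := by
  simp only [relOne, val_three, val_four, Fin.val_zero, Fin.val_one, Fin.val_two,
    Nat.cast_zero, Nat.cast_one, Nat.cast_ofNat, show (4 : Fin 5) - 1 = 3 from rfl, show (3 : Fin
    5) + 1 = 4 from rfl]
  ring

lemma relTwo_0_2 : relTwo lam lam' del C 0 2 =
    (lam) * C 0 0 + (1 + 2 * lam) * C 0 1 + (2 - del) * C 0 2 + (-lam') * C 2 2 := by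
  simp only [relTwo, val_three, val_four, Fin.val_zero, Fin.val_one, Fin.val_two,
    Nat.cast_zero, Nat.cast_one, Nat.cast_ofNat, show (2 : Fin 5) - 1 = 1 from rfl, show (0 : Fin
    5) + 1 = 1 from rfl, show (2 : Fin 5) - 2 = 0 from rfl, show (0 : Fin 5) + 2 = 2 from rfl]
  ring

lemma relTwo_0_3 : relTwo lam lam' del C 0 3 =
    (1 + 3 * lam) * C 0 1 + (6 + 6 * lam) * C 0 2 + (8 - 3 * del) * C 0 3 + (-lam') * C 2 3 := by
  simp only [relTwo, val_three, val_four, Fin.val_zero, Fin.val_one, Fin.val_two,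
    Nat.cast_zero, Nat.cast_one, Nat.cast_ofNat, show (3 : Fin 5) - 1 = 2 from rfl, show (0 : Fin
    5) + 1 = 1 from rfl, show (3 : Fin 5) - 2 = 1 from rfl, show (0 : Fin 5) + 2 = 2 from rfl]
  ring

lemma relTwo_0_4 : relTwo lam lam' del C 0 4 =
    (4 + 6 * lam) * C 0 2 + (18 + 12 * lam) * C 0 3 + (20 - 6 * del) * C 0 4 + (-lam') * C 2 4 := by
  simp only [relTwo, val_three, val_four, Fin.val_zero, Fin.val_one, Fin.val_two,
    Nat.cast_zero, Nat.cast_one, Nat.cast_ofNat, show (4 : Fin 5) - 1 = 3 from rfl, show (0 : Fin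
    5) + 1 = 1 from rfl, show (4 : Fin 5) - 2 = 2 from rfl, show (0 : Fin 5) + 2 = 2 from rfl]
  ring

lemma relTwo_1_3 : relTwo lam lam' del C 1 3 =
    (1 + 3 * lam) * C 1 1 + (3 + 3 * lam) * C 1 2 + (3 - del) * C 1 3 + (-1 - 3 * lam') * C 3 3 := by
  simp only [relTwo, val_three, val_four, Fin.val_zero, Fin.val_one, Fin.val_two,
    Nat.cast_zero, Nat.cast_one, Nat.cast_ofNat, show (3 : Fin 5) - 1 = 2 from rfl, show (1 : Fin
    5) + 1 = 2 from rfl, show (3 : Fin 5) - 2 = 1 from rfl, show (1 : Fin 5) + 2 = 3 from rfl]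
  ring

lemma relTwo_1_4 : relTwo lam lam' del C 1 4 =
    (4 + 6 * lam) * C 1 2 + (12 + 8 * lam) * C 1 3 + (11 - 3 * del) * C 1 4 + (-1 - 3 * lam') *
    C 3 4 := by
  simp only [relTwo, val_three, val_four, Fin.val_zero, Fin.val_one, Fin.val_two,
    Nat.cast_zero, Nat.cast_one, Nat.cast_ofNat, show (4 : Fin 5) - 1 = 3 from rfl, show (1 : Fin
    5) + 1 = 2 from rfl, show (4 : Fin 5) - 2 = 2 from rfl, show (1 : Fin 5) + 2 = 3 from rfl]
  ring

lemma relTwo_2_4 : relTwo lam lam' del C 2 4 =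
    (4 + 6 * lam) * C 2 2 + (6 + 4 * lam) * C 2 3 + (4 - del) * C 2 4 + (-4 - 6 * lam') * C 4 4 := by
  simp only [relTwo, val_three, val_four, Fin.val_zero, Fin.val_one, Fin.val_two,
    Nat.cast_zero, Nat.cast_one, Nat.cast_ofNat, show (4 : Fin 5) - 1 = 3 from rfl, show (2 : Fin
    5) + 1 = 3 from rfl, show (4 : Fin 5) - 2 = 2 from rfl, show (2 : Fin 5) + 2 = 4 from rfl]
  ring

variable (p b : SmoothFun 𝕜) {x : ℝ} {p₀ p₁ p₂ p₃ b₀ b₁ b₂ b₃ b₄ : 𝕜}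

/-- This and the following identities express the defect for an arbitrary jet of `p` and `b` through
the equations of the two special germs; the underlying reason is that `x² ∂` and `x³ ∂` generate the
formal vector fields vanishing to second order. The terms to remember are `-p₀ b_(j - i - 1)` in
front of `relOne i j` and `-p₁ b_(j - i - 2)` in front of `relTwo i j`. -/
lemma jetDefect_0_1 (hC : IsUpper C) (hp₀ : p.1 x = p₀) (hb₀ : b.1 x = b₀) (hb₁ : (ddx 𝕜 b).1 x =
    b₁) :
    (jetDefect lam lam' del C 0 1 p b).1 x =
      ((-1) * p₀ * b₀) * relOne lam lam' del C 0 1 := by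
  simp only [jetDefect, Fin.sum_univ_five, Fin.val_zero, Fin.val_one, Fin.val_two,
    val_three, val_four, hC 2 1 (by decide), hC 3 1 (by decide), hC 4 1 (by decide),
    mcoef_eq_zero lam p (show 1 < 2 by decide), mcoef_eq_zero lam p (show 1 < 3 by decide),
    mcoef_eq_zero lam p (show 1 < 4 by decide), twistedPow_0_apply, twistedPow_1_apply,
    mcoef_1_0, mcoef_self, Nat.sub_self, Nat.sub_zero, pow_succ', pow_zero, Module.End.mul_apply,
    Module.End.one_apply, ddx_mul, map_add, map_smul, map_zero, zero_smul, smul_zero, zero_mul,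
    mul_zero, one_mul, sub_zero, zero_add, add_zero, sub_self, val_add, val_mul, val_sub,
    val_smul, val_zero, Nat.cast_zero, Nat.cast_one, Nat.cast_ofNat, hp₀, hb₀, hb₁]
  rw [relOne_0_1]
  ring

lemma jetDefect_0_2 (hC : IsUpper C) (hp₀ : p.1 x = p₀) (hp₁ : (ddx 𝕜 p).1 x = p₁) (hb₀ : b.1 x =
    b₀) (hb₁ : (ddx 𝕜 b).1 x = b₁) (hb₂ : (ddx 𝕜 (ddx 𝕜 b)).1 x = b₂) :
    (jetDefect lam lam' del C 0 2 p b).1 x =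
      ((1 / 2 + lam) * p₀ ^ 2 * b₀) * relOne lam lam' del C 0 1 + ((-1) * p₀ * b₁ + (-1 + 1 / 2
      * del) * p₀ ^ 2 * b₀) * relOne lam lam' del C 0 2 + ((1 / 2 * lam') * p₀ ^ 2 * b₀) *
      relOne lam lam' del C 1 2 + ((-1) * p₁ * b₀ + (1 / 2) * p₀ ^ 2 * b₀) * relTwo lam lam'
      del C 0 2 := by
  simp only [jetDefect, Fin.sum_univ_five, Fin.val_zero, Fin.val_one, Fin.val_two,
    val_three, val_four, hC 3 2 (by decide), hC 4 2 (by decide), mcoef_eq_zero lam p (show 2 < 3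
    by decide), mcoef_eq_zero lam p (show 2 < 4 by decide), twistedPow_0_apply,
    twistedPow_1_apply, twistedPow_2_apply, mcoef_1_0, mcoef_2_0, mcoef_2_1, mcoef_self,
    Nat.sub_self, Nat.sub_zero, show 2 - 1 = 1 from rfl, pow_succ', pow_zero,
    Module.End.mul_apply, Module.End.one_apply, ddx_mul, map_add, map_smul, map_zero, zero_smul,
    smul_zero, zero_mul, mul_zero, one_mul, sub_zero, zero_add, add_zero, sub_self, val_add,
    val_mul, val_sub, val_smul, val_zero, Nat.cast_zero, Nat.cast_one, Nat.cast_ofNat, hp₀, hp₁,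
    hb₀, hb₁, hb₂]
  rw [relOne_0_1, relOne_0_2, relOne_1_2, relTwo_0_2]
  ring

lemma jetDefect_0_3 (hC : IsUpper C) (hp₀ : p.1 x = p₀) (hp₁ : (ddx 𝕜 p).1 x = p₁) (hp₂ : (ddx 𝕜
    (ddx 𝕜 p)).1 x = p₂) (hb₀ : b.1 x = b₀) (hb₁ : (ddx 𝕜 b).1 x = b₁) (hb₂ : (ddx 𝕜 (ddx 𝕜
    b)).1 x = b₂) (hb₃ : (ddx 𝕜 (ddx 𝕜 (ddx 𝕜 b))).1 x = b₃) :
    (jetDefect lam lam' del C 0 3 p b).1 x =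
      ((1 / 2 + 3 / 2 * lam) * p₂ * b₀ + (-1 / 2 - 3 / 2 * lam) * p₀ * p₁ * b₀ + (-1 / 2 - 3 /
      2 * lam - lam ^ 2) * p₀ ^ 3 * b₀) * relOne lam lam' del C 0 1 + ((3 / 2 + 3 / 2 * lam) *
      p₂ * b₀ + (-3 / 2 - 3 / 2 * lam) * p₀ * p₁ * b₀ + (3 / 2 + 3 / 2 * lam) * p₀ ^ 2 * b₁ +
      (2 - 1 / 2 * del + 2 * lam - 1 / 2 * lam * del) * p₀ ^ 3 * b₀) * relOne lam lam' del C 0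
      2 + ((3 / 2 - 1 / 2 * del) * p₂ * b₀ + (-1) * p₀ * b₂ + (-9 / 2 + 3 / 2 * del) * p₀ * p₁
      * b₀ + (-5 / 2 + del) * p₀ ^ 2 * b₁ + (-1 + 4 / 3 * del - 1 / 3 * del ^ 2) * p₀ ^ 3 * b₀)
      * relOne lam lam' del C 0 3 + ((-1 / 2 * lam' - 1 / 2 * lam * lam') * p₀ ^ 3 * b₀) *
      relOne lam lam' del C 1 2 + ((1 / 2 * lam') * p₀ ^ 2 * b₁ + (lam' - 1 / 3 * lam' * del) *
      p₀ ^ 3 * b₀) * relOne lam lam' del C 1 3 + ((-1 / 2 * lam') * p₂ * b₀ + (3 / 2 * lam') *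
      p₀ * p₁ * b₀ + (-2 / 3 * lam' - 1 / 3 * lam' ^ 2) * p₀ ^ 3 * b₀) * relOne lam lam' del C
      2 3 + ((-3 / 2 - 3 / 2 * lam) * p₂ * b₀ + (9 / 2 + 9 / 2 * lam) * p₀ * p₁ * b₀ + (-3 / 2
      - 3 / 2 * lam) * p₀ ^ 3 * b₀) * relTwo lam lam' del C 0 2 + ((-3 / 2 + 1 / 2 * del) * p₂
      * b₀ + (-1) * p₁ * b₁ + (3 / 2 - 1 / 2 * del) * p₀ * p₁ * b₀ + (1 / 2) * p₀ ^ 2 * b₁) *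
      relTwo lam lam' del C 0 3 + ((1 / 2 * lam') * p₂ * b₀ + (-1 / 2 * lam') * p₀ * p₁ * b₀) *
      relTwo lam lam' del C 1 3 := by
  simp only [jetDefect, Fin.sum_univ_five, Fin.val_zero, Fin.val_one, Fin.val_two,
    val_three, val_four, hC 4 3 (by decide), mcoef_eq_zero lam p (show 3 < 4 by decide),
    twistedPow_0_apply, twistedPow_1_apply, twistedPow_2_apply, twistedPow_3_apply, mcoef_1_0,
    mcoef_2_0, mcoef_2_1, mcoef_3_0, mcoef_3_1, mcoef_3_2, mcoef_self, Nat.sub_self,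
    Nat.sub_zero, show 3 - 1 = 2 from rfl, show 3 - 2 = 1 from rfl, pow_succ', pow_zero,
    Module.End.mul_apply, Module.End.one_apply, ddx_mul, map_add, map_smul, map_zero, zero_smul,
    smul_zero, zero_mul, mul_zero, one_mul, sub_zero, zero_add, add_zero, sub_self, val_add,
    val_mul, val_sub, val_smul, val_zero, Nat.cast_zero, Nat.cast_one, Nat.cast_ofNat, hp₀, hp₁,
    hp₂, hb₀, hb₁, hb₂, hb₃]
  rw [relOne_0_1, relOne_0_2, relOne_0_3, relOne_1_2, relOne_1_3, relOne_2_3, relTwo_0_2,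
    relTwo_0_3, relTwo_1_3]
  ring

lemma jetDefect_0_4 (hp₀ : p.1 x = p₀) (hp₁ : (ddx 𝕜 p).1 x = p₁) (hp₂ : (ddx 𝕜
    (ddx 𝕜 p)).1 x = p₂) (hp₃ : (ddx 𝕜 (ddx 𝕜 (ddx 𝕜 p))).1 x = p₃) (hb₀ : b.1 x = b₀) (hb₁ :
    (ddx 𝕜 b).1 x = b₁) (hb₂ : (ddx 𝕜 (ddx 𝕜 b)).1 x = b₂) (hb₃ : (ddx 𝕜 (ddx 𝕜 (ddx 𝕜 b))).1 x
    = b₃) (hb₄ : (ddx 𝕜 (ddx 𝕜 (ddx 𝕜 (ddx 𝕜 b)))).1 x = b₄) :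
    (jetDefect lam lam' del C 0 4 p b).1 x =
      ((4 / 5 + 3 * lam + 6 / 5 * lam ^ 2) * p₃ * b₀ + (-8 / 5 - 6 * lam - 12 / 5 * lam ^ 2) *
      p₁ ^ 2 * b₀ + (-19 / 5 - 14 * lam - 36 / 5 * lam ^ 2) * p₀ * p₂ * b₀ + (19 / 5 + 14 * lam
      + 36 / 5 * lam ^ 2) * p₀ ^ 2 * p₁ * b₀ + (11 / 20 + 2 * lam + 27 / 10 * lam ^ 2 + lam ^
      3) * p₀ ^ 4 * b₀) * relOne lam lam' del C 0 1 + ((21 / 5 - 2 / 5 * del + 33 / 5 * lam - 3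
      / 5 * lam * del + 6 / 5 * lam ^ 2) * p₃ * b₀ + (2 + 3 * lam) * p₂ * b₁ + (-42 / 5 + 4 / 5
      * del - 66 / 5 * lam + 6 / 5 * lam * del - 12 / 5 * lam ^ 2) * p₁ ^ 2 * b₀ + (-66 / 5 + 2
      / 5 * del - 108 / 5 * lam + 3 / 5 * lam * del - 36 / 5 * lam ^ 2) * p₀ * p₂ * b₀ + (-2 -
      3 * lam) * p₀ * p₁ * b₁ + (66 / 5 - 2 / 5 * del + 108 / 5 * lam - 3 / 5 * lam * del + 36
      / 5 * lam ^ 2) * p₀ ^ 2 * p₁ * b₀ + (-3 - 5 * lam - 2 * lam ^ 2) * p₀ ^ 3 * b₁ + (-63 /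
      10 + 17 / 20 * del - 52 / 5 * lam + 7 / 5 * lam * del - 19 / 5 * lam ^ 2 + 1 / 2 * lam ^
      2 * del) * p₀ ^ 4 * b₀) * relOne lam lam' del C 0 2 + ((39 / 5 - 9 / 5 * del + 26 / 5 *
      lam - 6 / 5 * lam * del) * p₃ * b₀ + (6 + 4 * lam) * p₂ * b₁ + (-78 / 5 + 18 / 5 * del -
      52 / 5 * lam + 12 / 5 * lam * del) * p₁ ^ 2 * b₀ + (-84 / 5 + 24 / 5 * del - 56 / 5 * lam
      + 16 / 5 * lam * del) * p₀ * p₂ * b₀ + (-6 - 4 * lam) * p₀ * p₁ * b₁ + (3 + 2 * lam) * p₀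
      ^ 2 * b₂ + (144 / 5 - 39 / 5 * del + 96 / 5 * lam - 26 / 5 * lam * del) * p₀ ^ 2 * p₁ *
      b₀ + (9 - 2 * del + 6 * lam - 4 / 3 * lam * del) * p₀ ^ 3 * b₁ + (9 / 5 - 23 / 10 * del +
      1 / 2 * del ^ 2 + 6 / 5 * lam - 23 / 15 * lam * del + 1 / 3 * lam * del ^ 2) * p₀ ^ 4 *
      b₀) * relOne lam lam' del C 0 3 + ((26 / 5 - 5 / 2 * del + 3 / 10 * del ^ 2) * p₃ * b₀ +
      (11 / 2 - 3 / 2 * del) * p₂ * b₁ + (-52 / 5 + 5 * del - 3 / 5 * del ^ 2) * p₁ ^ 2 * b₀ +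
      (-1) * p₀ * b₃ + (-46 / 5 + 7 / 2 * del - 3 / 10 * del ^ 2) * p₀ * p₂ * b₀ + (-33 / 2 + 9
      / 2 * del) * p₀ * p₁ * b₁ + (-9 / 2 + 3 / 2 * del) * p₀ ^ 2 * b₂ + (-44 / 5 + 7 * del - 6
      / 5 * del ^ 2) * p₀ ^ 2 * p₁ * b₀ + (-5 + 5 * del - del ^ 2) * p₀ ^ 3 * b₁ + (-14 / 5 + 9
      / 2 * del - 39 / 20 * del ^ 2 + 1 / 4 * del ^ 3) * p₀ ^ 4 * b₀) * relOne lam lam' del C 0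
      4 + ((-2 / 5 * lam' - 3 / 5 * lam * lam') * p₃ * b₀ + (4 / 5 * lam' + 6 / 5 * lam * lam')
      * p₁ ^ 2 * b₀ + (2 / 5 * lam' + 3 / 5 * lam * lam') * p₀ * p₂ * b₀ + (-2 / 5 * lam' - 3 /
      5 * lam * lam') * p₀ ^ 2 * p₁ * b₀ + (17 / 20 * lam' + 7 / 5 * lam * lam' + 1 / 2 * lam ^
      2 * lam') * p₀ ^ 4 * b₀) * relOne lam lam' del C 1 2 + ((-3 / 5 * lam' - 2 / 5 * lam *
      lam') * p₃ * b₀ + (6 / 5 * lam' + 4 / 5 * lam * lam') * p₁ ^ 2 * b₀ + (3 / 5 * lam' + 2 /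
      5 * lam * lam') * p₀ * p₂ * b₀ + (-3 / 5 * lam' - 2 / 5 * lam * lam') * p₀ ^ 2 * p₁ * b₀
      + (-lam' - 2 / 3 * lam * lam') * p₀ ^ 3 * b₁ + (-21 / 10 * lam' + 1 / 2 * lam' * del - 7
      / 5 * lam * lam' + 1 / 3 * lam * lam' * del) * p₀ ^ 4 * b₀) * relOne lam lam' del C 1 3 +
      ((-2 / 5 * lam' + 1 / 10 * lam' * del) * p₃ * b₀ + (4 / 5 * lam' - 1 / 5 * lam' * del) *
      p₁ ^ 2 * b₀ + (2 / 5 * lam' - 1 / 10 * lam' * del) * p₀ * p₂ * b₀ + (1 / 2 * lam') * p₀ ^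
      2 * b₂ + (8 / 5 * lam' - 2 / 5 * lam' * del) * p₀ ^ 2 * p₁ * b₀ + (7 / 3 * lam' - 2 / 3 *
      lam' * del) * p₀ ^ 3 * b₁ + (13 / 5 * lam' - 33 / 20 * lam' * del + 1 / 4 * lam' * del ^
      2) * p₀ ^ 4 * b₀) * relOne lam lam' del C 1 4 + ((-3 / 5 * lam' - 2 / 5 * lam * lam') *
      p₃ * b₀ + (6 / 5 * lam' + 4 / 5 * lam * lam') * p₁ ^ 2 * b₀ + (18 / 5 * lam' + 12 / 5 *
      lam * lam') * p₀ * p₂ * b₀ + (-33 / 5 * lam' - 22 / 5 * lam * lam') * p₀ ^ 2 * p₁ * b₀ +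
      (19 / 10 * lam' + 1 / 2 * lam' ^ 2 + 19 / 15 * lam * lam' + 1 / 3 * lam * lam' ^ 2) * p₀
      ^ 4 * b₀) * relOne lam lam' del C 2 3 + ((-2 / 5 * lam' + 1 / 10 * lam' * del) * p₃ * b₀
      + (-1 / 2 * lam') * p₂ * b₁ + (4 / 5 * lam' - 1 / 5 * lam' * del) * p₁ ^ 2 * b₀ + (2 / 5
      * lam' - 1 / 10 * lam' * del) * p₀ * p₂ * b₀ + (3 / 2 * lam') * p₀ * p₁ * b₁ + (8 / 5 *
      lam' - 2 / 5 * lam' * del) * p₀ ^ 2 * p₁ * b₀ + (-2 / 3 * lam' - 1 / 3 * lam' ^ 2) * p₀ ^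
      3 * b₁ + (-7 / 5 * lam' + 7 / 20 * lam' * del - lam' ^ 2 + 1 / 4 * lam' ^ 2 * del) * p₀ ^
      4 * b₀) * relOne lam lam' del C 2 4 + ((-1 / 10 * lam' + 3 / 10 * lam' ^ 2) * p₃ * b₀ +
      (1 / 5 * lam' - 3 / 5 * lam' ^ 2) * p₁ ^ 2 * b₀ + (11 / 10 * lam' - 3 / 10 * lam' ^ 2) *
      p₀ * p₂ * b₀ + (-13 / 5 * lam' - 6 / 5 * lam' ^ 2) * p₀ ^ 2 * p₁ * b₀ + (9 / 10 * lam' +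
      21 / 20 * lam' ^ 2 + 1 / 4 * lam' ^ 3) * p₀ ^ 4 * b₀) * relOne lam lam' del C 3 4 + ((-9
      / 5 - 3 * lam - 6 / 5 * lam ^ 2) * p₃ * b₀ + (28 / 5 + 9 * lam + 12 / 5 * lam ^ 2) * p₁ ^
      2 * b₀ + (54 / 5 + 18 * lam + 36 / 5 * lam ^ 2) * p₀ * p₂ * b₀ + (-109 / 5 - 36 * lam -
      66 / 5 * lam ^ 2) * p₀ ^ 2 * p₁ * b₀ + (109 / 20 + 9 * lam + 33 / 10 * lam ^ 2) * p₀ ^ 4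
      * b₀) * relTwo lam lam' del C 0 2 + ((-21 / 5 + 6 / 5 * del - 14 / 5 * lam + 4 / 5 * lam
      * del) * p₃ * b₀ + (-3 - 2 * lam) * p₂ * b₁ + (57 / 5 - 12 / 5 * del + 38 / 5 * lam - 8 /
      5 * lam * del) * p₁ ^ 2 * b₀ + (66 / 5 - 21 / 5 * del + 44 / 5 * lam - 14 / 5 * lam *
      del) * p₀ * p₂ * b₀ + (9 + 6 * lam) * p₀ * p₁ * b₁ + (-66 / 5 + 21 / 5 * del - 44 / 5 *
      lam + 14 / 5 * lam * del) * p₀ ^ 2 * p₁ * b₀ + (-3 - 2 * lam) * p₀ ^ 3 * b₁ + (3 / 10 - 3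
      / 10 * del + 1 / 5 * lam - 1 / 5 * lam * del) * p₀ ^ 4 * b₀) * relTwo lam lam' del C 0 3
      + ((-14 / 5 + 3 / 2 * del - 1 / 5 * del ^ 2) * p₃ * b₀ + (-7 / 2 + del) * p₂ * b₁ + (-1)
      * p₁ * b₂ + (18 / 5 - 5 / 2 * del + 2 / 5 * del ^ 2) * p₁ ^ 2 * b₀ + (14 / 5 - 3 / 2 *
      del + 1 / 5 * del ^ 2) * p₀ * p₂ * b₀ + (7 / 2 - del) * p₀ * p₁ * b₁ + (1 / 2) * p₀ ^ 2 *
      b₂ + (-4 / 5 + del - 1 / 5 * del ^ 2) * p₀ ^ 2 * p₁ * b₀ + (1 / 5 - 1 / 4 * del + 1 / 20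
      * del ^ 2) * p₀ ^ 4 * b₀) * relTwo lam lam' del C 0 4 + ((6 / 5 * lam' + 4 / 5 * lam *
      lam') * p₃ * b₀ + (-12 / 5 * lam' - 8 / 5 * lam * lam') * p₁ ^ 2 * b₀ + (-21 / 5 * lam' -
      14 / 5 * lam * lam') * p₀ * p₂ * b₀ + (21 / 5 * lam' + 14 / 5 * lam * lam') * p₀ ^ 2 * p₁
      * b₀ + (-3 / 10 * lam' - 1 / 5 * lam * lam') * p₀ ^ 4 * b₀) * relTwo lam lam' del C 1 3 +
      ((4 / 5 * lam' - 1 / 5 * lam' * del) * p₃ * b₀ + (1 / 2 * lam') * p₂ * b₁ + (-8 / 5 *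
      lam' + 2 / 5 * lam' * del) * p₁ ^ 2 * b₀ + (-4 / 5 * lam' + 1 / 5 * lam' * del) * p₀ * p₂
      * b₀ + (-1 / 2 * lam') * p₀ * p₁ * b₁ + (4 / 5 * lam' - 1 / 5 * lam' * del) * p₀ ^ 2 * p₁
      * b₀ + (-1 / 5 * lam' + 1 / 20 * lam' * del) * p₀ ^ 4 * b₀) * relTwo lam lam' del C 1 4 +
      ((-1 / 10 * lam' - 1 / 5 * lam' ^ 2) * p₃ * b₀ + (7 / 10 * lam' + 2 / 5 * lam' ^ 2) * p₁
      ^ 2 * b₀ + (1 / 10 * lam' + 1 / 5 * lam' ^ 2) * p₀ * p₂ * b₀ + (-3 / 5 * lam' - 1 / 5 *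
      lam' ^ 2) * p₀ ^ 2 * p₁ * b₀ + (3 / 20 * lam' + 1 / 20 * lam' ^ 2) * p₀ ^ 4 * b₀) *
      relTwo lam lam' del C 2 4 := by
  simp only [jetDefect, Fin.sum_univ_five, Fin.val_zero, Fin.val_one, Fin.val_two,
    val_three, val_four, twistedPow_0_apply, twistedPow_1_apply, twistedPow_2_apply,
    twistedPow_3_apply, twistedPow_4_apply, mcoef_1_0, mcoef_2_0, mcoef_2_1, mcoef_3_0,
    mcoef_3_1, mcoef_3_2, mcoef_4_0, mcoef_4_1, mcoef_4_2, mcoef_4_3, mcoef_self, Nat.sub_self,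
    Nat.sub_zero, show 4 - 1 = 3 from rfl, show 4 - 2 = 2 from rfl, show 4 - 3 = 1 from rfl,
    pow_succ', pow_zero, Module.End.mul_apply, Module.End.one_apply, ddx_mul, map_add, map_smul,
    map_zero, zero_smul, smul_zero, zero_mul, mul_zero, one_mul, sub_zero, zero_add, add_zero,
    sub_self, val_add, val_mul, val_sub, val_smul, val_zero, Nat.cast_zero, Nat.cast_one,
    Nat.cast_ofNat, hp₀, hp₁, hp₂, hp₃, hb₀, hb₁, hb₂, hb₃, hb₄]
  rw [relOne_0_1, relOne_0_2, relOne_0_3, relOne_0_4, relOne_1_2, relOne_1_3, relOne_1_4,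
    relOne_2_3, relOne_2_4, relOne_3_4, relTwo_0_2, relTwo_0_3, relTwo_0_4, relTwo_1_3,
    relTwo_1_4, relTwo_2_4]
  ring

lemma jetDefect_1_2 (hC : IsUpper C) (hp₀ : p.1 x = p₀) (hb₀ : b.1 x = b₀) (hb₁ : (ddx 𝕜 b).1 x =
    b₁) :
    (jetDefect lam lam' del C 1 2 p b).1 x =
      ((-1) * p₀ * b₀) * relOne lam lam' del C 1 2 := by
  simp only [jetDefect, Fin.sum_univ_five, Fin.val_zero, Fin.val_one, Fin.val_two,
    val_three, val_four, hC 1 0 (by decide), hC 3 2 (by decide), hC 4 2 (by decide),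
    mcoef_eq_zero lam p (show 2 < 3 by decide), mcoef_eq_zero lam p (show 2 < 4 by decide),
    mcoef_eq_zero lam' p (show 0 < 1 by decide), twistedPow_0_apply, twistedPow_1_apply,
    mcoef_1_0, mcoef_2_1, mcoef_self, Nat.sub_self, Nat.sub_zero, show 2 - 1 = 1 from rfl,
    pow_succ', pow_zero, Module.End.mul_apply, Module.End.one_apply, ddx_mul, map_add, map_smul,
    map_zero, zero_smul, smul_zero, zero_mul, mul_zero, one_mul, sub_zero, zero_add, add_zero,
    sub_self, val_add, val_mul, val_sub, val_smul, val_zero, Nat.cast_zero, Nat.cast_one,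
    Nat.cast_ofNat, hp₀, hb₀, hb₁]
  rw [relOne_1_2]
  ring

lemma jetDefect_1_3 (hC : IsUpper C) (hp₀ : p.1 x = p₀) (hp₁ : (ddx 𝕜 p).1 x = p₁) (hb₀ : b.1 x =
    b₀) (hb₁ : (ddx 𝕜 b).1 x = b₁) (hb₂ : (ddx 𝕜 (ddx 𝕜 b)).1 x = b₂) :
    (jetDefect lam lam' del C 1 3 p b).1 x =
      ((3 / 2 + 3 / 2 * lam) * p₀ ^ 2 * b₀) * relOne lam lam' del C 1 2 + ((-1) * p₀ * b₁ + (-3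
      / 2 + 1 / 2 * del) * p₀ ^ 2 * b₀) * relOne lam lam' del C 1 3 + ((1 / 2 + lam') * p₀ ^ 2
      * b₀) * relOne lam lam' del C 2 3 + ((-1) * p₁ * b₀ + (1 / 2) * p₀ ^ 2 * b₀) * relTwo lam
      lam' del C 1 3 := by
  simp only [jetDefect, Fin.sum_univ_five, Fin.val_zero, Fin.val_one, Fin.val_two,
    val_three, val_four, hC 1 0 (by decide), hC 4 3 (by decide), mcoef_eq_zero lam p (show 3 < 4
    by decide), mcoef_eq_zero lam' p (show 0 < 1 by decide), twistedPow_0_apply,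
    twistedPow_1_apply, twistedPow_2_apply, mcoef_1_0, mcoef_2_0, mcoef_2_1, mcoef_3_1,
    mcoef_3_2, mcoef_self, Nat.sub_self, Nat.sub_zero, show 2 - 1 = 1 from rfl, show 3 - 1 = 2
    from rfl, show 3 - 2 = 1 from rfl, pow_succ', pow_zero, Module.End.mul_apply,
    Module.End.one_apply, ddx_mul, map_add, map_smul, map_zero, zero_smul, smul_zero, zero_mul,
    mul_zero, one_mul, sub_zero, zero_add, add_zero, sub_self, val_add, val_mul, val_sub,
    val_smul, val_zero, Nat.cast_zero, Nat.cast_one, Nat.cast_ofNat, hp₀, hp₁, hb₀, hb₁, hb₂]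
  rw [relOne_1_2, relOne_1_3, relOne_2_3, relTwo_1_3]
  ring

lemma jetDefect_1_4 (hC : IsUpper C) (hp₀ : p.1 x = p₀) (hp₁ : (ddx 𝕜 p).1 x = p₁) (hp₂ : (ddx 𝕜
    (ddx 𝕜 p)).1 x = p₂) (hb₀ : b.1 x = b₀) (hb₁ : (ddx 𝕜 b).1 x = b₁) (hb₂ : (ddx 𝕜 (ddx 𝕜
    b)).1 x = b₂) (hb₃ : (ddx 𝕜 (ddx 𝕜 (ddx 𝕜 b))).1 x = b₃) :
    (jetDefect lam lam' del C 1 4 p b).1 x =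
      ((2 + 3 * lam) * p₂ * b₀ + (-2 - 3 * lam) * p₀ * p₁ * b₀ + (-3 - 5 * lam - 2 * lam ^ 2) *
      p₀ ^ 3 * b₀) * relOne lam lam' del C 1 2 + ((3 + 2 * lam) * p₂ * b₀ + (-3 - 2 * lam) * p₀
      * p₁ * b₀ + (3 + 2 * lam) * p₀ ^ 2 * b₁ + (5 - del + 10 / 3 * lam - 2 / 3 * lam * del) *
      p₀ ^ 3 * b₀) * relOne lam lam' del C 1 3 + ((2 - 1 / 2 * del) * p₂ * b₀ + (-1) * p₀ * b₂
      + (-6 + 3 / 2 * del) * p₀ * p₁ * b₀ + (-7 / 2 + del) * p₀ ^ 2 * b₁ + (-8 / 3 + 2 * del -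
      1 / 3 * del ^ 2) * p₀ ^ 3 * b₀) * relOne lam lam' del C 1 4 + ((-1 - 2 * lam' - 2 / 3 *
      lam - 4 / 3 * lam * lam') * p₀ ^ 3 * b₀) * relOne lam lam' del C 2 3 + ((1 / 2 + lam') *
      p₀ ^ 2 * b₁ + (4 / 3 - 1 / 3 * del + 8 / 3 * lam' - 2 / 3 * lam' * del) * p₀ ^ 3 * b₀) *
      relOne lam lam' del C 2 4 + ((-1 / 2 - 3 / 2 * lam') * p₂ * b₀ + (3 / 2 + 9 / 2 * lam') *
      p₀ * p₁ * b₀ + (-1 - 3 * lam' - lam' ^ 2) * p₀ ^ 3 * b₀) * relOne lam lam' del C 3 4 +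
      ((-3 - 2 * lam) * p₂ * b₀ + (9 + 6 * lam) * p₀ * p₁ * b₀ + (-3 - 2 * lam) * p₀ ^ 3 * b₀)
      * relTwo lam lam' del C 1 3 + ((-2 + 1 / 2 * del) * p₂ * b₀ + (-1) * p₁ * b₁ + (2 - 1 / 2
      * del) * p₀ * p₁ * b₀ + (1 / 2) * p₀ ^ 2 * b₁) * relTwo lam lam' del C 1 4 + ((1 / 2 +
      lam') * p₂ * b₀ + (-1 / 2 - lam') * p₀ * p₁ * b₀) * relTwo lam lam' del C 2 4 := by
  simp only [jetDefect, Fin.sum_univ_five, Fin.val_zero, Fin.val_one, Fin.val_two,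
    val_three, val_four, hC 1 0 (by decide), mcoef_eq_zero lam' p (show 0 < 1 by decide),
    twistedPow_0_apply, twistedPow_1_apply, twistedPow_2_apply, twistedPow_3_apply, mcoef_1_0,
    mcoef_2_0, mcoef_2_1, mcoef_3_0, mcoef_3_1, mcoef_3_2, mcoef_4_1, mcoef_4_2, mcoef_4_3,
    mcoef_self, Nat.sub_self, Nat.sub_zero, show 2 - 1 = 1 from rfl, show 3 - 1 = 2 from rfl,
    show 4 - 1 = 3 from rfl, show 4 - 2 = 2 from rfl, show 4 - 3 = 1 from rfl, pow_succ',
    pow_zero, Module.End.mul_apply, Module.End.one_apply, ddx_mul, map_add, map_smul, map_zero,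
    zero_smul, smul_zero, zero_mul, mul_zero, one_mul, sub_zero, zero_add, add_zero, sub_self,
    val_add, val_mul, val_sub, val_smul, val_zero, Nat.cast_zero, Nat.cast_one, Nat.cast_ofNat,
    hp₀, hp₁, hp₂, hb₀, hb₁, hb₂, hb₃]
  rw [relOne_1_2, relOne_1_3, relOne_1_4, relOne_2_3, relOne_2_4, relOne_3_4, relTwo_1_3,
    relTwo_1_4, relTwo_2_4]
  ring

lemma jetDefect_2_3 (hC : IsUpper C) (hp₀ : p.1 x = p₀) (hb₀ : b.1 x = b₀) (hb₁ : (ddx 𝕜 b).1 x =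
    b₁) :
    (jetDefect lam lam' del C 2 3 p b).1 x =
      ((-1) * p₀ * b₀) * relOne lam lam' del C 2 3 := by
  simp only [jetDefect, Fin.sum_univ_five, Fin.val_zero, Fin.val_one, Fin.val_two,
    val_three, val_four, hC 2 0 (by decide), hC 2 1 (by decide), hC 4 3 (by decide),
    mcoef_eq_zero lam p (show 3 < 4 by decide), mcoef_eq_zero lam' p (show 0 < 2 by decide),
    mcoef_eq_zero lam' p (show 1 < 2 by decide), twistedPow_0_apply, twistedPow_1_apply,
    mcoef_1_0, mcoef_3_2, mcoef_self, Nat.sub_self, Nat.sub_zero, show 3 - 2 = 1 from rfl,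
    pow_succ', pow_zero, Module.End.mul_apply, Module.End.one_apply, ddx_mul, map_add, map_smul,
    map_zero, zero_smul, smul_zero, zero_mul, mul_zero, one_mul, sub_zero, zero_add, add_zero,
    sub_self, val_add, val_mul, val_sub, val_smul, val_zero, Nat.cast_zero, Nat.cast_one,
    Nat.cast_ofNat, hp₀, hb₀, hb₁]
  rw [relOne_2_3]
  ring

lemma jetDefect_2_4 (hC : IsUpper C) (hp₀ : p.1 x = p₀) (hp₁ : (ddx 𝕜 p).1 x = p₁) (hb₀ : b.1 x =
    b₀) (hb₁ : (ddx 𝕜 b).1 x = b₁) (hb₂ : (ddx 𝕜 (ddx 𝕜 b)).1 x = b₂) :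
    (jetDefect lam lam' del C 2 4 p b).1 x =
      ((3 + 2 * lam) * p₀ ^ 2 * b₀) * relOne lam lam' del C 2 3 + ((-1) * p₀ * b₁ + (-2 + 1 / 2
      * del) * p₀ ^ 2 * b₀) * relOne lam lam' del C 2 4 + ((3 / 2 + 3 / 2 * lam') * p₀ ^ 2 *
      b₀) * relOne lam lam' del C 3 4 + ((-1) * p₁ * b₀ + (1 / 2) * p₀ ^ 2 * b₀) * relTwo lam
      lam' del C 2 4 := by
  simp only [jetDefect, Fin.sum_univ_five, Fin.val_zero, Fin.val_one, Fin.val_two,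
    val_three, val_four, hC 2 0 (by decide), hC 2 1 (by decide), mcoef_eq_zero lam' p (show 0 < 2
    by decide), mcoef_eq_zero lam' p (show 1 < 2 by decide), twistedPow_0_apply,
    twistedPow_1_apply, twistedPow_2_apply, mcoef_1_0, mcoef_2_0, mcoef_2_1, mcoef_3_2,
    mcoef_4_2, mcoef_4_3, mcoef_self, Nat.sub_self, Nat.sub_zero, show 3 - 2 = 1 from rfl, show 4
    - 2 = 2 from rfl, show 4 - 3 = 1 from rfl, pow_succ', pow_zero, Module.End.mul_apply,
    Module.End.one_apply, ddx_mul, map_add, map_smul, map_zero, zero_smul, smul_zero, zero_mul,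
    mul_zero, one_mul, sub_zero, zero_add, add_zero, sub_self, val_add, val_mul, val_sub,
    val_smul, val_zero, Nat.cast_zero, Nat.cast_one, Nat.cast_ofNat, hp₀, hp₁, hb₀, hb₁, hb₂]
  rw [relOne_2_3, relOne_2_4, relOne_3_4, relTwo_2_4]
  ring

lemma jetDefect_3_4 (hC : IsUpper C) (hp₀ : p.1 x = p₀) (hb₀ : b.1 x = b₀) (hb₁ : (ddx 𝕜 b).1 x =
    b₁) :
    (jetDefect lam lam' del C 3 4 p b).1 x =
      ((-1) * p₀ * b₀) * relOne lam lam' del C 3 4 := by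
  simp only [jetDefect, Fin.sum_univ_five, Fin.val_zero, Fin.val_one, Fin.val_two,
    val_three, val_four, hC 3 0 (by decide), hC 3 1 (by decide), hC 3 2 (by decide),
    mcoef_eq_zero lam' p (show 0 < 3 by decide), mcoef_eq_zero lam' p (show 1 < 3 by decide),
    mcoef_eq_zero lam' p (show 2 < 3 by decide), twistedPow_0_apply, twistedPow_1_apply,
    mcoef_1_0, mcoef_4_3, mcoef_self, Nat.sub_self, Nat.sub_zero, show 4 - 3 = 1 from rfl,
    pow_succ', pow_zero, Module.End.mul_apply, Module.End.one_apply, ddx_mul, map_add, map_smul,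
    map_zero, zero_smul, smul_zero, zero_mul, mul_zero, one_mul, sub_zero, zero_add, add_zero,
    sub_self, val_add, val_mul, val_sub, val_smul, val_zero, Nat.cast_zero, Nat.cast_one,
    Nat.cast_ofNat, hp₀, hb₀, hb₁]
  rw [relOne_3_4]
  ring

end Expansions

end JetRelations

/-! ### Symmetries as solutions of linear equations. -/

section Intertwiners

variable {𝕜 : Type*} [RCLike 𝕜]

/-- The operator `opV C` intertwines the actions for the weights `(lam, mu)` and `(lam', mu')`. -/
def Intertwines (lam mu lam' mu' : 𝕜) (C : Matrix (Fin 5) (Fin 5) 𝕜) : Prop :=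
  ∀ f a, opV C (coeffAct lam mu f a) = coeffAct lam' mu' f (opV C a)

/-- The equations characterizing the intertwining operators. -/
def JetRelations (lam lam' del : 𝕜) (C : Matrix (Fin 5) (Fin 5) 𝕜) : Prop :=
  (∀ i j : Fin 5, i < j → relOne lam lam' del C i j = 0) ∧
    ∀ i j : Fin 5, (i : ℕ) + 1 < j → relTwo lam lam' del C i j = 0

/-- Both sides depend on `f` only through `p = f''/f'` once the coefficients are replaced by their
pullbacks: the derivative `a_j^(j - k)` of a density of weight `del - j` is pulled back with weight
`del - k`, so `pull_ddx_pow` applies. -/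
lemma opV_coeffAct_sub {lam mu lam' mu' del : 𝕜} (h : mu - lam = del) (h' : mu' - lam' = del)
    {C : Matrix (Fin 5) (Fin 5) 𝕜} (hC : IsUpper C) (f : CircleDiffeo)
    (a : Fin 5 → SmoothFun 𝕜) (i : Fin 5) :
    opV C (coeffAct lam mu f a) i - coeffAct lam' mu' f (opV C a) i =
      ∑ j : Fin 5, jetDefect lam lam' del C i j (logJac f) (pull f (del - (j : ℕ)) (a j)) := by
  simp only [jetDefect, Finset.sum_sub_distrib]
  congr 1
  · rw [opV_apply, Finset.sum_comm]
    refine Finset.sum_congr rfl fun k _ => ?_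
    rw [coeffAct_apply, map_sum, Finset.smul_sum, h]
  · rw [coeffAct_apply, Finset.sum_comm]
    refine Finset.sum_congr rfl fun k _ => ?_
    rw [opV_apply, map_sum, Finset.mul_sum, h']
    refine Finset.sum_congr rfl fun j _ => ?_
    rw [map_smul]
    rcases lt_or_ge j k with hj | hj
    · rw [hC k j hj, zero_smul, zero_smul]
    · have h1 : (del - (k : ℕ) : 𝕜) = del - (j : ℕ) + ((j : ℕ) - (k : ℕ) : ℕ) := by
        rw [Nat.cast_sub (Fin.le_def.1 hj)]
        ring
      rw [h1, pull_ddx_pow]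

lemma jetDefect_eq_zero {lam lam' del : 𝕜} {C : Matrix (Fin 5) (Fin 5) 𝕜} (hC : IsUpper C)
    (h : JetRelations lam lam' del C) (i j : Fin 5) (p b : SmoothFun 𝕜) :
    jetDefect lam lam' del C i j p b = 0 := by
  rcases le_or_gt j i with hij | hij
  · exact jetDefect_of_le hC hij p b
  obtain ⟨h1, h2⟩ := h
  have a01 := h1 0 1 (by decide)
  have a02 := h1 0 2 (by decide)
  have a03 := h1 0 3 (by decide)
  have a04 := h1 0 4 (by decide)
  have a12 := h1 1 2 (by decide)
  have a13 := h1 1 3 (by decide)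
  have a14 := h1 1 4 (by decide)
  have a23 := h1 2 3 (by decide)
  have a24 := h1 2 4 (by decide)
  have a34 := h1 3 4 (by decide)
  have b02 := h2 0 2 (by decide)
  have b03 := h2 0 3 (by decide)
  have b04 := h2 0 4 (by decide)
  have b13 := h2 1 3 (by decide)
  have b14 := h2 1 4 (by decide)
  have b24 := h2 2 4 (by decide)
  ext x
  rw [val_zero]
  fin_cases i <;> fin_cases j <;> first | exact absurd hij (by decide) | skip
  · exact (jetDefect_0_1 p b hC rfl rfl rfl).trans (by simp only [a01, mul_zero])
  · exact (jetDefect_0_2 p b hC rfl rfl rfl rfl rfl).trans (by simp only [a01, a02, a12, b02,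
    mul_zero, add_zero])
  · exact (jetDefect_0_3 p b hC rfl rfl rfl rfl rfl rfl rfl).trans (by simp only [a01, a02,
    a03, a12, a13, a23, b02, b03, b13, mul_zero, add_zero])
  · exact (jetDefect_0_4 p b rfl rfl rfl rfl rfl rfl rfl rfl rfl).trans (by simp only [a01,
    a02, a03, a04, a12, a13, a14, a23, a24, a34, b02, b03, b04, b13, b14, b24, mul_zero,
    add_zero])
  · exact (jetDefect_1_2 p b hC rfl rfl rfl).trans (by simp only [a12, mul_zero])
  · exact (jetDefect_1_3 p b hC rfl rfl rfl rfl rfl).trans (by simp only [a12, a13, a23, b13,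
    mul_zero, add_zero])
  · exact (jetDefect_1_4 p b hC rfl rfl rfl rfl rfl rfl rfl).trans (by simp only [a12, a13,
    a14, a23, a24, a34, b13, b14, b24, mul_zero, add_zero])
  · exact (jetDefect_2_3 p b hC rfl rfl rfl).trans (by simp only [a23, mul_zero])
  · exact (jetDefect_2_4 p b hC rfl rfl rfl rfl rfl).trans (by simp only [a23, a24, a34, b24,
    mul_zero, add_zero])
  · exact (jetDefect_3_4 p b hC rfl rfl rfl).trans (by simp only [a34, mul_zero])

/-- The defining equations imply the intertwining property. -/
lemma intertwines_of_jetRelations {lam mu lam' mu' del : 𝕜} (h : mu - lam = del)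
    (h' : mu' - lam' = del) {C : Matrix (Fin 5) (Fin 5) 𝕜} (hC : IsUpper C)
    (hrel : JetRelations lam lam' del C) : Intertwines lam mu lam' mu' C := by
  intro f a
  funext i
  rw [← sub_eq_zero, opV_coeffAct_sub h h' hC]
  exact Finset.sum_eq_zero fun j _ => jetDefect_eq_zero hC hrel i j _ _

/-- Feeding in an operator with a single coefficient separates the columns `j`. Pullback is
surjective, so the pulled back coefficient `b` is arbitrary. -/
lemma jetDefect_eq_zero_of_intertwines {lam mu lam' mu' del : 𝕜} (h : mu - lam = del)
    (h' : mu' - lam' = del) {C : Matrix (Fin 5) (Fin 5) 𝕜} (hC : IsUpper C)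
    (hint : Intertwines lam mu lam' mu' C) (f : CircleDiffeo) (i j : Fin 5) (b : SmoothFun 𝕜) :
    jetDefect lam lam' del C i j (logJac f) b = 0 := by
  let w : 𝕜 := del - (j : ℕ)
  have h1 := opV_coeffAct_sub h h' hC f (Pi.single j (densityAct f w b)) i
  rw [hint f, sub_self, Finset.sum_eq_single j, Pi.single_eq_same,
    show pull f (del - (j : ℕ)) (densityAct f w b) = b from
      LinearMap.congr_fun (pull_mul_densityAct f w) b] at h1
  · exact h1.symm
  · intro k _ hk
    rw [Pi.single_eq_of_ne hk, map_zero]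
    refine Finset.sum_eq_zero fun l _ => ?_
    rw [mul_zero, map_zero, map_zero, smul_zero, smul_zero, mul_zero, sub_zero]
  · simp

lemma ddx_germ_pow {b : SmoothFun 𝕜} {k : ℕ}
    (hb : b.1 =ᶠ[𝓝 0] fun x : ℝ => ((x - 0 : ℝ) : 𝕜) ^ k) :
    b.1 0 = (if 0 = k then (k.factorial : 𝕜) else 0) ∧
    (ddx 𝕜 b).1 0 = (if 1 = k then (k.factorial : 𝕜) else 0) ∧
    (ddx 𝕜 (ddx 𝕜 b)).1 0 = (if 2 = k then (k.factorial : 𝕜) else 0) ∧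
    (ddx 𝕜 (ddx 𝕜 (ddx 𝕜 b))).1 0 = (if 3 = k then (k.factorial : 𝕜) else 0) ∧
    (ddx 𝕜 (ddx 𝕜 (ddx 𝕜 (ddx 𝕜 b)))).1 0 = (if 4 = k then (k.factorial : 𝕜) else 0) :=
  ⟨ddx_pow_germ_pow hb 0, ddx_pow_germ_pow hb 1, ddx_pow_germ_pow hb 2, ddx_pow_germ_pow hb 3,
    ddx_pow_germ_pow hb 4⟩

lemma jetRelations_of_jetDefect {lam lam' del : 𝕜} {C : Matrix (Fin 5) (Fin 5) 𝕜}
    (hC : IsUpper C) (h : ∀ (f : CircleDiffeo) (i j : Fin 5) (b : SmoothFun 𝕜),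
      jetDefect lam lam' del C i j (logJac f) b = 0) : JetRelations lam lam' del C := by
  constructor
  · intro i j hij
    obtain ⟨ε, hε, h1⟩ := exists_local_diffeo 2 one_pos
    obtain ⟨f, hf, -⟩ := h1 ε (abs_of_pos hε).le
    obtain ⟨-, -, hp₀⟩ := deriv_of_germ_sq (𝕜 := 𝕜) hf
    have hε' : ((2 * ε : ℝ) : 𝕜) ≠ 0 := RCLike.ofReal_ne_zero.2 (by positivity)
    -- At `0` only the derivative of `b` of order `j - i - 1` is nonzero, and in the expansion it
    -- occurs with pure powers of `p₀` only in `-p₀ b_(j - i - 1) relOne i j`.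
    obtain ⟨b, hb⟩ := exists_germ_pow (𝕜 := 𝕜) ((j : ℕ) - i - 1) 0
    have h2 := congrArg (fun g => g.1 0) (h f i j b)
    obtain ⟨hb₀, hb₁, hb₂, hb₃, hb₄⟩ := ddx_germ_pow hb
    fin_cases i <;> fin_cases j <;> first | exact absurd hij (by decide) | skip
    · have h3 := (jetDefect_0_1 (logJac f) b hC hp₀ hb₀ hb₁).symm.trans h2
      simpa [val_zero, hε', hε.ne', Nat.factorial] using h3
    · have h3 := (jetDefect_0_2 (logJac f) b hC hp₀ rfl hb₀ hb₁ hb₂).symm.trans h2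
      simpa [val_zero, hε', hε.ne', Nat.factorial] using h3
    · have h3 := (jetDefect_0_3 (logJac f) b hC hp₀ rfl rfl hb₀ hb₁ hb₂ hb₃).symm.trans h2
      simpa [val_zero, hε', hε.ne', Nat.factorial] using h3
    · have h3 := (jetDefect_0_4 (logJac f) b hp₀ rfl rfl rfl hb₀ hb₁ hb₂ hb₃ hb₄).symm.trans h2
      simpa [val_zero, hε', hε.ne', Nat.factorial] using h3
    · have h3 := (jetDefect_1_2 (logJac f) b hC hp₀ hb₀ hb₁).symm.trans h2
      simpa [val_zero, hε', hε.ne', Nat.factorial] using h3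
    · have h3 := (jetDefect_1_3 (logJac f) b hC hp₀ rfl hb₀ hb₁ hb₂).symm.trans h2
      simpa [val_zero, hε', hε.ne', Nat.factorial] using h3
    · have h3 := (jetDefect_1_4 (logJac f) b hC hp₀ rfl rfl hb₀ hb₁ hb₂ hb₃).symm.trans h2
      simpa [val_zero, hε', hε.ne', Nat.factorial] using h3
    · have h3 := (jetDefect_2_3 (logJac f) b hC hp₀ hb₀ hb₁).symm.trans h2
      simpa [val_zero, hε', hε.ne', Nat.factorial] using h3
    · have h3 := (jetDefect_2_4 (logJac f) b hC hp₀ rfl hb₀ hb₁ hb₂).symm.trans h2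
      simpa [val_zero, hε', hε.ne', Nat.factorial] using h3
    · have h3 := (jetDefect_3_4 (logJac f) b hC hp₀ hb₀ hb₁).symm.trans h2
      simpa [val_zero, hε', hε.ne', Nat.factorial] using h3
  · intro i j hij
    obtain ⟨ε, hε, h1⟩ := exists_local_diffeo 3 one_pos
    obtain ⟨f, hf, -⟩ := h1 ε (abs_of_pos hε).le
    obtain ⟨-, -, hp₀, hp₁⟩ := deriv_of_germ_cube (𝕜 := 𝕜) hf
    have hε' : ((6 * ε : ℝ) : 𝕜) ≠ 0 := RCLike.ofReal_ne_zero.2 (by positivity)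
    -- Now `p₀ = 0` and `p₁ ≠ 0`, so the only surviving term of the expansion is `-p₁ b_(j - i - 2)
    -- relTwo i j`.
    obtain ⟨b, hb⟩ := exists_germ_pow (𝕜 := 𝕜) ((j : ℕ) - i - 2) 0
    have h2 := congrArg (fun g => g.1 0) (h f i j b)
    obtain ⟨hb₀, hb₁, hb₂, hb₃, hb₄⟩ := ddx_germ_pow hb
    fin_cases i <;> fin_cases j <;> first | exact absurd hij (by decide) | skip
    · have h3 := (jetDefect_0_2 (logJac f) b hC hp₀ hp₁ hb₀ hb₁ hb₂).symm.trans h2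
      simpa [val_zero, hε', hε.ne', Nat.factorial] using h3
    · have h3 := (jetDefect_0_3 (logJac f) b hC hp₀ hp₁ rfl hb₀ hb₁ hb₂ hb₃).symm.trans h2
      simpa [val_zero, hε', hε.ne', Nat.factorial] using h3
    · have h3 := (jetDefect_0_4 (logJac f) b hp₀ hp₁ rfl rfl hb₀ hb₁ hb₂ hb₃ hb₄).symm.trans h2
      simpa [val_zero, hε', hε.ne', Nat.factorial] using h3
    · have h3 := (jetDefect_1_3 (logJac f) b hC hp₀ hp₁ hb₀ hb₁ hb₂).symm.trans h2
      simpa [val_zero, hε', hε.ne', Nat.factorial] using h3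
    · have h3 := (jetDefect_1_4 (logJac f) b hC hp₀ hp₁ rfl hb₀ hb₁ hb₂ hb₃).symm.trans h2
      simpa [val_zero, hε', hε.ne', Nat.factorial] using h3
    · have h3 := (jetDefect_2_4 (logJac f) b hC hp₀ hp₁ hb₀ hb₁ hb₂).symm.trans h2
      simpa [val_zero, hε', hε.ne', Nat.factorial] using h3

lemma jetRelations_of_intertwines {lam mu lam' mu' del : 𝕜} (h : mu - lam = del)
    (h' : mu' - lam' = del) {C : Matrix (Fin 5) (Fin 5) 𝕜} (hC : IsUpper C)
    (hint : Intertwines lam mu lam' mu' C) : JetRelations lam lam' del C :=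
  jetRelations_of_jetDefect hC (jetDefect_eq_zero_of_intertwines h h' hC hint)

/-- The upper triangular matrices `C` for which `opV C` is a symmetry. -/
def symMat (lam mu : 𝕜) : Subalgebra 𝕜 (Matrix (Fin 5) (Fin 5) 𝕜) where
  carrier := {C | IsUpper C ∧ opV C ∈ CoeffSymmetryAlgebra lam mu}
  mul_mem' {C C'} hC hC' :=
    ⟨hC.1.mul hC'.1, by rw [opV_mul hC.1 hC'.1]; exact mul_mem hC.2 hC'.2⟩
  add_mem' {C C'} hC hC' := ⟨fun i j hij => by rw [Matrix.add_apply, hC.1 i j hij, hC'.1 i j hij,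
    add_zero], by rw [opV_add]; exact add_mem hC.2 hC'.2⟩
  algebraMap_mem' c := by
    rw [Algebra.algebraMap_eq_smul_one]
    refine ⟨fun i j hij => ?_, ?_⟩
    · rw [Matrix.smul_apply, Matrix.one_apply_ne hij.ne', smul_zero]
    · rw [opV_smul, opV_one]
      exact Subalgebra.smul_mem _ (one_mem _) c

lemma opV_mem_iff {lam mu : 𝕜} {C : Matrix (Fin 5) (Fin 5) 𝕜} :
    opV C ∈ CoeffSymmetryAlgebra lam mu ↔ Intertwines lam mu lam mu C :=
  mem_coeffSymmetryAlgebra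

lemma mem_symMat {lam mu : 𝕜} {C : Matrix (Fin 5) (Fin 5) 𝕜} :
    C ∈ symMat lam mu ↔ IsUpper C ∧ JetRelations lam lam (mu - lam) C :=
  ⟨fun h => ⟨h.1, jetRelations_of_intertwines rfl rfl h.1 (opV_mem_iff.1 h.2)⟩,
    fun h => ⟨h.1, opV_mem_iff.2 (intertwines_of_jetRelations rfl rfl h.1 h.2)⟩⟩

/-- The local symmetries. -/
def symMatHom (lam mu : 𝕜) : symMat lam mu →ₐ[𝕜] CoeffSymmetryAlgebra lam mu :=
  AlgHom.ofLinearMap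
    { toFun := fun C => ⟨opV C.1, C.2.2⟩
      map_add' := fun C C' => Subtype.ext (opV_add C.1 C'.1)
      map_smul' := fun c C => Subtype.ext (opV_smul c C.1) }
    (Subtype.ext opV_one) fun C C' => Subtype.ext (opV_mul C.2.1 C'.2.1)

lemma symMatHom_injective (lam mu : 𝕜) : Function.Injective (symMatHom lam mu) := fun C C' h =>
  Subtype.ext (opV_injOn C.2.1 C'.2.1 (congrArg Subtype.val h))

lemma symMatHom_surjective {lam mu : 𝕜} (hne : ¬ (lam = 0 ∧ mu = 1)) :
    Function.Surjective (symMatHom lam mu) := by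
  rintro ⟨T, hT⟩
  obtain ⟨C, hC, rfl⟩ := exists_eq_opV hT (isLocalAtZero_of_ne hne hT)
  exact ⟨⟨C, hC, hT⟩, rfl⟩

/-- Away from `(0, 1)` all symmetries are local. -/
def symMatEquiv {lam mu : 𝕜} (hne : ¬ (lam = 0 ∧ mu = 1)) :
    SymmetryAlgebra 4 lam mu ≃ₐ[𝕜] symMat lam mu :=
  (symmetryAlgebraEquiv lam mu).trans (AlgEquiv.ofBijective (symMatHom lam mu)
    ⟨symMatHom_injective lam mu, symMatHom_surjective hne⟩).symm

end Intertwiners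

/-! ### Elimination of the entries far from the diagonal. -/

section ReducedSystem

variable {𝕜 : Type*} [RCLike 𝕜] {lam mu : 𝕜} {C : Matrix (Fin 5) (Fin 5) 𝕜}

/-- The equations for the diagonal and superdiagonal entries of a local symmetry. -/
structure ReducedSystem (lam del a₁ a₂ a₃ a₄ y₁ y₂ y₃ y₄ : 𝕜) : Prop where
  first_one : (del - 1) * y₁ = lam * a₁
  first_two : (del - 2) * y₂ = (2 * lam + 1) * a₂
  first_three : (del - 3) * y₃ = (3 * lam + 3) * a₃
  first_four : (del - 4) * y₄ = (4 * lam + 6) * a₄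
  second_two :
      (-lam + lam * del + lam ^ 2) * a₁ + (-lam + lam * del + lam ^ 2) * a₂ = 0
  second_three :
      (-1 + del - 3 * lam + 3 * lam * del + 3 * lam ^ 2) * a₂ + (-1 + del - 3 * lam + 3 * lam *
      del + 3 * lam ^ 2) * a₃ = 0
  second_four :
      (-5 + 4 * del - 6 * lam + 6 * lam * del + 6 * lam ^ 2) * a₃ + (-5 + 4 * del - 6 * lam + 6
      * lam * del + 6 * lam ^ 2) * a₄ = 0
  third_three :
      (9 * lam - 9 * lam * del + 3 * lam ^ 2 - 9 * lam ^ 2 * del - 9 * lam ^ 3) * a₁ + (11 *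
      lam - 12 * lam * del + 9 * lam ^ 2 - 18 * lam ^ 2 * del - 18 * lam ^ 3) * a₂ + (-lam - 3
      * lam * del + 6 * lam ^ 2 - 9 * lam ^ 2 * del - 9 * lam ^ 3) * a₃ + (3 * lam ^ 2) * y₁ +
      (-2 * lam - lam ^ 2) * y₃ = 0
  third_four :
      (21 - 18 * del + 76 * lam - 66 * lam * del - 6 * lam ^ 2 - 36 * lam ^ 2 * del - 36 * lam
      ^ 3) * a₂ + (32 - 30 * del + 110 * lam - 108 * lam * del - 72 * lam ^ 2 * del - 72 * lam
      ^ 3) * a₃ + (8 - 12 * del + 22 * lam - 42 * lam * del + 6 * lam ^ 2 - 36 * lam ^ 2 * del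
      - 36 * lam ^ 3) * a₄ + (3 + 6 * lam + 6 * lam ^ 2) * y₂ + (-3 - 9 * lam - 3 * lam ^ 2) *
      y₄ = 0
  fourth_four :
      (-80 * lam + 76 * lam * del - 104 * lam ^ 2 + 132 * lam ^ 2 * del + 12 * lam ^ 3 + 72 *
      lam ^ 3 * del + 72 * lam ^ 4) * a₁ + (-146 * lam + 148 * lam * del - 344 * lam ^ 2 + 396
      * lam ^ 2 * del + 84 * lam ^ 3 + 216 * lam ^ 3 * del + 216 * lam ^ 4) * a₂ + (-52 * lam +
      128 * lam * del - 256 * lam ^ 2 + 396 * lam ^ 2 * del + 132 * lam ^ 3 + 216 * lam ^ 3 *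
      del + 216 * lam ^ 4) * a₃ + (-16 * lam + 56 * lam * del - 16 * lam ^ 2 + 132 * lam ^ 2 *
      del + 60 * lam ^ 3 + 72 * lam ^ 3 * del + 72 * lam ^ 4) * a₄ + (-4 * lam - 48 * lam ^ 2 -
      48 * lam ^ 3) * y₁ + (-12 * lam - 24 * lam ^ 2 - 24 * lam ^ 3) * y₂ + (48 * lam + 56 *
      lam ^ 2 + 16 * lam ^ 3) * y₃ + (26 * lam + 42 * lam ^ 2 + 12 * lam ^ 3) * y₄ = 0

/-- An entry `C i j` with `j ≥ i + 2` occurs in both `relOne i j` and `relTwo i j`; eliminating it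
leaves a compatibility condition on entries nearer to the diagonal. The names `first_`, ...,
`fourth_` record the distance `j - i`, and the second word records the column `j`. -/
lemma reducedSystem_of_mem (hC : C ∈ symMat lam mu) :
    ReducedSystem lam (mu - lam) (C 0 0 - C 1 1) (C 1 1 - C 2 2) (C 2 2 - C 3 3) (C 3 3 - C 4 4)
      (C 0 1) (C 1 2) (C 2 3) (C 3 4) := by
  obtain ⟨-, h1, h2⟩ := mem_symMat.1 hC
  generalize mu - lam = del at h1 h2 ⊢
  have a01 := h1 0 1 (by decide)
  have a02 := h1 0 2 (by decide)
  have a03 := h1 0 3 (by decide)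
  have a04 := h1 0 4 (by decide)
  have a12 := h1 1 2 (by decide)
  have a13 := h1 1 3 (by decide)
  have a14 := h1 1 4 (by decide)
  have a23 := h1 2 3 (by decide)
  have a24 := h1 2 4 (by decide)
  have a34 := h1 3 4 (by decide)
  have b02 := h2 0 2 (by decide)
  have b03 := h2 0 3 (by decide)
  have b04 := h2 0 4 (by decide)
  have b13 := h2 1 3 (by decide)
  have b14 := h2 1 4 (by decide)
  have b24 := h2 2 4 (by decide)
  rw [relOne_0_1] at a01
  rw [relOne_0_2] at a02
  rw [relOne_0_3] at a03
  rw [relOne_0_4] at a04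
  rw [relOne_1_2] at a12
  rw [relOne_1_3] at a13
  rw [relOne_1_4] at a14
  rw [relOne_2_3] at a23
  rw [relOne_2_4] at a24
  rw [relOne_3_4] at a34
  rw [relTwo_0_2] at b02
  rw [relTwo_0_3] at b03
  rw [relTwo_0_4] at b04
  rw [relTwo_1_3] at b13
  rw [relTwo_1_4] at b14
  rw [relTwo_2_4] at b24
  exact {
    first_one := by linear_combination -a01
    first_two := by linear_combination -a12
    first_three := by linear_combination -a23
    first_four := by linear_combination -a34
    second_two := by
      linear_combination (1 / 2 + lam) * a01 + (1 - 1 / 2 * del) * a02 + (1 / 2 * lam) * a12 +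
      (-3 / 2 + del) * b02
    second_three := by
      linear_combination (3 / 2 + 3 / 2 * lam) * a12 + (3 / 2 - 1 / 2 * del) * a13 + (1 / 2 +
      lam) * a23 + (-5 / 2 + del) * b13
    second_four := by
      linear_combination (3 + 2 * lam) * a23 + (2 - 1 / 2 * del) * a24 + (3 / 2 + 3 / 2 * lam)
      * a34 + (-7 / 2 + del) * b24
    third_three := by
      linear_combination (-3 - 9 * lam - 9 * lam ^ 2) * a01 + (-6 + 9 / 2 * del - 6 * lam + 9 /
      2 * lam * del) * a02 + (4 - 3 / 2 * del) * a03 + (-9 * lam - 9 * lam ^ 2) * a12 + (-4 *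
      lam + 3 / 2 * lam * del) * a13 + (-3 * lam - 3 * lam ^ 2) * a23 + (12 - 9 * del + 12 *
      lam - 9 * lam * del) * b02 + (-3 + 3 / 2 * del) * b03 + (8 * lam - 3 * lam * del) * b13
    third_four := by
      linear_combination (-21 - 36 * lam - 18 * lam ^ 2) * a12 + (-21 + 9 * del - 14 * lam + 6
      * lam * del) * a13 + (11 / 2 - 3 / 2 * del) * a14 + (-18 - 48 * lam - 24 * lam ^ 2) * a23
      + (-11 / 2 + 3 / 2 * del - 11 * lam + 3 * lam * del) * a24 + (-6 - 18 * lam - 9 * lam ^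
      2) * a34 + (42 - 18 * del + 28 * lam - 12 * lam * del) * b13 + (-9 / 2 + 3 / 2 * del) *
      b14 + (11 - 3 * del + 22 * lam - 6 * lam * del) * b24
    fourth_four := by
      linear_combination (20 + 76 * lam + 132 * lam ^ 2 + 72 * lam ^ 3) * a01 + (50 - 38 * del
      + 90 * lam - 66 * lam * del + 60 * lam ^ 2 - 36 * lam ^ 2 * del) * a02 + (-30 + 18 * del
      - 20 * lam + 12 * lam * del) * a03 + (20 - 6 * del) * a04 + (134 * lam + 228 * lam ^ 2 +
      108 * lam ^ 3) * a12 + (90 * lam - 36 * lam * del + 60 * lam ^ 2 - 24 * lam ^ 2 * del) *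
      a13 + (-10 * lam + 3 * lam * del) * a14 + (96 * lam + 172 * lam ^ 2 + 72 * lam ^ 3) * a23
      + (20 * lam - 7 * lam * del + 20 * lam ^ 2 - 6 * lam ^ 2 * del) * a24 + (24 * lam + 48 *
      lam ^ 2 + 18 * lam ^ 3) * a34 + (-100 + 76 * del - 180 * lam + 132 * lam * del - 120 *
      lam ^ 2 + 72 * lam ^ 2 * del) * b02 + (30 - 18 * del + 20 * lam - 12 * lam * del) * b03 +
      (-10 + 4 * del) * b04 + (-180 * lam + 72 * lam * del - 120 * lam ^ 2 + 48 * lam ^ 2 *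
      del) * b13 + (10 * lam - 3 * lam * del) * b14 + (-40 * lam + 14 * lam * del - 40 * lam ^
      2 + 12 * lam ^ 2 * del) * b24 }

/-- A local symmetry is determined by its diagonal and superdiagonal entries. -/
lemma eq_zero_of_mem_symMat (hC : C ∈ symMat lam mu) (hx : ∀ i, C i i = 0) (y₁ : C 0 1 = 0)
    (y₂ : C 1 2 = 0) (y₃ : C 2 3 = 0) (y₄ : C 3 4 = 0) : C = 0 := by
  obtain ⟨hup, h1, h2⟩ := mem_symMat.1 hC
  generalize mu - lam = del at h1 h2
  have a01 := h1 0 1 (by decide)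
  have a02 := h1 0 2 (by decide)
  have a03 := h1 0 3 (by decide)
  have a04 := h1 0 4 (by decide)
  have a12 := h1 1 2 (by decide)
  have a13 := h1 1 3 (by decide)
  have a14 := h1 1 4 (by decide)
  have a23 := h1 2 3 (by decide)
  have a24 := h1 2 4 (by decide)
  have a34 := h1 3 4 (by decide)
  have b02 := h2 0 2 (by decide)
  have b03 := h2 0 3 (by decide)
  have b04 := h2 0 4 (by decide)
  have b13 := h2 1 3 (by decide)
  have b14 := h2 1 4 (by decide)
  have b24 := h2 2 4 (by decide)
  rw [relOne_0_1] at a01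
  rw [relOne_0_2] at a02
  rw [relOne_0_3] at a03
  rw [relOne_0_4] at a04
  rw [relOne_1_2] at a12
  rw [relOne_1_3] at a13
  rw [relOne_1_4] at a14
  rw [relOne_2_3] at a23
  rw [relOne_2_4] at a24
  rw [relOne_3_4] at a34
  rw [relTwo_0_2] at b02
  rw [relTwo_0_3] at b03
  rw [relTwo_0_4] at b04
  rw [relTwo_1_3] at b13
  rw [relTwo_1_4] at b14
  rw [relTwo_2_4] at b24
  have x0 := hx 0
  have x1 := hx 1
  have x2 := hx 2
  have x3 := hx 3
  have x4 := hx 4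
  -- For `j ≥ i + 2` a fixed combination of `relOne i j` and `relTwo i j` has coefficient `1` at `C
  -- i j`, independently of the weights; here it is `2 (2 - del) - (3 - 2 del) = 1`. So the entry is
  -- determined by those nearer to the diagonal.
  have c02 : C 0 2 = 0 := by
    linear_combination (-1) * a02 + (2) * b02 + (-2 * lam) * x0 + (-1 - 2 * lam) * y₁ + (-lam)
    * y₂ + (2 * lam) * x2
  have c13 : C 1 3 = 0 := by
    linear_combination (-1) * a13 + (2) * b13 + (-2 - 6 * lam) * x1 + (-3 - 3 * lam) * y₂ + (-1
    - 2 * lam) * y₃ + (2 + 6 * lam) * x3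
  have c24 : C 2 4 = 0 := by
    linear_combination (-1) * a24 + (2) * b24 + (-8 - 12 * lam) * x2 + (-6 - 4 * lam) * y₃ +
    (-3 - 3 * lam) * y₄ + (8 + 12 * lam) * x4
  have c03 : C 0 3 = 0 := by
    linear_combination (3 / 2 + 3 / 2 * lam) * a02 + (-1 / 2) * a03 + (1 / 2 * lam) * a13 + (-3
    - 3 * lam) * b02 + (1 / 2) * b03 + (-lam) * b13 + (3 * lam + 3 * lam ^ 2) * x0 + (1 + 3 *
    lam + 3 * lam ^ 2) * y₁ + (lam + 3 * lam ^ 2) * x1 + (3 * lam + 3 * lam ^ 2) * y₂ + (-3 *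
    lam - 3 * lam ^ 2) * x2 + (lam + lam ^ 2) * y₃ + (-lam - 3 * lam ^ 2) * x3
  have c14 : C 1 4 = 0 := by
    linear_combination (3 + 2 * lam) * a13 + (-1 / 2) * a14 + (1 / 2 + lam) * a24 + (-6 - 4 *
    lam) * b13 + (1 / 2) * b14 + (-1 - 2 * lam) * b24 + (6 + 22 * lam + 12 * lam ^ 2) * x1 + (7
    + 12 * lam + 6 * lam ^ 2) * y₂ + (4 + 14 * lam + 12 * lam ^ 2) * x2 + (6 + 16 * lam + 8 *
    lam ^ 2) * y₃ + (-6 - 22 * lam - 12 * lam ^ 2) * x3 + (2 + 6 * lam + 3 * lam ^ 2) * y₄ +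
    (-4 - 14 * lam - 12 * lam ^ 2) * x4
  have c04 : C 0 4 = 0 := by
    linear_combination (-19 / 10 - 33 / 10 * lam - 9 / 5 * lam ^ 2) * a02 + (9 / 10 + 3 / 5 *
    lam) * a03 + (-3 / 10) * a04 + (-9 / 5 * lam - 6 / 5 * lam ^ 2) * a13 + (3 / 20 * lam) *
    a14 + (-7 / 20 * lam - 3 / 10 * lam ^ 2) * a24 + (19 / 5 + 33 / 5 * lam + 18 / 5 * lam ^ 2)
    * b02 + (-9 / 10 - 3 / 5 * lam) * b03 + (1 / 5) * b04 + (18 / 5 * lam + 12 / 5 * lam ^ 2) *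
    b13 + (-3 / 20 * lam) * b14 + (7 / 10 * lam + 3 / 5 * lam ^ 2) * b24 + (-19 / 5 * lam - 33
    / 5 * lam ^ 2 - 18 / 5 * lam ^ 3) * x0 + (-1 - 19 / 5 * lam - 33 / 5 * lam ^ 2 - 18 / 5 *
    lam ^ 3) * y₁ + (-18 / 5 * lam - 66 / 5 * lam ^ 2 - 36 / 5 * lam ^ 3) * x1 + (-67 / 10 *
    lam - 57 / 5 * lam ^ 2 - 27 / 5 * lam ^ 3) * y₂ + (lam) * x2 + (-24 / 5 * lam - 43 / 5 *
    lam ^ 2 - 18 / 5 * lam ^ 3) * y₃ + (18 / 5 * lam + 66 / 5 * lam ^ 2 + 36 / 5 * lam ^ 3) *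
    x3 + (-6 / 5 * lam - 12 / 5 * lam ^ 2 - 9 / 10 * lam ^ 3) * y₄ + (14 / 5 * lam + 33 / 5 *
    lam ^ 2 + 18 / 5 * lam ^ 3) * x4
  ext i j
  rcases lt_or_ge j i with hij | hij
  · exact hup i j hij
  · fin_cases i <;> fin_cases j <;> first | assumption | exact absurd hij (by decide)

end ReducedSystem

/-! ### Solving the reduced system. -/

namespace ReducedSystem

variable {𝕜 : Type*} [RCLike 𝕜] {lam del a₁ a₂ a₃ a₄ y₁ y₂ y₃ y₄ : 𝕜}

/-- The compatibility conditions at distance two factor as a polynomial in the weights times the sum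
of two consecutive differences. Hence generically the diagonal entries alternate, as they do for the
identity and the formal adjoint. Note that `del - 1 + lam` is `mu - 1`. -/
lemma add_one_two (h : ReducedSystem lam del a₁ a₂ a₃ a₄ y₁ y₂ y₃ y₄) (h0 : lam ≠ 0)
    (h1 : del - 1 + lam ≠ 0) : a₂ = -a₁ := by
  have h2 : (lam * (del - 1 + lam)) * (a₁ + a₂) = 0 := by linear_combination h.second_two
  exact eq_neg_of_add_eq_zero_right ((mul_eq_zero.1 h2).resolve_left (mul_ne_zero h0 h1))

lemma add_two_three (h : ReducedSystem lam del a₁ a₂ a₃ a₄ y₁ y₂ y₃ y₄)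
    (h3 : (3 * lam + 1) * (del - 1) + 3 * lam ^ 2 ≠ 0) : a₃ = -a₂ := by
  have h2 : ((3 * lam + 1) * (del - 1) + 3 * lam ^ 2) * (a₂ + a₃) = 0 := by
    linear_combination h.second_three
  exact eq_neg_of_add_eq_zero_right ((mul_eq_zero.1 h2).resolve_left h3)

lemma add_three_four (h : ReducedSystem lam del a₁ a₂ a₃ a₄ y₁ y₂ y₃ y₄)
    (h4 : 6 * lam * (del - 1 + lam) + 4 * del - 5 ≠ 0) : a₄ = -a₃ := by
  have h2 : (6 * lam * (del - 1 + lam) + 4 * del - 5) * (a₃ + a₄) = 0 := by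
    linear_combination h.second_four
  exact eq_neg_of_add_eq_zero_right ((mul_eq_zero.1 h2).resolve_left h4)

/-- If the first four diagonal entries alternate, the condition at distance three becomes `lam (mu -
1) (lam + mu - 1) a₁ = 0`. -/
lemma first_diffs_eq_zero (h : ReducedSystem lam del a₁ a₂ a₃ a₄ y₁ y₂ y₃ y₄) (h0 : lam ≠ 0)
    (h1 : del - 1 + lam ≠ 0) (h2 : del - 1 + 2 * lam ≠ 0)
    (h3 : (3 * lam + 1) * (del - 1) + 3 * lam ^ 2 ≠ 0) : a₁ = 0 ∧ a₂ = 0 ∧ a₃ = 0 := by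
  have e2 := h.add_one_two h0 h1
  have e3 := h.add_two_three h3
  rw [e2, neg_neg] at e3
  rw [e2, e3] at h
  have key : (lam * (del - 1 + lam) * (del - 1 + 2 * lam)) * a₁ = 0 := by
    linear_combination (-1 + 4 / 3 * del - 1 / 3 * del ^ 2) * h.third_three + (2 / 3 * lam - 2
    / 3 * lam * del + 1 / 3 * lam ^ 2 - 1 / 3 * lam ^ 2 * del) * h.first_three + (-3 * lam ^ 2
    + lam ^ 2 * del) * h.first_one
  have h4 := (mul_eq_zero.1 key).resolve_left (mul_ne_zero (mul_ne_zero h0 h1) h2)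
  rw [e2, e3, h4]
  simp

/-- If all diagonal entries agree, then the system has only few solutions. -/
lemma superdiag_eq_zero (h : ReducedSystem lam del 0 0 0 0 y₁ y₂ y₃ y₄) (h0 : lam ≠ 0)
    (h1 : del - 1 + lam ≠ 0) : y₁ = 0 ∧ y₃ = 0 ∧ y₄ = 0 ∧
      (¬ (2 * lam ^ 2 + 2 * lam + 1 = 0 ∧ del = 2) → y₂ = 0) := by
  have e1 := h.first_one
  have e2 := h.first_two
  have e3 := h.first_three
  have e4 := h.first_four
  have r3 := h.third_three
  have r4 := h.third_four
  have r := h.fourth_four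
  rw [mul_zero, mul_eq_zero, sub_eq_zero] at e1 e2 e3 e4
  simp only [mul_zero, zero_add] at r3 r4 r
  -- With equal diagonal entries `(del - j) y_j = 0`. So `y_j` can survive only for `del = j`, when
  -- the order `j` coefficient has weight `0` and its derivative weight `1`, like the coefficient of
  -- order `j - 1`.
  by_cases d1 : del = 1
  · subst d1
    norm_num at e2 e3 e4
    subst e2 e3 e4
    refine ⟨?_, rfl, rfl, fun _ => rfl⟩
    simpa [h0] using r3
  replace e1 := e1.resolve_left d1
  subst e1
  by_cases d2 : del = 2
  · subst d2
    norm_num at e3 e4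
    subst e3 e4
    refine ⟨rfl, rfl, rfl, fun h' => ?_⟩
    -- This is the source of the non-real exceptional pairs.
    have h2 : (3 * (2 * lam ^ 2 + 2 * lam + 1)) * y₂ = 0 := by linear_combination r4
    refine (mul_eq_zero.1 h2).resolve_left fun h3 => h' ⟨?_, rfl⟩
    linear_combination h3 / 3
  replace e2 := e2.resolve_left d2
  subst e2
  by_cases d3 : del = 3
  · subst d3
    norm_num at e4
    subst e4
    refine ⟨rfl, ?_, rfl, fun _ => rfl⟩
    have h2 : (lam * (3 - 1 + lam)) * y₃ = 0 := by linear_combination -r3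
    exact (mul_eq_zero.1 h2).resolve_left (mul_ne_zero h0 h1)
  replace e3 := e3.resolve_left d3
  subst e3
  refine ⟨rfl, rfl, ?_, fun _ => rfl⟩
  by_contra hy
  -- A nonzero `y₄` needs a common root of two quadratics, one from distance three and one from
  -- distance four; their difference of multiples gives `lam = -7/3`, which is not a root.
  have h2 : 1 + 3 * lam + lam ^ 2 = 0 := by
    have : (1 + 3 * lam + lam ^ 2) * y₄ = 0 := by linear_combination (-1 / 3) * r4
    exact (mul_eq_zero.1 this).resolve_right hy
  have h3 : 13 + 21 * lam + 6 * lam ^ 2 = 0 := by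
    have : (lam * (13 + 21 * lam + 6 * lam ^ 2)) * y₄ = 0 := by linear_combination r / 2
    exact (mul_eq_zero.1 ((mul_eq_zero.1 this).resolve_right hy)).resolve_left h0
  have h4 : (5 : 𝕜) = 0 := by
    have h5 : lam = -7 / 3 := by linear_combination (h3 - 6 * h2) / 3
    subst h5
    linear_combination (-9) * h2
  norm_num at h4

/-- When the relation between `a₂` and `a₃` degenerates, the condition at distance three still
controls `a₃`, up to the factor `3 del + 3 lam - 5`. On the degenerate curve this factor vanishes
only at `lam = -2/3`, `del = 7/3`, which lies on the excluded line `lam + mu = 1`. -/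
lemma third_diff_eq_zero (h : ReducedSystem lam del a₁ a₂ a₃ a₄ y₁ y₂ y₃ y₄) (h0 : lam ≠ 0)
    (h1 : del - 1 + lam ≠ 0) (h2 : del - 1 + 2 * lam ≠ 0)
    (h3 : (3 * lam + 1) * (del - 1) + 3 * lam ^ 2 = 0) : a₃ = 0 := by
  have e2 := h.add_one_two h0 h1
  rw [e2] at h
  have d1 : del - 1 ≠ 0 := fun d1 => by
    rw [d1, mul_zero, zero_add] at h3
    simp [h0] at h3
  have d2 : 3 * del + 3 * lam - 5 ≠ 0 := fun d2 => by
    have hl : lam = -2 / 3 := by linear_combination h3 - (lam + 1 / 3) * d2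
    refine h2 ?_
    linear_combination d2 / 3 + hl
  have key : (lam * (del - 1) * (3 * del + 3 * lam - 5)) * a₃ = 0 := by
    linear_combination (-3 + 4 * del - del ^ 2) * h.third_three + (2 * lam - 2 * lam * del +
    lam ^ 2 - lam ^ 2 * del) * h.first_three + (-8 * lam * a₃ + 6 * lam * a₁ + 11 * lam * del *
    a₃ - 11 * lam * del * a₁ - 3 * lam * del ^ 2 * a₃ + 3 * lam * del ^ 2 * a₁) * h3 + (-9 *
    lam ^ 2 + 3 * lam ^ 2 * del) * h.first_one
  exact (mul_eq_zero.1 key).resolve_left (mul_ne_zero (mul_ne_zero h0 d1) d2)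

/-- The generic part of the classification. -/
lemma diffs_eq_zero (h : ReducedSystem lam del a₁ a₂ a₃ a₄ y₁ y₂ y₃ y₄) (h0 : lam ≠ 0)
    (h1 : del - 1 + lam ≠ 0) (h2 : del - 1 + 2 * lam ≠ 0) :
    a₁ = 0 ∧ a₂ = 0 ∧ a₃ = 0 ∧ a₄ = 0 := by
  by_cases h3 : (3 * lam + 1) * (del - 1) + 3 * lam ^ 2 = 0
  · have e2 := h.add_one_two h0 h1
    have e3 := h.third_diff_eq_zero h0 h1 h2 h3
    rw [e2, e3] at h
    by_cases h4 : 6 * lam * (del - 1 + lam) + 4 * del - 5 = 0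
    · have hd : del = 3 / 2 := by linear_combination h4 / 2 - h3
      rw [hd] at h h3
      have e1 : a₁ = 0 := by
        linear_combination (-3 / 5 - 3 / 20 * lam) * h.third_four + (-18 / 5 - 69 / 5 * lam -
        171 / 10 * lam ^ 2) * h.first_two + (-537 / 20 - 1671 / 20 * lam - 1431 / 10 * lam ^ 2)
        * h.first_one + (111 / 40 + 483 / 40 * lam + 189 / 10 * lam ^ 2) * h.first_four + (411
        / 40 * y₄ + 537 / 20 * y₁ + 213 / 10 * a₄ + 82 / 5 * a₁ - 33 / 20 * lam * y₄ - 2 * lam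
        * y₃ + 33 / 10 * lam * y₂ + 6 * lam * y₁ - 54 / 5 * lam ^ 2 * a₄ + 99 / 5 * lam ^ 2 *
        a₁) * h3 + (34 / 3 * lam + 12 * lam ^ 2) * h.first_three + (3 / 8) * h.fourth_four
      have e4 : a₄ = 0 := by
        linear_combination (3 / 4 - 3 / 4 * lam + 45 / 2 * lam ^ 2) * h.first_one + (-21 / 40 -
        9 / 40 * lam - 9 / 2 * lam ^ 2) * h.first_four + (9 / 4 * lam) * h.third_four + (34 / 3
        * lam + 12 * lam ^ 2) * h.first_three + (3 * lam + 9 / 2 * lam ^ 2) * h.first_two + (3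
        / 8) * h.fourth_four + (-21 / 8 * y₄ - 3 / 4 * y₁ - 43 / 10 * a₄ + 3 / 4 * lam * y₄ - 2
        * lam * y₃ - 3 / 2 * lam * y₂ + 6 * lam * y₁ + 18 * lam ^ 2 * a₄ - 9 * lam ^ 2 * a₁) *
        h3
      rw [e2, e3, e1, e4]
      simp
    · have e4 := h.add_three_four h4
      rw [neg_zero] at e4
      rw [e4] at h
      have key : (lam + (del + lam) - 1) * a₁ + 3 * (1 + 3 * lam + lam ^ 2) * (del - 2) * y₄ = 0 := by
        linear_combination (2 - del) * h.third_four + (3 + 6 * lam + 6 * lam ^ 2) * h.first_two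
        + (-38 * a₁ + 18 * del * a₁ - 28 * lam * a₁ + 12 * lam * del * a₁) * h3
      -- Either `y₄ = 0` or `del = 4`; in the latter case the equation of the degenerate curve is `3
      -- (1 + 3 lam + lam²) = 0`.
      have hy : (1 + 3 * lam + lam ^ 2) * y₄ = 0 := by
        have e5 := h.first_four
        rw [mul_zero, mul_eq_zero] at e5
        rcases e5 with e5 | e5
        · have : 1 + 3 * lam + lam ^ 2 = 0 := by
            linear_combination h3 / 3 - (3 * lam + 1) / 3 * e5
          rw [this, zero_mul]
        · rw [e5, mul_zero]
      have e1 : (del - 1 + 2 * lam) * a₁ = 0 := by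
        linear_combination key - 3 * (del - 2) * hy
      rw [e2, e3, e4, (mul_eq_zero.1 e1).resolve_left h2]
      simp
  · obtain ⟨e1, e2, e3⟩ := h.first_diffs_eq_zero h0 h1 h2 h3
    rw [e1, e2, e3] at h
    refine ⟨e1, e2, e3, ?_⟩
    by_cases h4 : 6 * lam * (del - 1 + lam) + 4 * del - 5 = 0
    · by_cases d2 : del = 2
      · rw [d2] at h h4
        -- These are the weights where `y₂` may be nonzero, so `a₄ = 0` needs the condition at
        -- distance four as well.
        have hp : 2 * lam ^ 2 + 2 * lam + 1 = 0 := by linear_combination h4 / 3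
        linear_combination (-3 / 2 + lam) * h.first_four + (-2 / 5 + 4 / 5 * lam) *
        h.third_four + (24 / 5 + 56 / 5 * lam) * h.first_one + (-24 / 5 - 36 / 5 * lam) *
        h.second_four + (2 / 5) * h.fourth_four + (48 / 5 + 32 / 5 * lam) * h.third_three +
        (-21 / 5 * y₄ + 6 / 5 * y₂ - 24 / 5 * y₁ - 6 / 5 * lam * y₄ + 12 / 5 * lam * y₂) * hp
      · have key : ((del - 2) * (del - 1 + 2 * lam)) * a₄ = 0 := by
          linear_combination (8 / 5 - 6 / 5 * del + 1 / 5 * del ^ 2) * h.third_four + (12 / 5 -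
          3 / 5 * del + 24 / 5 * lam - 6 / 5 * lam * del + 24 / 5 * lam ^ 2 - 6 / 5 * lam ^ 2 *
          del) * h.first_two + (-6 / 5 + 3 / 5 * del - 18 / 5 * lam + 9 / 5 * lam * del - 6 / 5
          * lam ^ 2 + 3 / 5 * lam ^ 2 * del) * h.first_four + (18 / 5 * a₄ - 3 * del * a₄ + 3 /
          5 * del ^ 2 * a₄ + 44 / 5 * lam * a₄ - 34 / 5 * lam * del * a₄ + 6 / 5 * lam * del ^
          2 * a₄) * h4
        exact (mul_eq_zero.1 key).resolve_left (mul_ne_zero (sub_ne_zero.2 d2) h2)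
    · simpa using h.add_three_four h4

/-- The classification on the line of self-dual weights. -/
lemma eq_zero_of_self_dual (h : ReducedSystem lam (1 - 2 * lam) 0 a₂ a₃ a₄ y₁ y₂ y₃ y₄)
    (h0 : lam ≠ 0) (h1 : lam ≠ -2 / 3) :
    a₂ = 0 ∧ a₃ = 0 ∧ a₄ = 0 ∧ y₁ = 0 ∧ y₂ = 0 ∧ y₃ = 0 ∧ y₄ = 0 := by
  have e2 := h.add_one_two h0 (by
    intro h'
    exact h0 (by linear_combination -h'))
  -- On the line `lam + mu = 1` the factor of `a₂ + a₃` is `-lam (3 lam + 2)`, which singles out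
  -- `lam = -2/3`.
  have e3 := h.add_two_three (by
    intro h'
    have h2 : lam * (3 * lam + 2) = 0 := by linear_combination -h'
    refine h1 ?_
    linear_combination ((mul_eq_zero.1 h2).resolve_left h0) / 3)
  rw [neg_zero] at e2
  rw [e2, neg_zero] at e3
  rw [e2, e3] at h
  have e4 : a₄ = 0 := by
    linear_combination (49 / 10 + 351 / 10 * lam + 417 / 10 * lam ^ 2 + 54 / 5 * lam ^ 3) *
    h.first_four + (-147 / 10 - 201 / 5 * lam - 51 * lam ^ 2 - 108 / 5 * lam ^ 3) * h.first_two
    + (-54 / 5 - 57 * lam - 72 * lam ^ 2 - 108 / 5 * lam ^ 3) * h.second_four + (248 / 5 * lam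
    + 268 / 5 * lam ^ 2 + 72 / 5 * lam ^ 3) * h.first_three + (-22 / 5 - 258 / 5 * lam - 96 *
    lam ^ 2 - 216 / 5 * lam ^ 3) * h.first_one + (-49 / 10 - 23 / 5 * lam) * h.third_four + (16
    / 5) * h.third_three + (11 / 5 + 9 / 5 * lam) * h.fourth_four
  have d1 : y₁ = 0 := by
    have : lam * y₁ = 0 := by linear_combination (-1 / 2) * h.first_one
    exact (mul_eq_zero.1 this).resolve_left h0
  rw [e4, d1] at h
  have d2 : y₂ = 0 := by
    linear_combination (-2 / 3) * h.first_four + (1 + 2 * lam) * h.first_two + (2 / 3 + 4 / 3 *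
    lam) * h.third_four + (8 + 16 / 3 * lam) * h.third_three + (1 / 3) * h.fourth_four
  have d3 : y₃ = 0 := by
    linear_combination (-1 / 2 - 1 / 2 * lam) * h.first_three + (1) * h.third_three
  have d4 : y₄ = 0 := by
    linear_combination (-1 / 3 - 2 / 5 * lam) * h.first_four + (-16 / 5 - 32 / 15 * lam) *
    h.third_three + (-8 / 15 * lam) * h.third_four + (-2 / 15) * h.fourth_four
  exact ⟨e2, e3, e4, d1, d2, d3, d4⟩

/-- The classification for operators on functions. -/
lemma eq_zero_of_lam_eq_zero (h : ReducedSystem 0 del a₁ a₂ a₃ a₄ y₁ y₂ y₃ y₄)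
    (h0 : del ≠ 0) (h1 : del ≠ 1) (h2 : del ≠ 5 / 4) :
    a₂ = 0 ∧ a₃ = 0 ∧ a₄ = 0 ∧ y₁ = 0 ∧ y₂ = 0 ∧ y₄ = 0 ∧ (del ≠ 3 → y₃ = 0) := by
  have h1' : del - 1 ≠ 0 := sub_ne_zero.2 h1
  have h2' : 4 * del - 5 ≠ 0 := fun h' => h2 (by linear_combination h' / 4)
  -- The roots are the exceptional weights `mu = 0, 1, 5/4`. The fourth one, `mu = 3`, comes from
  -- `(del - 3) y₃ = 0` below.
  have e2 : (del * (del - 1) * (4 * del - 5)) * a₂ = 0 := by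
    linear_combination (-10 + 13 * del - 4 * del ^ 2) * h.first_four + (20 - 21 * del + 4 * del
    ^ 2) * h.first_two + (100 / 3 - 54 * del + 80 / 3 * del ^ 2 - 4 * del ^ 3) * h.second_four
    + (260 - 398 * del + 182 * del ^ 2 - 24 * del ^ 3) * h.second_three + (40 / 3 - 62 / 3 *
    del + 29 / 3 * del ^ 2 - 4 / 3 * del ^ 3) * h.third_four
  replace e2 := (mul_eq_zero.1 e2).resolve_left (mul_ne_zero (mul_ne_zero h0 h1') h2')
  rw [e2] at h
  have e3 : (del - 1) * a₃ = 0 := by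
    linear_combination (1) * h.second_three
  replace e3 := (mul_eq_zero.1 e3).resolve_left h1'
  rw [e3] at h
  have e4 : (4 * del - 5) * a₄ = 0 := by
    linear_combination (1) * h.second_four
  replace e4 := (mul_eq_zero.1 e4).resolve_left h2'
  rw [e4] at h
  have d1 : (del - 1) * y₁ = 0 := by
    linear_combination (1) * h.first_one
  have d2 : y₂ = 0 := by
    linear_combination (-1 / 2) * h.first_four + (1 / 2) * h.first_two + (2 / 3 - 1 / 6 * del)
    * h.third_four
  have d4 : y₄ = 0 := by
    linear_combination (-1 / 2) * h.first_four + (1 / 2) * h.first_two + (1 / 3 - 1 / 6 * del)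
    * h.third_four
  have d3 : (del - 3) * y₃ = 0 := by
    linear_combination (1) * h.first_three
  exact ⟨e2, e3, e4, (mul_eq_zero.1 d1).resolve_left h1', d2, d4,
    fun h3 => (mul_eq_zero.1 d3).resolve_left (sub_ne_zero.2 h3)⟩

/-- This and the next three lemmas treat special weights: setting the listed unknowns to zero forces
all the others to vanish. They bound the algebra from above, and the explicit matrices below attain
the bound. -/
lemma eq_zero_of_zero_zero (h : ReducedSystem (0 : 𝕜) 0 0 0 a₃ a₄ y₁ y₂ y₃ y₄) :
    a₃ = 0 ∧ a₄ = 0 ∧ y₁ = 0 ∧ y₂ = 0 ∧ y₃ = 0 ∧ y₄ = 0 := by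
  refine ⟨?_, ?_, ?_, ?_, ?_, ?_⟩
  · linear_combination (-1) * h.second_three
  · linear_combination (-1 / 5) * h.second_four + (1) * h.second_three
  · linear_combination (-1) * h.first_one
  · linear_combination (-1 / 2) * h.first_two
  · linear_combination (-1 / 3) * h.first_three + (1) * h.second_three
  · linear_combination (-1 / 4) * h.first_four + (3 / 10) * h.second_four + (-3 / 2) *
    h.second_three

lemma eq_zero_of_zero_five_fourths (h : ReducedSystem (0 : 𝕜) (5 / 4) 0 0 a₃ a₄ y₁ y₂ y₃ y₄) :
    a₃ = 0 ∧ a₄ = 0 ∧ y₁ = 0 ∧ y₂ = 0 ∧ y₃ = 0 ∧ y₄ = 0 := by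
  refine ⟨?_, ?_, ?_, ?_, ?_, ?_⟩
  · linear_combination (4) * h.second_three
  · linear_combination (12 / 5) * h.first_four + (-44 / 5) * h.first_two + (-11 / 5) *
    h.third_four + (-242 / 5) * h.second_three
  · linear_combination (4) * h.first_one
  · linear_combination (-4 / 3) * h.first_two
  · linear_combination (-4 / 7) * h.first_three + (-48 / 7) * h.second_three
  · linear_combination (-28 / 5) * h.first_four + (96 / 5) * h.first_two + (24 / 5) *
    h.third_four + (528 / 5) * h.second_three

lemma eq_zero_of_zero_one (h : ReducedSystem (0 : 𝕜) 1 0 0 0 a₄ 0 y₂ y₃ y₄) :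
    a₄ = 0 ∧ y₂ = 0 ∧ y₃ = 0 ∧ y₄ = 0 := by
  refine ⟨?_, ?_, ?_, ?_⟩
  · linear_combination (-1) * h.second_four
  · linear_combination (-1) * h.first_two
  · linear_combination (-1 / 2) * h.first_three
  · linear_combination (-1 / 3) * h.first_four + (2) * h.second_four

lemma eq_zero_of_neg_two_thirds (h : ReducedSystem (-2 / 3 : 𝕜) (7 / 3) 0 a₂ 0 a₄ y₁ y₂ y₃ y₄) :
    a₂ = 0 ∧ a₄ = 0 ∧ y₁ = 0 ∧ y₂ = 0 ∧ y₃ = 0 ∧ y₄ = 0 := by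
  refine ⟨?_, ?_, ?_, ?_, ?_, ?_⟩
  · linear_combination (-9 / 4) * h.second_two
  · linear_combination (3 / 5) * h.second_four
  · linear_combination (3 / 4) * h.first_one
  · linear_combination (3) * h.first_two + (9 / 4) * h.second_two
  · linear_combination (-3 / 2) * h.first_three
  · linear_combination (-3 / 5) * h.first_four + (-6 / 5) * h.second_four

end ReducedSystem

/-! ### Explicit solutions of the equations. -/

section Matrices

variable {𝕜 : Type*} [RCLike 𝕜] {lam mu : 𝕜} {C C' : Matrix (Fin 5) (Fin 5) 𝕜}

lemma jetRelations_of {lam' del : 𝕜}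
    (a01 : relOne lam lam' del C 0 1 = 0)
    (a02 : relOne lam lam' del C 0 2 = 0)
    (a03 : relOne lam lam' del C 0 3 = 0)
    (a04 : relOne lam lam' del C 0 4 = 0)
    (a12 : relOne lam lam' del C 1 2 = 0)
    (a13 : relOne lam lam' del C 1 3 = 0)
    (a14 : relOne lam lam' del C 1 4 = 0)
    (a23 : relOne lam lam' del C 2 3 = 0)
    (a24 : relOne lam lam' del C 2 4 = 0)
    (a34 : relOne lam lam' del C 3 4 = 0)
    (b02 : relTwo lam lam' del C 0 2 = 0)
    (b03 : relTwo lam lam' del C 0 3 = 0)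
    (b04 : relTwo lam lam' del C 0 4 = 0)
    (b13 : relTwo lam lam' del C 1 3 = 0)
    (b14 : relTwo lam lam' del C 1 4 = 0)
    (b24 : relTwo lam lam' del C 2 4 = 0) :
    JetRelations lam lam' del C := by
  constructor
  · intro i j hij
    fin_cases i <;> fin_cases j <;> first | assumption | exact absurd hij (by decide)
  · intro i j hij
    fin_cases i <;> fin_cases j <;> first | assumption | exact absurd hij (by decide)

/-- The principal idempotent symmetry on operators on functions, `A ↦ A(1)`. -/
def evalOneMatrix : Matrix (Fin 5) (Fin 5) 𝕜 :=
  !![1, 0, 0, 0, 0; 0, 0, 0, 0, 0; 0, 0, 0, 0, 0; 0, 0, 0, 0, 0; 0, 0, 0, 0, 0]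

/-- The formal adjoint of operators, `A ↦ A*`. -/
def adjointMatrix : Matrix (Fin 5) (Fin 5) 𝕜 :=
  !![1, -1, 1, -1, 1; 0, -1, 2, -3, 4; 0, 0, 1, -3, 6; 0, 0, 0, -1, 4; 0, 0, 0, 0, 1]

/-- An idempotent symmetry for the weights `(0, 5/4)`. -/
def fiveFourthsMatrix : Matrix (Fin 5) (Fin 5) 𝕜 :=
  !![0, 0, 0, 0, 0; 0, 0, 4 / 3, -16 / 7, 64 / 21; 0, 0, 1, -12 / 7, 16 / 7; 0, 0, 0, 0, 0;
    0, 0, 0, 0, 0]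

/-- An idempotent symmetry for the weights `(0, 0)`. -/
def zeroZeroMatrix : Matrix (Fin 5) (Fin 5) 𝕜 :=
  !![0, 0, 0, 0, 0; 0, 1, -1 / 2, 1 / 2, -1 / 2; 0, 0, 0, 1, -3 / 2; 0, 0, 0, 1, -3 / 2;
    0, 0, 0, 0, 0]

/-- A nilpotent symmetry for the weights `(0, 3)`. -/
def zeroThreeMatrix : Matrix (Fin 5) (Fin 5) 𝕜 :=
  !![0, 0, 0, 0, 0; 0, 0, 0, -1, 6; 0, 0, 0, 1, -6; 0, 0, 0, 0, 0; 0, 0, 0, 0, 0]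

/-- An idempotent symmetry for the weights `(-2/3, 5/3)`. -/
def twoThirdsMatrix : Matrix (Fin 5) (Fin 5) 𝕜 :=
  !![0, 1 / 2, -1 / 2, 3 / 2, -5 / 2; 0, 1, -1, 3, -5; 0, 0, 0, 0, 0; 0, 0, 0, 0, 0;
    0, 0, 0, 0, 0]

/-- A nilpotent symmetry for the weights `(lam, lam + 2)` with `2 lam² + 2 lam + 1 = 0`. -/
def nonrealMatrix (lam : 𝕜) : Matrix (Fin 5) (Fin 5) 𝕜 :=
  !![0, 0, -lam, -3 / 2, 2 * lam + 3; 0, 0, 1, -3 - 3 * lam, 4 + 6 * lam; 0, 0, 0, 0, 0;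
    0, 0, 0, 0, 0; 0, 0, 0, 0, 0]

/-- The local symmetries for the weights `(0, 1)`. -/
def zeroOneMatrix (x₀ x₁ x₂ x₃ y : 𝕜) : Matrix (Fin 5) (Fin 5) 𝕜 :=
  !![x₀, y, -y, y, -y;
    0, x₁, x₂ - x₁, x₃ / 2 - 3 / 2 * x₂ + x₁, -x₃ + 2 * x₂ - x₁;
    0, 0, x₂, 3 / 2 * x₃ - 3 / 2 * x₂, -3 * x₃ + 3 * x₂;
    0, 0, 0, x₃, -2 * x₃ + 2 * x₂;
    0, 0, 0, 0, x₂]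

lemma isUpper_evalOneMatrix : IsUpper (evalOneMatrix : Matrix (Fin 5) (Fin 5) 𝕜) := by
  intro i j hij
  fin_cases i <;> fin_cases j <;> first | rfl | exact absurd hij (by decide)

lemma isUpper_adjointMatrix : IsUpper (adjointMatrix : Matrix (Fin 5) (Fin 5) 𝕜) := by
  intro i j hij
  fin_cases i <;> fin_cases j <;> first | rfl | exact absurd hij (by decide)

lemma isUpper_fiveFourthsMatrix : IsUpper (fiveFourthsMatrix : Matrix (Fin 5) (Fin 5) 𝕜) := by
  intro i j hij
  fin_cases i <;> fin_cases j <;> first | rfl | exact absurd hij (by decide)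

lemma isUpper_zeroZeroMatrix : IsUpper (zeroZeroMatrix : Matrix (Fin 5) (Fin 5) 𝕜) := by
  intro i j hij
  fin_cases i <;> fin_cases j <;> first | rfl | exact absurd hij (by decide)

lemma isUpper_zeroThreeMatrix : IsUpper (zeroThreeMatrix : Matrix (Fin 5) (Fin 5) 𝕜) := by
  intro i j hij
  fin_cases i <;> fin_cases j <;> first | rfl | exact absurd hij (by decide)

lemma isUpper_twoThirdsMatrix : IsUpper (twoThirdsMatrix : Matrix (Fin 5) (Fin 5) 𝕜) := by
  intro i j hij
  fin_cases i <;> fin_cases j <;> first | rfl | exact absurd hij (by decide)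

lemma isUpper_nonrealMatrix (lam : 𝕜) : IsUpper (nonrealMatrix lam : Matrix (Fin 5) (Fin 5) 𝕜) := by
  intro i j hij
  fin_cases i <;> fin_cases j <;> first | rfl | exact absurd hij (by decide)

lemma isUpper_zeroOneMatrix (x₀ x₁ x₂ x₃ y : 𝕜) :
    IsUpper (zeroOneMatrix x₀ x₁ x₂ x₃ y : Matrix (Fin 5) (Fin 5) 𝕜) := by
  intro i j hij
  fin_cases i <;> fin_cases j <;> first | rfl | exact absurd hij (by decide)

lemma jetRelations_evalOneMatrix (del : 𝕜) :
    JetRelations 0 0 del (evalOneMatrix : Matrix (Fin 5) (Fin 5) 𝕜) := by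
  apply jetRelations_of
  all_goals
    simp only [relOne_0_1, relOne_0_2, relOne_0_3, relOne_0_4, relOne_1_2, relOne_1_3, relOne_1_4,
    relOne_2_3, relOne_2_4, relOne_3_4, relTwo_0_2, relTwo_0_3, relTwo_0_4, relTwo_1_3,
    relTwo_1_4, relTwo_2_4]
    simp [evalOneMatrix]

lemma jetRelations_adjointMatrix (lam mu : 𝕜) :
    JetRelations lam (1 - mu) (mu - lam) (adjointMatrix : Matrix (Fin 5) (Fin 5) 𝕜) := by
  apply jetRelations_of
  all_goals
    simp only [relOne_0_1, relOne_0_2, relOne_0_3, relOne_0_4, relOne_1_2, relOne_1_3, relOne_1_4,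
    relOne_2_3, relOne_2_4, relOne_3_4, relTwo_0_2, relTwo_0_3, relTwo_0_4, relTwo_1_3,
    relTwo_1_4, relTwo_2_4]
    simp [adjointMatrix]
    try ring

lemma jetRelations_fiveFourthsMatrix :
    JetRelations 0 0 (5 / 4) (fiveFourthsMatrix : Matrix (Fin 5) (Fin 5) 𝕜) := by
  apply jetRelations_of
  all_goals
    simp only [relOne_0_1, relOne_0_2, relOne_0_3, relOne_0_4, relOne_1_2, relOne_1_3, relOne_1_4,
    relOne_2_3, relOne_2_4, relOne_3_4, relTwo_0_2, relTwo_0_3, relTwo_0_4, relTwo_1_3,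
    relTwo_1_4, relTwo_2_4]
    simp [fiveFourthsMatrix]
    try ring

lemma jetRelations_zeroZeroMatrix :
    JetRelations 0 0 0 (zeroZeroMatrix : Matrix (Fin 5) (Fin 5) 𝕜) := by
  apply jetRelations_of
  all_goals
    simp only [relOne_0_1, relOne_0_2, relOne_0_3, relOne_0_4, relOne_1_2, relOne_1_3, relOne_1_4,
    relOne_2_3, relOne_2_4, relOne_3_4, relTwo_0_2, relTwo_0_3, relTwo_0_4, relTwo_1_3,
    relTwo_1_4, relTwo_2_4]
    simp [zeroZeroMatrix]
    try ring

lemma jetRelations_zeroThreeMatrix :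
    JetRelations 0 0 3 (zeroThreeMatrix : Matrix (Fin 5) (Fin 5) 𝕜) := by
  apply jetRelations_of
  all_goals
    simp only [relOne_0_1, relOne_0_2, relOne_0_3, relOne_0_4, relOne_1_2, relOne_1_3, relOne_1_4,
    relOne_2_3, relOne_2_4, relOne_3_4, relTwo_0_2, relTwo_0_3, relTwo_0_4, relTwo_1_3,
    relTwo_1_4, relTwo_2_4]
    simp [zeroThreeMatrix]
    try ring

lemma jetRelations_twoThirdsMatrix :
    JetRelations (-2 / 3) (-2 / 3) (7 / 3) (twoThirdsMatrix : Matrix (Fin 5) (Fin 5) 𝕜) := by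
  apply jetRelations_of
  all_goals
    simp only [relOne_0_1, relOne_0_2, relOne_0_3, relOne_0_4, relOne_1_2, relOne_1_3, relOne_1_4,
    relOne_2_3, relOne_2_4, relOne_3_4, relTwo_0_2, relTwo_0_3, relTwo_0_4, relTwo_1_3,
    relTwo_1_4, relTwo_2_4]
    simp [twoThirdsMatrix]
    try ring

lemma jetRelations_zeroOneMatrix (x₀ x₁ x₂ x₃ y : 𝕜) :
    JetRelations 0 0 1 (zeroOneMatrix x₀ x₁ x₂ x₃ y) := by
  apply jetRelations_of
  all_goals
    simp only [relOne_0_1, relOne_0_2, relOne_0_3, relOne_0_4, relOne_1_2, relOne_1_3, relOne_1_4,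
    relOne_2_3, relOne_2_4, relOne_3_4, relTwo_0_2, relTwo_0_3, relTwo_0_4, relTwo_1_3,
    relTwo_1_4, relTwo_2_4]
    simp [zeroOneMatrix]
    try ring

lemma jetRelations_nonrealMatrix (h : 2 * lam ^ 2 + 2 * lam + 1 = 0) :
    JetRelations lam lam 2 (nonrealMatrix lam) := by
  apply jetRelations_of
  all_goals
    simp only [relOne_0_1, relOne_0_2, relOne_0_3, relOne_0_4, relOne_1_2, relOne_1_3, relOne_1_4,
    relOne_2_3, relOne_2_4, relOne_3_4, relTwo_0_2, relTwo_0_3, relTwo_0_4, relTwo_1_3,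
    relTwo_1_4, relTwo_2_4]
    simp [nonrealMatrix]
    try grind

end Matrices

/-! ### The algebras of local symmetries. -/

section LocalSymmetries

variable {𝕜 : Type*} [RCLike 𝕜] {lam mu : 𝕜} {C C' : Matrix (Fin 5) (Fin 5) 𝕜}

lemma IsUpper.mul_apply_self (h : IsUpper C) (h' : IsUpper C') (i : Fin 5) :
    (C * C') i i = C i i * C' i i := by
  rw [Matrix.mul_apply, Finset.sum_eq_single i]
  · intro k _ hk
    rcases lt_or_gt_of_ne hk with hk | hk
    · rw [h i k hk, zero_mul]
    · rw [h' k i hk, mul_zero]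
  · simp

lemma IsUpper.mul_apply_succ (h : IsUpper C) (h' : IsUpper C') {i j : Fin 5}
    (hij : (j : ℕ) = i + 1) : (C * C') i j = C i i * C' i j + C i j * C' j j := by
  have hne : i ≠ j := by
    rintro rfl
    omega
  rw [Matrix.mul_apply, ← Finset.sum_subset (Finset.subset_univ {i, j}), Finset.sum_pair hne]
  intro k _ hk
  simp only [Finset.mem_insert, Finset.mem_singleton, not_or, Fin.ext_iff] at hk
  rcases lt_or_ge k i with hk' | hk'
  · rw [h i k hk', zero_mul]
  · rw [h' k j (Fin.lt_def.2 (by have := Fin.le_def.1 hk'; omega)), mul_zero]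

lemma mem_symMat_of {del : 𝕜} (hC : IsUpper C) (hdel : mu - lam = del)
    (h : JetRelations lam lam del C) : C ∈ symMat lam mu :=
  mem_symMat.2 ⟨hC, hdel ▸ h⟩

/-- Vanishing of a local symmetry can be read off from the diagonal and the superdiagonal. -/
lemma eq_zero_of_diffs (hC : C ∈ symMat lam mu) (h0 : C 0 0 = 0) (h1 : C 0 0 - C 1 1 = 0)
    (h2 : C 1 1 - C 2 2 = 0) (h3 : C 2 2 - C 3 3 = 0) (h4 : C 3 3 - C 4 4 = 0) (y₁ : C 0 1 = 0)
    (y₂ : C 1 2 = 0) (y₃ : C 2 3 = 0) (y₄ : C 3 4 = 0) : C = 0 := by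
  have e1 : C 1 1 = 0 := by linear_combination h0 - h1
  have e2 : C 2 2 = 0 := by linear_combination e1 - h2
  have e3 : C 3 3 = 0 := by linear_combination e2 - h3
  have e4 : C 4 4 = 0 := by linear_combination e3 - h4
  refine eq_zero_of_mem_symMat hC (fun i => ?_) y₁ y₂ y₃ y₄
  fin_cases i <;> assumption

/-- The characters given by diagonal entries. -/
def diagHom (lam mu : 𝕜) {k : ℕ} (ι : Fin k → Fin 5) : symMat lam mu →ₐ[𝕜] (Fin k → 𝕜) :=
  AlgHom.ofLinearMap
    { toFun := fun C t => C.1 (ι t) (ι t)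
      map_add' := fun _ _ => rfl
      map_smul' := fun _ _ => rfl }
    (funext fun t => Matrix.one_apply_eq (ι t))
    fun C C' => funext fun t => C.2.1.mul_apply_self C'.2.1 (ι t)

/-- Triangularity makes each diagonal entry a character; a set of characters that is jointly
faithful and independent identifies the algebra with a power of the field. -/
lemma nonempty_equiv_of_diag {k : ℕ} (ι : Fin k → Fin 5)
    (hinj : ∀ C ∈ symMat lam mu, (∀ t, C (ι t) (ι t) = 0) → C = 0)
    (hsurj : ∀ v : Fin k → 𝕜, ∃ C ∈ symMat lam mu, ∀ t, C (ι t) (ι t) = v t) :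
    Nonempty (symMat lam mu ≃ₐ[𝕜] (Fin k → 𝕜)) := by
  refine ⟨AlgEquiv.ofBijective (diagHom lam mu ι) ⟨(injective_iff_map_eq_zero _).2 ?_, ?_⟩⟩
  · rintro ⟨C, hC⟩ h
    exact Subtype.ext (hinj C hC fun t => congrFun h t)
  · intro v
    obtain ⟨C, hC, h⟩ := hsurj v
    exact ⟨⟨C, hC⟩, funext h⟩

/-- Local symmetries are scalar, for generic weights. -/
lemma symMat_eq_bot (h0 : lam ≠ 0) (h1 : mu ≠ 1) (h2 : lam + mu ≠ 1)
    (h3 : ¬ (2 * lam ^ 2 + 2 * lam + 1 = 0 ∧ mu = lam + 2)) : symMat lam mu = ⊥ := by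
  rw [eq_bot_iff]
  intro C hC
  rw [Algebra.mem_bot]
  refine ⟨C 0 0, ?_⟩
  rw [Algebra.algebraMap_eq_smul_one, eq_comm, ← sub_eq_zero]
  -- Subtracting the scalar normalizes the first diagonal entry to zero, so equal diagonal entries
  -- all vanish.
  have hD : C - C 0 0 • (1 : Matrix (Fin 5) (Fin 5) 𝕜) ∈ symMat lam mu :=
    sub_mem hC (Subalgebra.smul_mem _ (one_mem _) _)
  have h1' : mu - lam - 1 + lam ≠ 0 := fun h => h1 (by linear_combination h)
  have hr := reducedSystem_of_mem hD
  obtain ⟨a1, a2, a3, a4⟩ := hr.diffs_eq_zero h0 h1' fun h => h2 (by linear_combination h)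
  rw [a1, a2, a3, a4] at hr
  obtain ⟨y1, y3, y4, y2⟩ := hr.superdiag_eq_zero h0 h1'
  exact eq_zero_of_diffs hD (by simp) a1 a2 a3 a4 y1
    (y2 fun h => h3 ⟨h.1, by linear_combination h.2⟩) y3 y4

lemma evalOneMatrix_mem (mu : 𝕜) : evalOneMatrix ∈ symMat (0 : 𝕜) mu :=
  mem_symMat_of isUpper_evalOneMatrix rfl (jetRelations_evalOneMatrix _)

/-- For `lam = 0` an operator splits invariantly into `A(1)` and a part that kills constants; for
these weights nothing else can be scaled separately. -/
lemma nonempty_symMat_zero (h0 : mu ≠ 0) (h1 : mu ≠ 1) (h2 : mu ≠ 5 / 4) (h3 : mu ≠ 3) :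
    Nonempty (symMat 0 mu ≃ₐ[𝕜] (Fin 2 → 𝕜)) := by
  refine nonempty_equiv_of_diag ![0, 1] (fun C hC h => ?_) fun v => ?_
  · have x0 : C 0 0 = 0 := h 0
    have x1 : C 1 1 = 0 := h 1
    have hr := reducedSystem_of_mem hC
    rw [sub_zero] at hr
    obtain ⟨a2, a3, a4, y1, y2, y4, y3⟩ := hr.eq_zero_of_lam_eq_zero h0 h1 h2
    exact eq_zero_of_diffs hC x0 (by rw [x0, x1, sub_zero]) a2 a3 a4 y1 y2 (y3 h3) y4
  · refine ⟨v 1 • 1 + (v 0 - v 1) • evalOneMatrix, add_mem (Subalgebra.smul_mem _ (one_mem _) _)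
      (Subalgebra.smul_mem _ (evalOneMatrix_mem mu) _), fun t => ?_⟩
    fin_cases t <;> simp [evalOneMatrix]

/-- On this line the formal adjoint is an involution of the space of operators, with diagonal `1,
-1, 1, -1, 1`; the two factors are its eigenspaces. -/
lemma nonempty_symMat_self_dual (h : lam + mu = 1) (h0 : lam ≠ 0) (h1 : lam ≠ -2 / 3) :
    Nonempty (symMat lam mu ≃ₐ[𝕜] (Fin 2 → 𝕜)) := by
  have hmu : 1 - mu = lam := by linear_combination -h
  have hA : adjointMatrix ∈ symMat lam mu := mem_symMat_of isUpper_adjointMatrix rfl (by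
    have := jetRelations_adjointMatrix lam mu
    rwa [hmu] at this)
  refine nonempty_equiv_of_diag ![0, 1] (fun C hC h => ?_) fun v => ?_
  · have x0 : C 0 0 = 0 := h 0
    have x1 : C 1 1 = 0 := h 1
    have a1 : C 0 0 - C 1 1 = 0 := by rw [x0, x1, sub_zero]
    have hr := reducedSystem_of_mem hC
    rw [a1, show mu - lam = 1 - 2 * lam by linear_combination -hmu] at hr
    obtain ⟨a2, a3, a4, y1, y2, y3, y4⟩ := hr.eq_zero_of_self_dual h0 h1
    exact eq_zero_of_diffs hC x0 a1 a2 a3 a4 y1 y2 y3 y4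
  · refine ⟨((v 0 + v 1) / 2) • 1 + ((v 0 - v 1) / 2) • adjointMatrix,
      add_mem (Subalgebra.smul_mem _ (one_mem _) _) (Subalgebra.smul_mem _ hA _), fun t => ?_⟩
    fin_cases t <;> simp [adjointMatrix] <;> ring

lemma nonempty_symMat_zero_five_fourths :
    Nonempty (symMat (0 : 𝕜) (5 / 4) ≃ₐ[𝕜] (Fin 3 → 𝕜)) := by
  have hM : fiveFourthsMatrix ∈ symMat (0 : 𝕜) (5 / 4) :=
    mem_symMat_of isUpper_fiveFourthsMatrix (sub_zero _) jetRelations_fiveFourthsMatrix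
  refine nonempty_equiv_of_diag ![0, 1, 2] (fun C hC h => ?_) fun v => ?_
  · have x0 : C 0 0 = 0 := h 0
    have x1 : C 1 1 = 0 := h 1
    have x2 : C 2 2 = 0 := h 2
    have a1 : C 0 0 - C 1 1 = 0 := by rw [x0, x1, sub_zero]
    have a2 : C 1 1 - C 2 2 = 0 := by rw [x1, x2, sub_zero]
    have hr := reducedSystem_of_mem hC
    rw [a1, a2, sub_zero] at hr
    obtain ⟨a3, a4, y1, y2, y3, y4⟩ := hr.eq_zero_of_zero_five_fourths
    exact eq_zero_of_diffs hC x0 a1 a2 a3 a4 y1 y2 y3 y4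
  · refine ⟨v 1 • 1 + ((v 0 - v 1) • evalOneMatrix + (v 2 - v 1) • fiveFourthsMatrix),
      add_mem (Subalgebra.smul_mem _ (one_mem _) _)
        (add_mem (Subalgebra.smul_mem _ (evalOneMatrix_mem _) _) (Subalgebra.smul_mem _ hM _)),
      fun t => ?_⟩
    fin_cases t <;> simp [evalOneMatrix, fiveFourthsMatrix]

/-- Operators killing constants have the form `B ∘ d/dx` with `B` of weights `(1, 0)`, a self-dual
pair. The extra idempotent `zeroZeroMatrix` replaces `B` by its self-adjoint part `(B + B*) / 2`. -/
lemma nonempty_symMat_zero_zero : Nonempty (symMat (0 : 𝕜) 0 ≃ₐ[𝕜] (Fin 3 → 𝕜)) := by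
  have hM : zeroZeroMatrix ∈ symMat (0 : 𝕜) 0 :=
    mem_symMat_of isUpper_zeroZeroMatrix (sub_zero _) jetRelations_zeroZeroMatrix
  refine nonempty_equiv_of_diag ![0, 1, 2] (fun C hC h => ?_) fun v => ?_
  · have x0 : C 0 0 = 0 := h 0
    have x1 : C 1 1 = 0 := h 1
    have x2 : C 2 2 = 0 := h 2
    have a1 : C 0 0 - C 1 1 = 0 := by rw [x0, x1, sub_zero]
    have a2 : C 1 1 - C 2 2 = 0 := by rw [x1, x2, sub_zero]
    have hr := reducedSystem_of_mem hC
    rw [a1, a2, sub_zero] at hr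
    obtain ⟨a3, a4, y1, y2, y3, y4⟩ := hr.eq_zero_of_zero_zero
    exact eq_zero_of_diffs hC x0 a1 a2 a3 a4 y1 y2 y3 y4
  · refine ⟨v 2 • 1 + ((v 0 - v 2) • evalOneMatrix + (v 1 - v 2) • zeroZeroMatrix),
      add_mem (Subalgebra.smul_mem _ (one_mem _) _)
        (add_mem (Subalgebra.smul_mem _ (evalOneMatrix_mem _) _) (Subalgebra.smul_mem _ hM _)),
      fun t => ?_⟩
    fin_cases t <;> simp [evalOneMatrix, zeroZeroMatrix]

/-- Besides the adjoint there is a further idempotent with diagonal `0, 1, 0, 0, 0`. So the entries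
at `0`, `1` and `3` are independent, and the others follow. -/
lemma nonempty_symMat_neg_two_thirds :
    Nonempty (symMat (-2 / 3 : 𝕜) (5 / 3) ≃ₐ[𝕜] (Fin 3 → 𝕜)) := by
  have hdel : (5 / 3 : 𝕜) - -2 / 3 = 7 / 3 := by norm_num
  have hM : twoThirdsMatrix ∈ symMat (-2 / 3 : 𝕜) (5 / 3) :=
    mem_symMat_of isUpper_twoThirdsMatrix hdel jetRelations_twoThirdsMatrix
  have hA : adjointMatrix ∈ symMat (-2 / 3 : 𝕜) (5 / 3) :=
    mem_symMat_of isUpper_adjointMatrix rfl (by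
      have := jetRelations_adjointMatrix (-2 / 3 : 𝕜) (5 / 3)
      rwa [show (1 : 𝕜) - 5 / 3 = -2 / 3 by norm_num] at this)
  refine nonempty_equiv_of_diag ![0, 1, 3] (fun C hC h => ?_) fun v => ?_
  · have x0 : C 0 0 = 0 := h 0
    have x1 : C 1 1 = 0 := h 1
    have x3 : C 3 3 = 0 := h 2
    have a1 : C 0 0 - C 1 1 = 0 := by rw [x0, x1, sub_zero]
    have hr := reducedSystem_of_mem hC
    have a2 : C 1 1 - C 2 2 = 0 := by
      have := hr.add_one_two (by norm_num) (by norm_num)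
      rw [this, a1, neg_zero]
    have a3 : C 2 2 - C 3 3 = 0 := by
      rw [x3, sub_zero]
      linear_combination x1 - a2
    rw [a1, a3, hdel] at hr
    obtain ⟨-, a4, y1, y2, y3, y4⟩ := hr.eq_zero_of_neg_two_thirds
    exact eq_zero_of_diffs hC x0 a1 a2 a3 a4 y1 y2 y3 y4
  · refine ⟨((v 0 + v 2) / 2) • 1 + (((v 0 - v 2) / 2) • adjointMatrix +
      (v 1 - v 2) • twoThirdsMatrix),
      add_mem (Subalgebra.smul_mem _ (one_mem _) _)
        (add_mem (Subalgebra.smul_mem _ hA _) (Subalgebra.smul_mem _ hM _)), fun t => ?_⟩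
    fin_cases t <;> simp [adjointMatrix, twoThirdsMatrix] <;> ring

/-- The homomorphism to `𝔞` given by a superdiagonal entry between equal diagonal entries. -/
def algAHom (lam mu : 𝕜) (i j : Fin 5) (hij : (j : ℕ) = i + 1)
    (h : ∀ C ∈ symMat lam mu, C i i = C j j) : symMat lam mu →ₐ[𝕜] AlgA 𝕜 :=
  AlgHom.ofLinearMap
    { toFun := fun C => ⟨!![C.1 i i, 0; C.1 i j, C.1 i i], _, _, rfl⟩
      map_add' := fun C C' => Subtype.ext (by simp)
      map_smul' := fun c C => Subtype.ext (by simp) }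
    (Subtype.ext (by
      have hne : i ≠ j := by
        rintro rfl
        omega
      change !![(1 : Matrix (Fin 5) (Fin 5) 𝕜) i i, 0; (1 : Matrix (Fin 5) (Fin 5) 𝕜) i j,
        (1 : Matrix (Fin 5) (Fin 5) 𝕜) i i] = 1
      rw [Matrix.one_apply_eq, Matrix.one_apply_ne hne, Matrix.one_fin_two]))
    fun C C' => Subtype.ext (by
      change !![(C.1 * C'.1) i i, 0; (C.1 * C'.1) i j, (C.1 * C'.1) i i] =
        !![C.1 i i, 0; C.1 i j, C.1 i i] * !![C'.1 i i, 0; C'.1 i j, C'.1 i i]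
      rw [C.2.1.mul_apply_self C'.2.1, C.2.1.mul_apply_succ C'.2.1 hij, ← h _ C'.2,
        Matrix.mul_fin_two]
      congr! 3 <;> ring_nf)

lemma algAHom_apply (lam mu : 𝕜) {i j : Fin 5} (hij : (j : ℕ) = i + 1)
    (h : ∀ C ∈ symMat lam mu, C i i = C j j) (C : symMat lam mu) :
    (algAHom lam mu i j hij h C).1 = !![C.1 i i, 0; C.1 i j, C.1 i i] := rfl

/-- The diagonal entries from `1` to `4` agree, and since `del = 3` the entry `C 2 3` is free. It
generates the nilpotent part of `AlgA`, while `A ↦ A(1)` gives the separate factor. -/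
lemma nonempty_symMat_zero_three : Nonempty (symMat (0 : 𝕜) 3 ≃ₐ[𝕜] (AlgA 𝕜 × 𝕜)) := by
  have hM : zeroThreeMatrix ∈ symMat (0 : 𝕜) 3 :=
    mem_symMat_of isUpper_zeroThreeMatrix (sub_zero _) jetRelations_zeroThreeMatrix
  have key : ∀ C ∈ symMat (0 : 𝕜) 3, C 1 1 - C 2 2 = 0 ∧ C 2 2 - C 3 3 = 0 ∧ C 3 3 - C 4 4 = 0 ∧
      C 0 1 = 0 ∧ C 1 2 = 0 ∧ C 3 4 = 0 := fun C hC => by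
    have hr := reducedSystem_of_mem hC
    rw [sub_zero] at hr
    obtain ⟨a2, a3, a4, y1, y2, y4, -⟩ :=
      hr.eq_zero_of_lam_eq_zero (by norm_num) (by norm_num) (by norm_num)
    exact ⟨a2, a3, a4, y1, y2, y4⟩
  let F : symMat (0 : 𝕜) 3 →ₐ[𝕜] (AlgA 𝕜 × 𝕜) :=
    (algAHom 0 3 2 3 rfl fun C hC => sub_eq_zero.1 (key C hC).2.1).prod
      ((Pi.evalAlgHom 𝕜 (fun _ : Fin 1 => 𝕜) 0).comp (diagHom 0 3 ![0]))
  refine ⟨AlgEquiv.ofBijective F ⟨(injective_iff_map_eq_zero _).2 ?_, ?_⟩⟩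
  · rintro ⟨C, hC⟩ h
    have h1 : !![C 2 2, 0; C 2 3, C 2 2] = 0 := congrArg (fun p => p.1.1) h
    have x0 : C 0 0 = 0 := congrArg Prod.snd h
    have x2 : C 2 2 = 0 := congrFun (congrFun h1 0) 0
    have y3 : C 2 3 = 0 := congrFun (congrFun h1 1) 0
    obtain ⟨a2, a3, a4, y1, y2, y4⟩ := key C hC
    refine Subtype.ext (eq_zero_of_diffs hC x0 ?_ a2 a3 a4 y1 y2 y3 y4)
    linear_combination x0 - x2 - a2
  · rintro ⟨⟨_, a, b, rfl⟩, c⟩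
    refine ⟨⟨a • 1 + ((c - a) • evalOneMatrix + b • zeroThreeMatrix),
      add_mem (Subalgebra.smul_mem _ (one_mem _) _)
        (add_mem (Subalgebra.smul_mem _ (evalOneMatrix_mem _) _) (Subalgebra.smul_mem _ hM _))⟩,
      Prod.ext (Subtype.ext ?_) ?_⟩
    · refine (algAHom_apply _ _ _ _ _).trans ?_
      simp [evalOneMatrix, zeroThreeMatrix]
    · change (a • 1 + ((c - a) • evalOneMatrix + b • zeroThreeMatrix) :
        Matrix (Fin 5) (Fin 5) 𝕜) 0 0 = c
      simp [evalOneMatrix, zeroThreeMatrix]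

/-- All diagonal entries agree and only `C 1 2` is free. The quadratic equation excludes the lines
`lam = 0`, `mu = 1` and `lam + mu = 1`, so the generic analysis of the diagonal applies. -/
lemma nonempty_symMat_nonreal (h : 2 * lam ^ 2 + 2 * lam + 1 = 0) (hmu : mu = lam + 2) :
    Nonempty (symMat lam mu ≃ₐ[𝕜] AlgA 𝕜) := by
  have hdel : mu - lam = 2 := by rw [hmu]; ring
  have hM : nonrealMatrix lam ∈ symMat lam mu :=
    mem_symMat_of (isUpper_nonrealMatrix lam) hdel (jetRelations_nonrealMatrix h)
  have h0 : lam ≠ 0 := by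
    rintro rfl
    norm_num at h
  have h1 : (2 : 𝕜) - 1 + lam ≠ 0 := fun h' => one_ne_zero (α := 𝕜) (by
    linear_combination h - 2 * lam * h')
  have h2 : (2 : 𝕜) - 1 + 2 * lam ≠ 0 := fun h' => one_ne_zero (α := 𝕜) (by
    linear_combination 2 * h - (1 + 2 * lam) * h')
  have key : ∀ C ∈ symMat lam mu, C 0 0 - C 1 1 = 0 ∧ C 1 1 - C 2 2 = 0 ∧ C 2 2 - C 3 3 = 0 ∧
      C 3 3 - C 4 4 = 0 ∧ C 0 1 = 0 ∧ C 2 3 = 0 ∧ C 3 4 = 0 := fun C hC => by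
    have hr := reducedSystem_of_mem hC
    rw [hdel] at hr
    obtain ⟨a1, a2, a3, a4⟩ := hr.diffs_eq_zero h0 h1 h2
    rw [a1, a2, a3, a4] at hr
    obtain ⟨y1, y3, y4, -⟩ := hr.superdiag_eq_zero h0 h1
    exact ⟨a1, a2, a3, a4, y1, y3, y4⟩
  refine ⟨AlgEquiv.ofBijective (algAHom lam mu 1 2 rfl fun C hC =>
    sub_eq_zero.1 (key C hC).2.1) ⟨(injective_iff_map_eq_zero _).2 ?_, ?_⟩⟩
  · rintro ⟨C, hC⟩ h
    have h1 : !![C 1 1, 0; C 1 2, C 1 1] = 0 := congrArg Subtype.val h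
    have x1 : C 1 1 = 0 := congrFun (congrFun h1 0) 0
    have y2 : C 1 2 = 0 := congrFun (congrFun h1 1) 0
    obtain ⟨a1, a2, a3, a4, y1, y3, y4⟩ := key C hC
    refine Subtype.ext (eq_zero_of_diffs hC ?_ a1 a2 a3 a4 y1 y2 y3 y4)
    linear_combination x1 + a1
  · rintro ⟨_, a, b, rfl⟩
    refine ⟨⟨a • 1 + b • nonrealMatrix lam,
      add_mem (Subalgebra.smul_mem _ (one_mem _) _) (Subalgebra.smul_mem _ hM _)⟩,
      Subtype.ext ?_⟩
    refine (algAHom_apply _ _ _ _ _).trans ?_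
    simp [nonrealMatrix]

lemma adjointMatrix_mul_self : (adjointMatrix * adjointMatrix : Matrix (Fin 5) (Fin 5) 𝕜) = 1 := by
  ext i j
  fin_cases i <;> fin_cases j <;>
    simp [adjointMatrix, Matrix.mul_apply, Fin.sum_univ_five] <;> norm_num

lemma intertwines_adjointMatrix (lam mu : 𝕜) :
    Intertwines lam mu (1 - mu) (1 - lam) adjointMatrix :=
  intertwines_of_jetRelations rfl (by ring) isUpper_adjointMatrix
      (jetRelations_adjointMatrix lam mu)

/-- The adjoint intertwines the weights `(lam, mu)` and `(1 - mu, 1 - lam)` in both directions, so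
conjugation by it carries symmetries to symmetries. -/
lemma adjoint_conj_mem (hC : C ∈ symMat lam mu) :
    adjointMatrix * C * adjointMatrix ∈ symMat (1 - mu) (1 - lam) := by
  have hA := isUpper_adjointMatrix (𝕜 := 𝕜)
  refine ⟨(hA.mul hC.1).mul hA, mem_coeffSymmetryAlgebra.2 fun f a => ?_⟩
  have h1 := intertwines_adjointMatrix (1 - mu) (1 - lam)
  rw [sub_sub_cancel, sub_sub_cancel] at h1
  rw [opV_mul (hA.mul hC.1) hA, opV_mul hA hC.1, Module.End.mul_apply, Module.End.mul_apply,
    Module.End.mul_apply, Module.End.mul_apply, h1, mem_coeffSymmetryAlgebra.1 hC.2,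
    intertwines_adjointMatrix]

/-- Taking adjoints identifies the local symmetries for `(lam, mu)` and `(1 - mu, 1 - lam)`. -/
def adjointEquiv (lam mu lam' mu' : 𝕜) (h : lam' = 1 - mu) (h' : mu' = 1 - lam) :
    symMat lam mu ≃ₐ[𝕜] symMat lam' mu' :=
  AlgEquiv.ofBijective (AlgHom.ofLinearMap
    { toFun := fun C => ⟨adjointMatrix * C.1 * adjointMatrix, by
        subst h h'
        exact adjoint_conj_mem C.2⟩
      map_add' := fun C C' => Subtype.ext (by
        change _ * (C.1 + C'.1) * _ = _
        rw [mul_add, add_mul]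
        rfl)
      map_smul' := fun c C => Subtype.ext (by
        change _ * (c • C.1) * _ = _
        rw [mul_smul_comm, smul_mul_assoc]
        rfl) }
    (Subtype.ext (by
      change _ * (1 : Matrix (Fin 5) (Fin 5) 𝕜) * _ = 1
      rw [mul_one, adjointMatrix_mul_self]))
    fun C C' => Subtype.ext (by
      change _ * (C.1 * C'.1) * _ = (_ * C.1 * _) * (_ * C'.1 * _)
      simp only [mul_assoc]
      rw [← mul_assoc adjointMatrix adjointMatrix, adjointMatrix_mul_self, one_mul])) (by
    constructor
    · intro C C' hCC
      have h1 : adjointMatrix * C.1 * adjointMatrix = adjointMatrix * C'.1 * adjointMatrix :=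
        congrArg Subtype.val hCC
      have h2 := congrArg (fun M => adjointMatrix * M * adjointMatrix) h1
      simp only [mul_assoc, adjointMatrix_mul_self, mul_one] at h2
      simp only [← mul_assoc, adjointMatrix_mul_self, one_mul] at h2
      exact Subtype.ext h2
    · intro C
      have hmem := adjoint_conj_mem C.2
      rw [show 1 - mu' = lam by rw [h']; ring, show 1 - lam' = mu by rw [h]; ring] at hmem
      refine ⟨⟨_, hmem⟩, Subtype.ext ?_⟩
      change adjointMatrix * (adjointMatrix * C.1 * adjointMatrix) * adjointMatrix = C.1
      simp only [mul_assoc, adjointMatrix_mul_self, mul_one]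
      simp only [← mul_assoc, adjointMatrix_mul_self, one_mul])

end LocalSymmetries

/-! ### The exceptional weights `(0, 1)`. -/

section Nonlocal

variable {𝕜 : Type*} [RCLike 𝕜]

lemma zeroOneMatrix_mem (x₀ x₁ x₂ x₃ y : 𝕜) : zeroOneMatrix x₀ x₁ x₂ x₃ y ∈ symMat (0 : 𝕜) 1 :=
  mem_symMat_of (isUpper_zeroOneMatrix _ _ _ _ _) (sub_zero _)
    (jetRelations_zeroOneMatrix _ _ _ _ _)

/-- The difference of the two matrices is a symmetry whose first four diagonal entries and first
superdiagonal entry vanish, and the reduced system leaves no such symmetry but zero. -/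
lemma eq_zeroOneMatrix {C : Matrix (Fin 5) (Fin 5) 𝕜} (hC : C ∈ symMat (0 : 𝕜) 1) :
    C = zeroOneMatrix (C 0 0) (C 1 1) (C 2 2) (C 3 3) (C 0 1) := by
  have hD := sub_mem hC (zeroOneMatrix_mem (C 0 0) (C 1 1) (C 2 2) (C 3 3) (C 0 1))
  rw [← sub_eq_zero]
  generalize hE : C - zeroOneMatrix (C 0 0) (C 1 1) (C 2 2) (C 3 3) (C 0 1) = E at *
  have x0 : E 0 0 = 0 := by simp [← hE, zeroOneMatrix]
  have x1 : E 1 1 = 0 := by simp [← hE, zeroOneMatrix]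
  have x2 : E 2 2 = 0 := by simp [← hE, zeroOneMatrix]
  have x3 : E 3 3 = 0 := by simp [← hE, zeroOneMatrix]
  have y1 : E 0 1 = 0 := by simp [← hE, zeroOneMatrix]
  have a1 : E 0 0 - E 1 1 = 0 := by rw [x0, x1, sub_zero]
  have a2 : E 1 1 - E 2 2 = 0 := by rw [x1, x2, sub_zero]
  have a3 : E 2 2 - E 3 3 = 0 := by rw [x2, x3, sub_zero]
  have hr := reducedSystem_of_mem hD
  rw [a1, a2, a3, y1, sub_zero] at hr
  obtain ⟨a4, y2, y3, y4⟩ := hr.eq_zero_of_zero_one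
  exact eq_zero_of_diffs hD x0 a1 a2 a3 a4 y1 y2 y3 y4

/-- By `eq_zeroOneMatrix` a symmetry is determined by four diagonal entries and the entry at `(0,
1)`, so only these entries of the product have to be computed. -/
lemma zeroOneMatrix_mul (x₀ x₁ x₂ x₃ y x₀' x₁' x₂' x₃' y' : 𝕜) :
    zeroOneMatrix (x₀ * x₀') (x₁ * x₁') (x₂ * x₂') (x₃ * x₃') (x₀ * y' + y * x₁') =
      zeroOneMatrix x₀ x₁ x₂ x₃ y * zeroOneMatrix x₀' x₁' x₂' x₃' y' := by
  have h := isUpper_zeroOneMatrix x₀ x₁ x₂ x₃ y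
  have h' := isUpper_zeroOneMatrix x₀' x₁' x₂' x₃' y'
  rw [eq_zeroOneMatrix (mul_mem (zeroOneMatrix_mem x₀ x₁ x₂ x₃ y)
    (zeroOneMatrix_mem x₀' x₁' x₂' x₃' y')), h.mul_apply_self h', h.mul_apply_self h',
    h.mul_apply_self h', h.mul_apply_self h', h.mul_apply_succ h' (by rfl)]
  rfl

lemma zeroOneMatrix_one : (zeroOneMatrix 1 1 1 1 0 : Matrix (Fin 5) (Fin 5) 𝕜) = 1 := by
  rw [eq_zeroOneMatrix (one_mem (symMat (0 : 𝕜) 1)), Matrix.one_apply_ne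
      (show (0 : Fin 5) ≠ 1 by decide)]
  simp only [Matrix.one_apply_eq]

lemma zeroOneMatrix_add (x₀ x₁ x₂ x₃ y x₀' x₁' x₂' x₃' y' : 𝕜) :
    zeroOneMatrix (x₀ + x₀') (x₁ + x₁') (x₂ + x₂') (x₃ + x₃') (y + y') =
      zeroOneMatrix x₀ x₁ x₂ x₃ y + zeroOneMatrix x₀' x₁' x₂' x₃' y' := by
  rw [eq_zeroOneMatrix (add_mem (zeroOneMatrix_mem x₀ x₁ x₂ x₃ y)
    (zeroOneMatrix_mem x₀' x₁' x₂' x₃' y'))]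
  rfl

lemma zeroOneMatrix_smul (c x₀ x₁ x₂ x₃ y : 𝕜) :
    zeroOneMatrix (c * x₀) (c * x₁) (c * x₂) (c * x₃) (c * y) = c • zeroOneMatrix x₀ x₁ x₂ x₃ y := by
  rw [eq_zeroOneMatrix (Subalgebra.smul_mem _ (zeroOneMatrix_mem x₀ x₁ x₂ x₃ y) c)]
  rfl

lemma integralCircle_ddx (u : SmoothFun 𝕜) : integralCircle (ddx 𝕜 u) = 0 := by
  have h : integralCircle (ddx 𝕜 u) = u.1 1 - u.1 0 :=
    intervalIntegral.integral_deriv_eq_sub (fun x _ => (u.2.1.differentiable (by simp)) x)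
      ((ddx 𝕜 u).2.1.continuous.intervalIntegrable _ _)
  have h1 := u.2.2 0
  rw [zero_add] at h1
  rw [h, h1, sub_self]

lemma integralCircle_ddx_pow {n : ℕ} (hn : n ≠ 0) (u : SmoothFun 𝕜) :
    integralCircle ((ddx 𝕜 ^ n) u) = 0 := by
  obtain ⟨m, rfl⟩ := Nat.exists_eq_succ_of_ne_zero hn
  rw [pow_succ', Module.End.mul_apply, integralCircle_ddx]

lemma integralCircle_algebraMap (c : 𝕜) : integralCircle (algebraMap 𝕜 (SmoothFun 𝕜) c) = c := by
  change ∫ x in (0 : ℝ)..1, c = c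
  simp

/-- All terms with `j > 0` are derivatives and integrate to zero over the circle. -/
lemma integralCircle_opV (C : Matrix (Fin 5) (Fin 5) 𝕜) (a : Fin 5 → SmoothFun 𝕜) :
    integralCircle (opV C a 0) = C 0 0 * integralCircle (a 0) := by
  rw [opV_apply, map_sum, Finset.sum_eq_single 0]
  · rw [map_smul, smul_eq_mul, Fin.val_zero, Nat.sub_zero, pow_zero, Module.End.one_apply]
  · intro j _ hj
    rw [map_smul, integralCircle_ddx_pow, smul_zero]
    have := Fin.pos_of_ne_zero hj
    have := Fin.lt_def.1 this
    simpa using this.ne'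
  · simp

lemma opV_single_one {C : Matrix (Fin 5) (Fin 5) 𝕜} (hC : IsUpper C) (c : 𝕜) :
    opV C (Pi.single 1 (algebraMap 𝕜 (SmoothFun 𝕜) c)) =
      Pi.single 1 (algebraMap 𝕜 (SmoothFun 𝕜) (C 1 1 * c)) := by
  funext i
  rw [opV_apply, Finset.sum_eq_single 1]
  · rw [Pi.single_eq_same]
    rcases lt_trichotomy i 1 with hi | rfl | hi
    · obtain rfl : i = 0 := by omega
      rw [Pi.single_eq_of_ne (by decide), Fin.val_zero, Fin.val_one, Nat.sub_zero, pow_one,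
        ddx_algebraMap, smul_zero]
    · rw [Pi.single_eq_same, Nat.sub_self, pow_zero, Module.End.one_apply, map_mul,
        Algebra.smul_def]
    · rw [hC i 1 hi, zero_smul, Pi.single_eq_of_ne hi.ne']
  · intro j _ hj
    rw [Pi.single_eq_of_ne hj, map_zero, smul_zero]
  · simp

/-- The general symmetry at `(0, 1)`. -/
def zeroOneOp (x₀ x₁ x₂ x₃ y κ : 𝕜) : Module.End 𝕜 (Fin 5 → SmoothFun 𝕜) :=
  opV (zeroOneMatrix x₀ x₁ x₂ x₃ y) + κ • nonlocalOp

lemma zeroOneOp_apply (x₀ x₁ x₂ x₃ y κ : 𝕜) (a : Fin 5 → SmoothFun 𝕜) :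
    zeroOneOp x₀ x₁ x₂ x₃ y κ a = opV (zeroOneMatrix x₀ x₁ x₂ x₃ y) a +
      Pi.single 1 (algebraMap 𝕜 (SmoothFun 𝕜) (κ * integralCircle (a 0))) := by
  change _ + κ • nonlocalOp a = _
  rw [nonlocalOp_apply, ← Pi.single_smul, map_mul, Algebra.smul_def]

lemma zeroOneOp_mem (x₀ x₁ x₂ x₃ y κ : 𝕜) :
    zeroOneOp x₀ x₁ x₂ x₃ y κ ∈ CoeffSymmetryAlgebra (0 : 𝕜) 1 :=
  add_mem (zeroOneMatrix_mem _ _ _ _ _).2 (Subalgebra.smul_mem _ nonlocalOp_mem _)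

lemma zeroOneOp_one : zeroOneOp 1 1 1 1 0 (0 : 𝕜) = 1 := by
  refine LinearMap.ext fun a => ?_
  rw [zeroOneOp_apply, zeroOneMatrix_one, opV_one, zero_mul, map_zero, Pi.single_zero, add_zero]

lemma zeroOneOp_add (x₀ x₁ x₂ x₃ y κ x₀' x₁' x₂' x₃' y' κ' : 𝕜) :
    zeroOneOp (x₀ + x₀') (x₁ + x₁') (x₂ + x₂') (x₃ + x₃') (y + y') (κ + κ') =
      zeroOneOp x₀ x₁ x₂ x₃ y κ + zeroOneOp x₀' x₁' x₂' x₃' y' κ' := by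
  refine LinearMap.ext fun a => ?_
  rw [LinearMap.add_apply]
  simp only [zeroOneOp_apply]
  rw [zeroOneMatrix_add, opV_add, LinearMap.add_apply, add_mul, map_add, Pi.single_add]
  abel

lemma zeroOneOp_smul (c x₀ x₁ x₂ x₃ y κ : 𝕜) :
    zeroOneOp (c * x₀) (c * x₁) (c * x₂) (c * x₃) (c * y) (c * κ) =
      c • zeroOneOp x₀ x₁ x₂ x₃ y κ := by
  refine LinearMap.ext fun a => ?_
  rw [LinearMap.smul_apply]
  simp only [zeroOneOp_apply]
  rw [zeroOneMatrix_smul, opV_smul, LinearMap.smul_apply, smul_add, ← Pi.single_smul, mul_assoc,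
    map_mul, Algebra.smul_def c (algebraMap 𝕜 (SmoothFun 𝕜) _)]

/-- The nonlocal part composes with the local one only through the characters `x₀` and `x₁`:
integrals of derivatives vanish, derivatives of constants vanish, and the nonlocal part squares to
zero since its values have no order zero coefficient. Thus `y` and `κ` multiply like the entries `d`
and `c` of the algebra `𝔟`. -/
lemma zeroOneOp_mul (x₀ x₁ x₂ x₃ y κ x₀' x₁' x₂' x₃' y' κ' : 𝕜) :
    zeroOneOp (x₀ * x₀') (x₁ * x₁') (x₂ * x₂') (x₃ * x₃') (x₀ * y' + y * x₁') (κ * x₀' + x₁ * κ') =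
      zeroOneOp x₀ x₁ x₂ x₃ y κ * zeroOneOp x₀' x₁' x₂' x₃' y' κ' := by
  refine LinearMap.ext fun a => ?_
  rw [Module.End.mul_apply]
  simp only [zeroOneOp_apply]
  have h0 : (zeroOneMatrix x₀' x₁' x₂' x₃' y' : Matrix (Fin 5) (Fin 5) 𝕜) 0 0 = x₀' := rfl
  have h1 : (zeroOneMatrix x₀ x₁ x₂ x₃ y : Matrix (Fin 5) (Fin 5) 𝕜) 1 1 = x₁ := rfl
  rw [map_add, opV_single_one (isUpper_zeroOneMatrix _ _ _ _ _), h1, Pi.add_apply,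
    Pi.single_eq_of_ne (by decide), add_zero, integralCircle_opV, h0, zeroOneMatrix_mul,
    opV_mul (isUpper_zeroOneMatrix _ _ _ _ _) (isUpper_zeroOneMatrix _ _ _ _ _),
    Module.End.mul_apply, add_assoc, ← Pi.single_add, ← map_add]
  congr 3
  ring

/-- Parametrization of the symmetries at `(0, 1)`. -/
def algBHom : (AlgB 𝕜 × (Fin 2 → 𝕜)) →ₐ[𝕜] CoeffSymmetryAlgebra (0 : 𝕜) 1 :=
  AlgHom.ofLinearMap
    { toFun := fun p => ⟨zeroOneOp (p.1.1 0 0) (p.1.1 2 2) (p.2 0) (p.2 1) (p.1.1 0 3) (p.1.1 2 1),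
        zeroOneOp_mem _ _ _ _ _ _⟩
      map_add' := fun _ _ => Subtype.ext (zeroOneOp_add _ _ _ _ _ _ _ _ _ _ _ _)
      map_smul' := fun _ _ => Subtype.ext (zeroOneOp_smul _ _ _ _ _ _ _) }
    (Subtype.ext zeroOneOp_one)
    (by
      rintro ⟨⟨_, a, b, c, d, rfl⟩, v⟩ ⟨⟨_, a', b', c', d', rfl⟩, v'⟩
      refine Subtype.ext (Eq.trans ?_ (zeroOneOp_mul _ _ _ _ _ _ _ _ _ _ _ _))
      change zeroOneOp _ _ _ _ _ _ = zeroOneOp _ _ _ _ _ _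
      congr 1 <;> simp [Matrix.mul_apply, Fin.sum_univ_four])

lemma algBHom_bijective : Function.Bijective (algBHom (𝕜 := 𝕜)) := by
  constructor
  · refine (injective_iff_map_eq_zero _).2 ?_
    rintro ⟨⟨_, a, b, c, d, rfl⟩, v⟩ h
    have h1 : ∀ u, zeroOneOp a b (v 0) (v 1) d c u = 0 := fun u =>
      congrArg (fun T : CoeffSymmetryAlgebra (0 : 𝕜) 1 => T.1 u) h
    -- On the operator of multiplication by `1`, the order one coefficient of the value is the
    -- constant `c`, since the local part is triangular.
    have hc : c = 0 := by
      have h2 := congrArg (integralCircle (𝕜 := 𝕜))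
        (congrFun (h1 (Pi.single 0 (algebraMap 𝕜 (SmoothFun 𝕜) 1))) 1)
      rw [zeroOneOp_apply, Pi.add_apply, Pi.single_eq_same, Pi.single_eq_same,
        integralCircle_algebraMap, map_add, integralCircle_algebraMap, opV_apply,
        Finset.sum_eq_single 0, isUpper_zeroOneMatrix _ _ _ _ _ 1 0 (by decide), zero_smul,
        map_zero, zero_add, mul_one, Pi.zero_apply, map_zero] at h2
      · exact h2
      · intro j _ hj
        rw [Pi.single_eq_of_ne hj, map_zero, smul_zero]
      · simp
    subst hc
    have h3 := eq_zero_of_opV_eq_zero (isUpper_zeroOneMatrix a b (v 0) (v 1) d) fun u => by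
      have := h1 u
      rwa [zeroOneOp_apply, zero_mul, map_zero, Pi.single_zero, add_zero] at this
    have ha : a = 0 := congrFun (congrFun h3 0) 0
    have hb : b = 0 := congrFun (congrFun h3 1) 1
    have h20 : v 0 = 0 := congrFun (congrFun h3 2) 2
    have h21 : v 1 = 0 := congrFun (congrFun h3 3) 3
    have hd : d = 0 := congrFun (congrFun h3 0) 1
    subst ha hb hd
    refine Prod.ext (Subtype.ext ?_) (funext fun t => ?_)
    · ext i j
      fin_cases i <;> fin_cases j <;> rfl
    · fin_cases t
      exacts [h20, h21]
  · rintro ⟨T, hT⟩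
    obtain ⟨κ, hκ⟩ := exists_isLocalAtZero_sub hT
    have hmem := sub_smul_nonlocalOp_mem hT κ
    obtain ⟨C, hC, h⟩ := exists_eq_opV hmem hκ
    have hC' : C ∈ symMat (0 : 𝕜) 1 := ⟨hC, h ▸ hmem⟩
    refine ⟨⟨⟨_, C 0 0, C 1 1, κ, C 0 1, rfl⟩, ![C 2 2, C 3 3]⟩, Subtype.ext
      (LinearMap.ext fun a => ?_)⟩
    have h2 : T a - κ • nonlocalOp a = opV C a := congrArg (fun S => S a) h
    rw [eq_zeroOneMatrix hC', sub_eq_iff_eq_add] at h2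
    exact h2.symm

lemma nonempty_symmetryAlgebra_zero_one :
    Nonempty (SymmetryAlgebra 4 (0 : 𝕜) 1 ≃ₐ[𝕜] (AlgB 𝕜 × (Fin 2 → 𝕜))) :=
  ⟨(symmetryAlgebraEquiv 0 1).trans (AlgEquiv.ofBijective algBHom algBHom_bijective).symm⟩

end Nonlocal


/-! ### Transfer to the symmetry algebra of operators. -/

section Main

variable {𝕜 : Type*} [RCLike 𝕜] {lam mu : 𝕜}

lemma symmetryAlgebra_eq_bot (h0 : lam ≠ 0) (h1 : mu ≠ 1) (h2 : lam + mu ≠ 1)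
    (h3 : ¬ (2 * lam ^ 2 + 2 * lam + 1 = 0 ∧ mu = lam + 2)) :
    SymmetryAlgebra 4 lam mu = ⊥ := by
  rw [eq_bot_iff]
  intro T hT
  let e := symMatEquiv (𝕜 := 𝕜) (lam := lam) (mu := mu) fun h => h0 h.1
  have hbot : (e ⟨T, hT⟩).1 ∈ (⊥ : Subalgebra 𝕜 (Matrix (Fin 5) (Fin 5) 𝕜)) :=
    symMat_eq_bot h0 h1 h2 h3 ▸ (e ⟨T, hT⟩).2
  obtain ⟨c, hc⟩ := Algebra.mem_bot.1 hbot
  have h : (⟨T, hT⟩ : SymmetryAlgebra 4 lam mu) = algebraMap 𝕜 _ c := by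
    apply e.injective
    rw [AlgEquiv.commutes]
    exact Subtype.ext hc.symm
  exact Algebra.mem_bot.2 ⟨c, (congrArg Subtype.val h).symm⟩

lemma nonempty_symmetryAlgebra_equiv {R : Type*} [Semiring R] [Algebra 𝕜 R]
    (hne : ¬ (lam = 0 ∧ mu = 1)) (h : Nonempty (symMat lam mu ≃ₐ[𝕜] R)) :
    Nonempty (SymmetryAlgebra 4 lam mu ≃ₐ[𝕜] R) :=
  h.map (symMatEquiv hne).trans

lemma nonempty_symMat_adjoint {R : Type*} [Semiring R] [Algebra 𝕜 R] {lam' mu' : 𝕜}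
    (h : lam' = 1 - mu) (h' : mu' = 1 - lam) (e : Nonempty (symMat lam' mu' ≃ₐ[𝕜] R)) :
    Nonempty (symMat lam mu ≃ₐ[𝕜] R) :=
  e.map (adjointEquiv lam mu lam' mu' h h').trans

end Main

end CircleDO

end

theorem theorem3p2 {𝕜 : Type*} [RCLike 𝕜] (lam mu : 𝕜) :
    -- trivial, except on the three lines and (only over `ℂ`) at two non-real points
    (lam + mu ≠ 1 → lam ≠ 0 → mu ≠ 1 → ¬ (2 * lam ^ 2 + 2 * lam + 1 = 0 ∧ mu = lam + 2) →
      CircleDO.SymmetryAlgebra 4 lam mu = ⊥) ∧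
    -- 1.
    ((lam + mu = 1 ∧ lam ≠ 0 ∧ lam ≠ -2 / 3) ∨
      (lam = 0 ∧ mu ≠ 3 ∧ mu ≠ 5 / 4 ∧ mu ≠ 1 ∧ mu ≠ 0) ∨
      (mu = 1 ∧ lam ≠ 1 ∧ lam ≠ 0 ∧ lam ≠ -1 / 4 ∧ lam ≠ -2) →
      Nonempty (CircleDO.SymmetryAlgebra 4 lam mu ≃ₐ[𝕜] (Fin 2 → 𝕜))) ∧
    -- 2.
    ((lam, mu) = (1, 1) ∨ (lam, mu) = (0, 5 / 4) ∨ (lam, mu) = (0, 0) ∨ (lam, mu) = (-1 / 4, 1) ∨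
      (lam, mu) = (-2 / 3, 5 / 3) →
      Nonempty (CircleDO.SymmetryAlgebra 4 lam mu ≃ₐ[𝕜] (Fin 3 → 𝕜))) ∧
    -- 3.
    ((lam, mu) = (0, 3) ∨ (lam, mu) = (-2, 1) →
      Nonempty (CircleDO.SymmetryAlgebra 4 lam mu ≃ₐ[𝕜] (CircleDO.AlgA 𝕜 × 𝕜))) ∧
    -- 4.
    ((lam, mu) = (0, 1) →
      Nonempty (CircleDO.SymmetryAlgebra 4 lam mu ≃ₐ[𝕜] (CircleDO.AlgB 𝕜 × (Fin 2 → 𝕜)))) ∧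
    -- the two non-real points; this case is void over `ℝ`
    (2 * lam ^ 2 + 2 * lam + 1 = 0 ∧ mu = lam + 2 →
      Nonempty (CircleDO.SymmetryAlgebra 4 lam mu ≃ₐ[𝕜] CircleDO.AlgA 𝕜)) := by
  refine ⟨fun h2 h0 h1 h3 => CircleDO.symmetryAlgebra_eq_bot h0 h1 h2 h3, ?_, ?_, ?_, ?_, ?_⟩
  · rintro (⟨h, h0, h1⟩ | ⟨rfl, h3, h2, h1, h0⟩ | ⟨rfl, h1, h0, h4, h2⟩)
    · exact CircleDO.nonempty_symmetryAlgebra_equiv (fun h' => h0 h'.1)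
        (CircleDO.nonempty_symMat_self_dual h h0 h1)
    · exact CircleDO.nonempty_symmetryAlgebra_equiv (fun h' => h1 h'.2)
        (CircleDO.nonempty_symMat_zero h0 h1 h2 h3)
    -- The adjoint exchanges `(lam, 1)` with `(0, 1 - lam)`, so the excluded values `1, 0, -1/4, -2`
    -- of `lam` correspond to `mu = 0, 1, 5/4, 3`.
    · refine CircleDO.nonempty_symmetryAlgebra_equiv (fun h' => h0 h'.1)
        (CircleDO.nonempty_symMat_adjoint (sub_self 1).symm rfl
            (CircleDO.nonempty_symMat_zero ?_ ?_ ?_ ?_))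
      · exact fun h => h1 (by linear_combination -h)
      · exact fun h => h0 (by linear_combination -h)
      · exact fun h => h4 (by linear_combination -h)
      · exact fun h => h2 (by linear_combination -h)
  · simp only [Prod.mk.injEq]
    rintro (⟨rfl, rfl⟩ | ⟨rfl, rfl⟩ | ⟨rfl, rfl⟩ | ⟨rfl, rfl⟩ | ⟨rfl, rfl⟩)
    · exact CircleDO.nonempty_symmetryAlgebra_equiv (by norm_num)
        (CircleDO.nonempty_symMat_adjoint (sub_self 1).symm (sub_self 1).symm
            CircleDO.nonempty_symMat_zero_zero)
    · exact CircleDO.nonempty_symmetryAlgebra_equiv (by norm_num)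
        CircleDO.nonempty_symMat_zero_five_fourths
    · exact CircleDO.nonempty_symmetryAlgebra_equiv (by norm_num) CircleDO.nonempty_symMat_zero_zero
    · exact CircleDO.nonempty_symmetryAlgebra_equiv (by norm_num)
        (CircleDO.nonempty_symMat_adjoint (sub_self 1).symm (by norm_num)
            CircleDO.nonempty_symMat_zero_five_fourths)
    · exact CircleDO.nonempty_symmetryAlgebra_equiv (by norm_num)
        CircleDO.nonempty_symMat_neg_two_thirds
  · simp only [Prod.mk.injEq]
    rintro (⟨rfl, rfl⟩ | ⟨rfl, rfl⟩)
    · exact CircleDO.nonempty_symmetryAlgebra_equiv (by norm_num)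
        CircleDO.nonempty_symMat_zero_three
    · exact CircleDO.nonempty_symmetryAlgebra_equiv (by norm_num)
        (CircleDO.nonempty_symMat_adjoint (sub_self 1).symm (by norm_num)
            CircleDO.nonempty_symMat_zero_three)
  · simp only [Prod.mk.injEq]
    rintro ⟨rfl, rfl⟩
    exact CircleDO.nonempty_symmetryAlgebra_zero_one
  · rintro ⟨h, rfl⟩
    refine CircleDO.nonempty_symmetryAlgebra_equiv (fun h' => ?_)
        (CircleDO.nonempty_symMat_nonreal h rfl)
    rw [h'.1] at h
    norm_num at h
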